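/- Let $\mu_{\mathrm B}=\mathcal N(m_{\mathrm B},\Sigma_{\mathrm B})$ be a Gaussian measure on $\mathbb R^d$ with arbitrary mean $m_{\mathrm B}\in\mathbb R^d$ and arbitrary (symmetric) positive definite covariance matrix $\Sigma_{\mathrm B}$, and let $\rho_{\mathrm B}=\frac{\mathrm d\mu_{\mathrm B}}{\mathrm dx}$. Let $\rho_*$ be a probability density on $\mathbb R^d$ with $\rho_*\log\rho_*\in L^1(\mathbb R^d)$ such that, for some $M>0$ and $\sigma_\bullet>0$, $$\rho_*(x)\le \frac{1}{(2\pi\sigma_\bullet^2)^{d/2}}\,e^{-\frac{\|x\|^2}{2\sigma_\bullet^2}}\qquad\text{for all }\|x\|\ge M,$$ and let $\mu_*$ be the measure with $\frac{\mathrm d\mu_*}{\mathrm dx}=\rho_*$. Then for every $T>0$ and $\varepsilon>0$ there is $\theta=(w,a,b):[0,T]\to\mathbb R^d\times\mathbb R^d\times\mathbb R$, piecewise constant with finitely many switches (that is, constant on each interval $[t_{k-1},t_k)$ of some subdivision $0=t_0<t_1<\dots<t_K=T$), such that the following holds. The continuity equation $$\partial_t\rho(t,x)+\operatorname{div}\big(w(t)\,(a(t)^\top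 x+b(t))_+\,\rho(t,x)\big)=0\ \text{ in }[0,T]\times\mathbb R^d,\qquad \rho(0,\cdot)=\rho_{\mathrm B},$$ has a weak solution $\rho\in C^0([0,T];L^1(\mathbb R^d))\cap L^\infty([0,T]\times\mathbb R^d)$, and every such solution satisfies $\rho(T,\cdot)>0$ almost everywhere, $\rho_*\log\frac{\rho_*}{\rho(T,\cdot)}\in L^1(\mathbb R^d)$ and $$\int_{\mathbb R^d}\rho_*(x)\log\frac{\rho_*(x)}{\rho(T,x)}\,\mathrm dx\le\varepsilon .$$ Equivalently, $\mathsf{KL}\big(\mu_*\,\|\,\Phi^T_{\theta\#}\mu_{\mathrm B}\big)\le\varepsilon$, where $\Phi^T_\theta:\mathbb R^d\to\mathbb R^d$, $x\mapsto x(T)$, is the (existing and unique) time-$T$ flow map of $\dot x(t)=w(t)\,(a(t)^\top x(t)+b(t))_+$, $x(0)=x$. -/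

import Mathlib

open MeasureTheory Set Filter Topology
open scoped ENNReal

noncomputable section

namespace NeuralFlow

/-- `ℝ^d` with its Euclidean norm. -/
abbrev E (d : ℕ) : Type := EuclideanSpace ℝ (Fin d)

/-- The parameters `(w, a, b) ∈ ℝ^d × ℝ^d × ℝ`. -/
abbrev Param (d : ℕ) : Type := E d × E d × ℝ

/-- The perceptron velocity field `v(x, (w, a, b)) = w (aᵀ x + b)_+`. -/
def velocity {d : ℕ} (x : E d) (p : Param d) : E d :=
  max (inner ℝ p.2.1 x + p.2.2) 0 • p.1

/-- `θ` is piecewise constant on `[0, T]` with finitely many switches: there is a subdivision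
`0 = t_0 < t_1 < ⋯ < t_K = T` such that `θ` is constant on every `[t_k, t_{k+1})`. -/
def IsPiecewiseConstant {d : ℕ} (T : ℝ) (θ : ℝ → Param d) : Prop :=
  ∃ (K : ℕ) (t : Fin (K + 1) → ℝ) (p : Fin K → Param d),
    StrictMono t ∧ t 0 = 0 ∧ t (Fin.last K) = T ∧
      ∀ k : Fin K, ∀ s ∈ Ico (t k.castSucc) (t k.succ), θ s = p k

/-- `Φ` is the flow on `[0, T]` of `ẋ(t) = v(x(t), θ(t))`: for every `x`, the curve `t ↦ Φ t x` is
the (Carathéodory) solution that starts at `x`. -/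
structure IsFlow {d : ℕ} (T : ℝ) (θ : ℝ → Param d) (Φ : ℝ → E d → E d) : Prop where
  continuousOn : ∀ x, ContinuousOn (fun t => Φ t x) (Icc 0 T)
  eq_integral : ∀ x, ∀ t ∈ Icc (0 : ℝ) T, Φ t x = x + ∫ s in (0 : ℝ)..t, velocity (Φ s x) (θ s)

/-- `ρ ∈ C⁰([0, T]; L¹)`, bounded in `L^∞` uniformly in time, solves
`∂_t ρ + div (v(x, θ(t)) ρ) = 0` on `[0, T] × ℝ^d` with `ρ(0) = ρB`, in the sense of distributions,
i.e. tested against compactly supported `C¹` functions of `x`. -/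
structure IsSolution {d : ℕ} (T : ℝ) (θ : ℝ → Param d) (ρB : E d → ℝ)
    (ρ : ℝ → (E d →₁[volume] ℝ)) : Prop where
  continuousOn : ContinuousOn ρ (Icc 0 T)
  bounded : ∃ C : ℝ, ∀ t ∈ Icc (0 : ℝ) T, ∀ᵐ x, |ρ t x| ≤ C
  initial : ρ 0 =ᵐ[volume] ρB
  weak_eq : ∀ φ : E d → ℝ, ContDiff ℝ 1 φ → HasCompactSupport φ → ∀ t ∈ Icc (0 : ℝ) T,
    ∫ x, φ x * ρ t x = (∫ x, φ x * ρB x) +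
      ∫ s in (0 : ℝ)..t, ∫ x, fderiv ℝ φ x (velocity x (θ s)) * ρ s x

/-- `ρ` is a probability density on `ℝ^d`. -/
structure IsProbDensity {d : ℕ} (ρ : E d → ℝ) : Prop where
  nonneg : ∀ x, 0 ≤ ρ x
  integrable : Integrable ρ
  integral_eq_one : ∫ x, ρ x = 1

/-- The measure `ρ dx`. -/
def densityMeasure {d : ℕ} (ρ : E d → ℝ) : Measure (E d) :=
  volume.withDensity fun x => ENNReal.ofReal (ρ x)

/-- The Lebesgue density `dμ/dx`. -/
def lebesgueDensity {d : ℕ} (μ : Measure (E d)) (x : E d) : ℝ :=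
  (μ.rnDeriv volume x).toReal

end NeuralFlow

end

open MeasureTheory Set Filter Topology
open scoped ENNReal

noncomputable section

namespace NeuralFlow

/-! Everything is computed backwards in time. The inverse of the time-T map is again a composition
`Ψ` of perceptron flows, and with Jacobian `e^ℓ` it turns the final density into `ρ_B(Ψ x)
e^{ℓ(x)}`. A nondegenerate Gaussian is the image of the standard one under an affine map that is
itself such a composition (`exists_reachable_sqrt`). So it suffices to pull the standard Gaussian
back to a density close to `ρ_*` in divergence (`exists_reachable_divergence_le`).

The map used is a discrete Knothe–Rosenblatt rearrangement. On a grid of `[-R, R)^d` the mass of a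
cell is a product of conditional probabilities, one per coordinate. Coordinate `i` is moved by an
increasing piecewise linear map, selected by the cell of the earlier coordinates, that sends the
cells of `[-R, R)` to intervals of prescribed Gaussian mass (`exists_lineReachable_of_weights`,
`exists_limitReachable_grid`). Such a map is a composition of dilations of half-lines, which are
flows with `a` parallel to `w`. To confine a dilation to a cylinder, conjugate it by a shear made of
flows with `a ⟂ w`: the shear vanishes on the cylinder and is so large off it that points land where
the dilation is the identity (`limitReachable_localize_dil`). This is exact only in the limit, but
every point sees the limit value from some index on. With uniform linear growth and bounded
Jacobians, the second moment of `ρ_*`, finite by the Gaussian tail, lets dominated convergence carry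
the divergence over (`LimitReachable.exists_reachable`).

Inside the box the pullback dominates, up to a factor near `1`, the cell averages of `ρ_*`; Lebesgue
differentiation and Fatou's lemma make these averages lose little entropy
(`exists_entropy_stepAvg_le`). Outside it stays above a multiple of the Gaussian, at a cost
controlled by the second moment.

The claim about every solution needs uniqueness for a field that is only Lipschitz. Smoothing the
rectifier admits test functions transported by the flow (`IsWeakOn.comp_flow`), so a weak solution
is the pushed-forward density (`IsWeakOn.eq_push`). -/

/-! ### The explicit flow of one perceptron field -/

/-- The primitive `∫₀ᵗ e^{cs} ds`. -/
def expPrim (c t : ℝ) : ℝ := if c = 0 then t else (Real.exp (c * t) - 1) / c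

lemma expPrim_zero_right (c : ℝ) : expPrim c 0 = 0 := by
  unfold expPrim; split_ifs <;> simp

lemma mul_expPrim (c t : ℝ) : c * expPrim c t = Real.exp (c * t) - 1 := by
  unfold expPrim
  split_ifs with h
  · simp [h]
  · field_simp

lemma expPrim_add (c s t : ℝ) :
    expPrim c (s + t) = expPrim c t + expPrim c s * Real.exp (c * t) := by
  unfold expPrim
  split_ifs with h
  · simp [h]; ring
  · rw [mul_add, Real.exp_add]; field_simp; ring

lemma hasDerivAt_expPrim (c t : ℝ) : HasDerivAt (expPrim c) (Real.exp (c * t)) t := by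
  by_cases h : c = 0
  · have : expPrim c = id := by ext s; simp [expPrim, h]
    rw [this]; simpa [h] using hasDerivAt_id t
  · have : expPrim c = fun s => (Real.exp (c * s) - 1) / c := by ext s; simp [expPrim, h]
    rw [this]
    have h1 : HasDerivAt (fun s => (Real.exp (c * s) - 1) / c)
        (Real.exp (c * t) * (c * 1) / c) t :=
      ((((hasDerivAt_id t).const_mul c).exp).sub_const 1).div_const c
    convert h1 using 1
    field_simp

lemma continuous_expPrim (c : ℝ) : Continuous (expPrim c) :=
  continuous_iff_continuousAt.2 fun t => (hasDerivAt_expPrim c t).continuousAt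

lemma expPrim_mul_scale (c : ℝ) {τ : ℝ} (hτ : τ ≠ 0) :
    expPrim (c / τ) τ = τ * expPrim c 1 := by
  unfold expPrim
  by_cases h : c = 0
  · simp [h]
  · simp only [div_eq_zero_iff, h, hτ, or_self, if_false]
    field_simp

variable {d : ℕ}

/-- The preactivation `aᵀ x + b`. -/
def preact (p : Param d) (x : E d) : ℝ := inner ℝ p.2.1 x + p.2.2

/-- The growth rate `aᵀ w`. -/
def rate (p : Param d) : ℝ := inner ℝ p.2.1 p.1

/-- The time-`t` flow map of the autonomous field `velocity · p`. -/
def flow (p : Param d) (t : ℝ) (x : E d) : E d :=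
  x + (expPrim (rate p) t * max (preact p x) 0) • p.1

/-- The logarithm of the Jacobian determinant of `flow p t`. -/
def logJac (p : Param d) (t : ℝ) (x : E d) : ℝ := if 0 < preact p x then rate p * t else 0

lemma velocity_eq (p : Param d) (x : E d) : velocity x p = max (preact p x) 0 • p.1 := rfl

@[fun_prop]
lemma continuous_preact (p : Param d) : Continuous (preact p) := by
  unfold preact; fun_prop

@[fun_prop]
lemma continuous_velocity (p : Param d) : Continuous (fun x => velocity x p) := by
  unfold velocity; fun_prop

lemma continuous_flow_uncurry (p : Param d) :
    Continuous (fun z : ℝ × E d => flow p z.1 z.2) := by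
  unfold flow
  have := continuous_expPrim (rate p)
  fun_prop

@[fun_prop]
lemma continuous_flow (p : Param d) (t : ℝ) : Continuous (flow p t) :=
  (continuous_flow_uncurry p).comp (by fun_prop : Continuous fun x : E d => (t, x))

lemma continuous_flow_time (p : Param d) (x : E d) : Continuous (fun t => flow p t x) :=
  (continuous_flow_uncurry p).comp (by fun_prop : Continuous fun t : ℝ => (t, x))

lemma flow_zero (p : Param d) (x : E d) : flow p 0 x = x := by
  simp [flow, expPrim_zero_right]

lemma preact_flow (p : Param d) (t : ℝ) (x : E d) :
    preact p (flow p t x) = preact p x + (Real.exp (rate p * t) - 1) * max (preact p x) 0 := by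
  rw [← mul_expPrim]
  simp only [preact, flow, rate, inner_add_right, inner_smul_right]
  ring

lemma preact_flow_of_pos {p : Param d} {x : E d} (h : 0 < preact p x) (t : ℝ) :
    preact p (flow p t x) = Real.exp (rate p * t) * preact p x := by
  rw [preact_flow, max_eq_left h.le]; ring

lemma flow_of_nonpos {p : Param d} {x : E d} (h : preact p x ≤ 0) (t : ℝ) :
    flow p t x = x := by
  simp [flow, max_eq_right h]

/-- The preactivation is multiplied by an exponential where it is positive and frozen elsewhere, so
no trajectory crosses the hyperplane. -/
lemma preact_flow_pos_iff (p : Param d) (t : ℝ) (x : E d) :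
    0 < preact p (flow p t x) ↔ 0 < preact p x := by
  by_cases h : 0 < preact p x
  · simp only [h, iff_true, preact_flow_of_pos h]
    exact mul_pos (Real.exp_pos _) h
  · rw [flow_of_nonpos (not_lt.1 h)]

lemma max_preact_flow (p : Param d) (t : ℝ) (x : E d) :
    max (preact p (flow p t x)) 0 = Real.exp (rate p * t) * max (preact p x) 0 := by
  by_cases h : 0 < preact p x
  · rw [max_eq_left ((preact_flow_pos_iff p t x).2 h).le, max_eq_left h.le, preact_flow_of_pos h]
  · rw [flow_of_nonpos (not_lt.1 h), max_eq_right (not_lt.1 h), mul_zero]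

lemma flow_add (p : Param d) (s t : ℝ) (x : E d) :
    flow p (s + t) x = flow p s (flow p t x) := by
  conv_rhs => rw [flow]
  rw [max_preact_flow, flow, flow, expPrim_add]
  module

lemma flow_neg_flow (p : Param d) (t : ℝ) (x : E d) : flow p (-t) (flow p t x) = x := by
  rw [← flow_add, neg_add_cancel, flow_zero]

lemma flow_flow_neg (p : Param d) (t : ℝ) (x : E d) : flow p t (flow p (-t) x) = x := by
  rw [← flow_add, add_neg_cancel, flow_zero]

lemma velocity_flow (p : Param d) (t : ℝ) (x : E d) :
    velocity (flow p t x) p = (Real.exp (rate p * t) * max (preact p x) 0) • p.1 := by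
  rw [velocity_eq, max_preact_flow]

lemma hasDerivAt_flow (p : Param d) (x : E d) (t : ℝ) :
    HasDerivAt (fun s => flow p s x) (velocity (flow p t x) p) t := by
  rw [velocity_flow]
  exact (((hasDerivAt_expPrim (rate p) t).mul_const _).smul_const p.1).const_add x

lemma logJac_add (p : Param d) (s t : ℝ) (x : E d) :
    logJac p (s + t) x = logJac p t x + logJac p s (flow p t x) := by
  simp only [logJac, preact_flow_pos_iff]
  split_ifs <;> ring

lemma logJac_zero (p : Param d) (x : E d) : logJac p 0 x = 0 := by
  simp [logJac]

lemma abs_logJac_le (p : Param d) (t : ℝ) (x : E d) : |logJac p t x| ≤ |rate p| * |t| := by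
  unfold logJac
  split_ifs
  · rw [abs_mul]
  · simp; positivity

lemma continuous_logJac_time (p : Param d) (x : E d) : Continuous (fun t => logJac p t x) := by
  unfold logJac; split_ifs <;> fun_prop

@[fun_prop]
lemma measurable_logJac (p : Param d) (t : ℝ) : Measurable (logJac p t) :=
  Measurable.ite (measurableSet_lt measurable_const (continuous_preact p).measurable)
    measurable_const measurable_const

/-- `flow p t` as a homeomorphism. -/
def flowHomeo (p : Param d) (t : ℝ) : E d ≃ₜ E d where
  toFun := flow p t
  invFun := flow p (-t)
  left_inv := flow_neg_flow p t
  right_inv := flow_flow_neg p t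
  continuous_toFun := continuous_flow p t
  continuous_invFun := continuous_flow p (-t)

lemma measurableEmbedding_flow (p : Param d) (t : ℝ) : MeasurableEmbedding (flow p t) :=
  (flowHomeo p t).measurableEmbedding

/-! ### Change of variables -/

/-- `Ψ` is a change of variables of `ℝ^d` with Jacobian `e^ℓ`. -/
structure IsChange (Ψ : E d → E d) (ℓ : E d → ℝ) : Prop where
  embedding : MeasurableEmbedding Ψ
  measurable_log : Measurable ℓ
  map_eq : (volume.withDensity fun x => ENNReal.ofReal (Real.exp (ℓ x))).map Ψ = volume

lemma isChange_id : IsChange (id : E d → E d) 0 :=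
  ⟨MeasurableEmbedding.id, measurable_const, by simp⟩

lemma IsChange.lintegral_comp {Ψ : E d → E d} {ℓ : E d → ℝ} (h : IsChange Ψ ℓ)
    (f : E d → ℝ≥0∞) :
    ∫⁻ x, ENNReal.ofReal (Real.exp (ℓ x)) * f (Ψ x) = ∫⁻ x, f x := by
  have hm : Measurable fun x => ENNReal.ofReal (Real.exp (ℓ x)) :=
    (h.measurable_log.exp).ennreal_ofReal
  conv_rhs => rw [← h.map_eq]
  rw [h.embedding.lintegral_map, lintegral_withDensity_eq_lintegral_mul_non_measurable₀ _
    hm.aemeasurable (by simp)]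
  rfl

lemma IsChange.integral_comp {Ψ : E d → E d} {ℓ : E d → ℝ} (h : IsChange Ψ ℓ)
    (f : E d → ℝ) :
    ∫ x, Real.exp (ℓ x) * f (Ψ x) = ∫ x, f x := by
  have hm : Measurable fun x => (Real.exp (ℓ x)).toNNReal :=
    (h.measurable_log.exp).real_toNNReal
  conv_rhs => rw [← h.map_eq]
  rw [h.embedding.integral_map]
  have := integral_withDensity_eq_integral_smul (μ := (volume : Measure (E d))) hm
    (fun x => f (Ψ x))
  rw [show (fun x => ENNReal.ofReal (Real.exp (ℓ x))) =
    fun x => (((Real.exp (ℓ x)).toNNReal : NNReal) : ℝ≥0∞) from rfl, this]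
  refine integral_congr_ae (ae_of_all _ fun x => ?_)
  simp [NNReal.smul_def, Real.coe_toNNReal _ (Real.exp_pos (ℓ x)).le]

lemma IsChange.integrable_comp {Ψ : E d → E d} {ℓ : E d → ℝ} (h : IsChange Ψ ℓ)
    {f : E d → ℝ} (hf : Integrable f) : Integrable fun x => Real.exp (ℓ x) * f (Ψ x) := by
  have hm : Measurable fun x => (Real.exp (ℓ x)).toNNReal :=
    (h.measurable_log.exp).real_toNNReal
  rw [← h.map_eq, h.embedding.integrable_map_iff] at hf
  rw [show (fun x => ENNReal.ofReal (Real.exp (ℓ x))) =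
    fun x => (((Real.exp (ℓ x)).toNNReal : NNReal) : ℝ≥0∞) from rfl,
    integrable_withDensity_iff_integrable_smul hm] at hf
  refine hf.congr (ae_of_all _ fun x => ?_)
  simp [NNReal.smul_def, Real.coe_toNNReal _ (Real.exp_pos (ℓ x)).le]

lemma IsChange.quasiMeasurePreserving {Ψ : E d → E d} {ℓ : E d → ℝ} (h : IsChange Ψ ℓ) :
    Measure.QuasiMeasurePreserving Ψ volume volume := by
  refine ⟨h.embedding.measurable, ?_⟩
  conv_rhs => rw [← h.map_eq]
  refine Measure.AbsolutelyContinuous.map ?_ h.embedding.measurable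
  exact withDensity_absolutelyContinuous' (h.measurable_log.exp.ennreal_ofReal).aemeasurable
    (ae_of_all _ fun x => by simp [Real.exp_pos])

lemma IsChange.comp {Ψ₁ Ψ₂ : E d → E d} {ℓ₁ ℓ₂ : E d → ℝ} (h₂ : IsChange Ψ₂ ℓ₂)
    (h₁ : IsChange Ψ₁ ℓ₁) : IsChange (Ψ₂ ∘ Ψ₁) (fun x => ℓ₁ x + ℓ₂ (Ψ₁ x)) := by
  refine ⟨h₂.embedding.comp h₁.embedding,
    h₁.measurable_log.add (h₂.measurable_log.comp h₁.embedding.measurable), ?_⟩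
  ext s hs
  have hm : Measurable (Ψ₂ ∘ Ψ₁) := h₂.embedding.measurable.comp h₁.embedding.measurable
  rw [Measure.map_apply hm hs, withDensity_apply _ (hm hs), ← lintegral_indicator (hm hs)]
  rw [← lintegral_indicator_one hs, ← h₂.lintegral_comp (s.indicator 1),
    ← h₁.lintegral_comp (fun x => _ * s.indicator 1 (Ψ₂ x))]
  refine lintegral_congr fun x => ?_
  by_cases hx : Ψ₂ (Ψ₁ x) ∈ s
  · simp [indicator, hx, Real.exp_add, ENNReal.ofReal_mul (Real.exp_pos _).le]
  · simp [indicator, hx]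

/-- The derivative of `flow p t` on the half-space where it moves. -/
def flowDeriv (p : Param d) (t : ℝ) : E d →L[ℝ] E d :=
  ContinuousLinearMap.id ℝ (E d) +
    (innerSL ℝ p.2.1).smulRight (expPrim (rate p) t • p.1)

/-- A rank-one perturbation of the identity has determinant `1 + aᵀw ∫₀ᵗ e^{cs} ds` with `c = aᵀw`,
which integrates to the exponential. -/
lemma det_flowDeriv (p : Param d) (t : ℝ) : (flowDeriv p t).det = Real.exp (rate p * t) := by
  have h : ((flowDeriv p t : E d →L[ℝ] E d) : E d →ₗ[ℝ] E d) =
      LinearMap.transvection (innerₛₗ ℝ p.2.1) (expPrim (rate p) t • p.1) := by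
    ext x
    simp [flowDeriv, LinearMap.transvection.apply]
  rw [ContinuousLinearMap.det, h, LinearMap.transvection.det]
  have := mul_expPrim (rate p) t
  simp only [map_smul, innerₛₗ_apply_apply, smul_eq_mul]
  change 1 + expPrim (rate p) t * rate p = _
  linarith

lemma hasFDerivWithinAt_flow (p : Param d) (t : ℝ) (x : E d) (hx : x ∈ {x | 0 < preact p x}) :
    HasFDerivWithinAt (flow p t) (flowDeriv p t) {x | 0 < preact p x} x := by
  have h1 : HasFDerivAt (fun x : E d => x + (expPrim (rate p) t * (inner ℝ p.2.1 x + p.2.2)) • p.1)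
      (flowDeriv p t) x := by
    have h2 : HasFDerivAt (fun x : E d => inner ℝ p.2.1 x + p.2.2) (innerSL ℝ p.2.1) x :=
      (innerSL ℝ p.2.1).hasFDerivAt.add_const _
    have h3 := (hasFDerivAt_id x).add ((h2.const_mul (expPrim (rate p) t)).smul_const p.1)
    refine h3.congr_fderiv ?_
    ext1 y
    simp [flowDeriv, smul_smul, mul_comm]
  refine h1.hasFDerivWithinAt.congr (fun y hy => ?_) ?_
  · simp only [flow, max_eq_left (le_of_lt (show 0 < preact p y from hy))]; rfl
  · simp only [flow, max_eq_left (le_of_lt (show 0 < preact p x from hx))]; rfl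

/-- The flow is not differentiable across the hyperplane, but it preserves both sides: on the open
moving side it is affine, on the complement it is the identity. The two contributions are compared
separately. -/
lemma isChange_flow (p : Param d) (t : ℝ) : IsChange (flow p t) (logJac p t) := by
  refine ⟨measurableEmbedding_flow p t, measurable_logJac p t, ?_⟩
  set S : Set (E d) := {x | 0 < preact p x} with hS
  have hSm : MeasurableSet S := measurableSet_lt measurable_const (continuous_preact p).measurable
  have himg : flow p t '' S = S := by
    ext y
    constructor
    · rintro ⟨x, hx, rfl⟩; exact (preact_flow_pos_iff p t x).2 hx
    · intro hy
      exact ⟨flow p (-t) y, (preact_flow_pos_iff p (-t) y).2 hy, flow_flow_neg p t y⟩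
  ext s hs
  have hm : MeasurableSet (flow p t ⁻¹' s) := (continuous_flow p t).measurable hs
  rw [Measure.map_apply (continuous_flow p t).measurable hs, withDensity_apply _ hm,
    ← lintegral_indicator hm, ← lintegral_indicator_one hs,
    ← lintegral_add_compl _ hSm, ← lintegral_add_compl (s.indicator 1) hSm]
  congr 1
  · conv_rhs => rw [← himg]
    rw [lintegral_image_eq_lintegral_abs_det_fderiv_mul volume hSm
      (fun x hx => hasFDerivWithinAt_flow p t x hx) (measurableEmbedding_flow p t).injective.injOn]
    refine setLIntegral_congr_fun hSm fun x hx => ?_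
    have hx' : 0 < preact p x := hx
    by_cases hy : flow p t x ∈ s <;>
      simp [det_flowDeriv, indicator, logJac, if_pos hx', hy]
  · refine setLIntegral_congr_fun hSm.compl fun x hx => ?_
    have hx' : ¬ 0 < preact p x := hx
    by_cases hy : x ∈ s <;>
      simp [indicator, logJac, if_neg hx', flow_of_nonpos (not_lt.1 hx'), hy]

lemma IsChange.ae_iff {Ψ : E d → E d} {ℓ : E d → ℝ} (h : IsChange Ψ ℓ) {P : E d → Prop} :
    (∀ᵐ x, P x) ↔ ∀ᵐ x, P (Ψ x) := by
  conv_lhs => rw [← h.map_eq]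
  rw [h.embedding.ae_map_iff, ae_withDensity_iff (h.measurable_log.exp.ennreal_ofReal)]
  simp [Real.exp_pos]

/-! ### Compositions of perceptron flows -/

/-- `Ψ` is a composition of finitely many unit-time perceptron flows and `e^ℓ` is its Jacobian. -/
inductive Reachable : (E d → E d) → (E d → ℝ) → Prop
  | id : Reachable id 0
  | comp_flow {Ψ ℓ} (p : Param d) : Reachable Ψ ℓ →
      Reachable (Ψ ∘ flow p 1) (fun x => logJac p 1 x + ℓ (flow p 1 x))

lemma Reachable.isChange {Ψ : E d → E d} {ℓ : E d → ℝ} (h : Reachable Ψ ℓ) : IsChange Ψ ℓ := by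
  induction h with
  | id => exact isChange_id
  | comp_flow p _ ih => exact ih.comp (isChange_flow p 1)

lemma Reachable.continuous {Ψ : E d → E d} {ℓ : E d → ℝ} (h : Reachable Ψ ℓ) :
    Continuous Ψ := by
  induction h with
  | id => exact continuous_id
  | comp_flow p _ ih => exact ih.comp (continuous_flow p 1)

lemma Reachable.comp {Ψ₁ Ψ₂ : E d → E d} {ℓ₁ ℓ₂ : E d → ℝ} (h₂ : Reachable Ψ₂ ℓ₂)
    (h₁ : Reachable Ψ₁ ℓ₁) : Reachable (Ψ₂ ∘ Ψ₁) (fun x => ℓ₁ x + ℓ₂ (Ψ₁ x)) := by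
  induction h₁ with
  | id => simpa using h₂
  | comp_flow p _ ih =>
    have := ih.comp_flow p
    simpa [Function.comp_def, add_assoc] using this

lemma reachable_flow (p : Param d) : Reachable (flow p 1) (logJac p 1) := by
  simpa [Function.comp_def] using (Reachable.id (d := d)).comp_flow p

lemma Reachable.exists_abs_log_le {Ψ : E d → E d} {ℓ : E d → ℝ} (h : Reachable Ψ ℓ) :
    ∃ C, ∀ x, |ℓ x| ≤ C := by
  induction h with
  | id => exact ⟨0, by simp⟩
  | comp_flow p _ ih =>
    obtain ⟨C, hC⟩ := ih
    exact ⟨|rate p| * |1| + C, fun x =>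
      (abs_add_le _ _).trans (add_le_add (abs_logJac_le p 1 x) (hC _))⟩

/-- The flow map at time `n * τ` of the control that equals `p k` on `[k * τ, (k + 1) * τ)`. -/
def stageMap (p : ℕ → Param d) (τ : ℝ) : ℕ → E d → E d
  | 0 => id
  | n + 1 => flow (p n) τ ∘ stageMap p τ n

/-- The inverse of `stageMap`. -/
def stageInv (p : ℕ → Param d) (τ : ℝ) : ℕ → E d → E d
  | 0 => id
  | n + 1 => stageInv p τ n ∘ flow (p n) (-τ)

/-- The logarithm of the Jacobian of `stageInv`. -/
def stageLog (p : ℕ → Param d) (τ : ℝ) : ℕ → E d → ℝ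
  | 0 => 0
  | n + 1 => fun x => logJac (p n) (-τ) x + stageLog p τ n (flow (p n) (-τ) x)

lemma stageMap_stageInv (p : ℕ → Param d) (τ : ℝ) (n : ℕ) (x : E d) :
    stageMap p τ n (stageInv p τ n x) = x := by
  induction n generalizing x with
  | zero => rfl
  | succ n ih => simp [stageInv, stageMap, flow_flow_neg, ih]

lemma continuous_stageMap (p : ℕ → Param d) (τ : ℝ) (n : ℕ) : Continuous (stageMap p τ n) := by
  induction n with
  | zero => exact continuous_id
  | succ n ih => exact (continuous_flow _ _).comp ih

lemma isChange_stageInv (p : ℕ → Param d) (τ : ℝ) (n : ℕ) :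
    IsChange (stageInv p τ n) (stageLog p τ n) := by
  induction n with
  | zero => exact isChange_id
  | succ n ih => exact ih.comp (isChange_flow (p n) (-τ))

lemma stage_congr {p q : ℕ → Param d} (τ : ℝ) {n : ℕ} (h : ∀ k < n, p k = q k) :
    stageInv p τ n = stageInv q τ n ∧ stageLog p τ n = stageLog q τ n := by
  induction n with
  | zero => exact ⟨rfl, rfl⟩
  | succ n ih =>
    obtain ⟨h1, h2⟩ := ih fun k hk => h k (hk.trans n.lt_succ_self)
    simp only [stageInv, stageLog, h1, h2, h n n.lt_succ_self, and_self]

lemma rate_scale (p : Param d) (τ : ℝ) : rate (τ⁻¹ • p.1, p.2) = rate p / τ := by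
  simp [rate, inner_smul_right, div_eq_inv_mul]

lemma preact_scale (p : Param d) (τ : ℝ) : preact (τ⁻¹ • p.1, p.2) = preact p := rfl

lemma flow_scale (p : Param d) {τ : ℝ} (hτ : τ ≠ 0) : flow (τ⁻¹ • p.1, p.2) τ = flow p 1 := by
  ext1 x
  simp only [flow, rate_scale, preact_scale, expPrim_mul_scale _ hτ, smul_smul]
  congr 2
  field_simp

lemma logJac_scale (p : Param d) {τ : ℝ} (hτ : τ ≠ 0) :
    logJac (τ⁻¹ • p.1, p.2) τ = logJac p 1 := by
  ext1 x
  simp only [logJac, rate_scale, preact_scale]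
  field_simp

/-- A composition of unit-time flows is the inverse flow map of a piecewise constant control whose
number of stages does not depend on their common length. -/
lemma Reachable.exists_stage {Ψ : E d → E d} {ℓ : E d → ℝ} (h : Reachable Ψ ℓ) :
    ∃ n : ℕ, 0 < n ∧ ∀ τ : ℝ, τ ≠ 0 → ∃ p : ℕ → Param d,
      stageInv p τ n = Ψ ∧ stageLog p τ n = ℓ := by
  induction h with
  | id =>
    refine ⟨1, one_pos, fun τ _ => ⟨0, ?_, ?_⟩⟩
    · ext1 x; simp [stageInv, flow]
    · ext1 x; simp [stageLog, logJac, rate]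
  | comp_flow q _ ih =>
    obtain ⟨n, -, hn⟩ := ih
    refine ⟨n + 1, n.succ_pos, fun τ hτ => ?_⟩
    obtain ⟨p, h1, h2⟩ := hn τ hτ
    -- `Reachable` grows on the inside and `stageInv` undoes the last stage first, so the new factor
    -- is stage `n`. Dividing `w` by `-τ` makes the inverse of this stage, a flow for time `-τ`,
    -- equal to the unit-time flow of `q`.
    refine ⟨Function.update p n ((-τ)⁻¹ • q.1, q.2), ?_⟩
    obtain ⟨h3, h4⟩ := stage_congr (p := Function.update p n ((-τ)⁻¹ • q.1, q.2)) (q := p) τ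
      (n := n) fun k hk => Function.update_of_ne hk.ne _ _
    have hτ' : -τ ≠ 0 := neg_ne_zero.2 hτ
    simp only [stageInv, stageLog, h3, h4, Function.update_self, flow_scale q hτ',
      logJac_scale q hτ', h1, h2, and_self]

/-! ### Pointwise limits of compositions of perceptron flows -/

/-- `(Ψ, ℓ)` is, at every point, eventually equal to a sequence of compositions of flows of
uniformly linear growth and uniformly bounded Jacobian. -/
def LimitReachable (Ψ : E d → E d) (ℓ : E d → ℝ) : Prop :=
  ∃ (Ψn : ℕ → E d → E d) (ℓn : ℕ → E d → ℝ) (C : ℝ), 0 ≤ C ∧ (∀ n, Reachable (Ψn n) (ℓn n)) ∧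
    (∀ x, ∀ᶠ n in atTop, Ψn n x = Ψ x ∧ ℓn n x = ℓ x) ∧
    (∀ n x, ‖Ψn n x‖ ≤ C * (1 + ‖x‖)) ∧ ∀ n x, |ℓn n x| ≤ C

lemma limitReachable_id : LimitReachable (id : E d → E d) 0 :=
  ⟨fun _ => id, fun _ => 0, 1, zero_le_one, fun _ => Reachable.id, fun x => by simp,
    fun n x => by simp, fun n x => by simp⟩

/-- Eventual equality survives composition where mere convergence would not: `Ψ₂` may be
discontinuous, but once `A n x = Ψ₁ x` the outer sequence is evaluated at a fixed point. -/
lemma LimitReachable.comp {Ψ₁ Ψ₂ : E d → E d} {ℓ₁ ℓ₂ : E d → ℝ} (h₂ : LimitReachable Ψ₂ ℓ₂)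
    (h₁ : LimitReachable Ψ₁ ℓ₁) :
    LimitReachable (Ψ₂ ∘ Ψ₁) (fun x => ℓ₁ x + ℓ₂ (Ψ₁ x)) := by
  obtain ⟨A, a, C, hC, hA, hAe, hAn, hAl⟩ := h₁
  obtain ⟨B, b, D, hD, hB, hBe, hBn, hBl⟩ := h₂
  refine ⟨fun n => B n ∘ A n, fun n x => a n x + b n (A n x), D * (1 + C) + C + D,
    by positivity, fun n => (hB n).comp (hA n), fun x => ?_, fun n x => ?_, fun n x => ?_⟩
  · filter_upwards [hAe x, hBe (Ψ₁ x)] with n h1 h2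
    simp [h1.1, h1.2, h2.1, h2.2]
  · have h1 := hBn n (A n x)
    have h2 := hAn n x
    have h3 : D * (1 + ‖A n x‖) ≤ D * (1 + C * (1 + ‖x‖)) := by gcongr
    have h4 : 0 ≤ D * ‖x‖ := by positivity
    have h5 : 0 ≤ C * ‖x‖ := by positivity
    simp only [Function.comp]
    nlinarith
  · have h1 := abs_add_le (a n x) (b n (A n x))
    have h2 := hAl n x
    have h3 := hBl n (A n x)
    have : 0 ≤ D * (1 + C) := by positivity
    linarith

/-! ### Shears and localized one-dimensional maps -/

/-- The `i`-th vector of the standard basis. -/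
def basisVec (i : Fin d) : E d := EuclideanSpace.single i 1

@[simp] lemma basisVec_self (i : Fin d) : basisVec i i = 1 := by simp [basisVec]

lemma basisVec_ne {i j : Fin d} (h : j ≠ i) : basisVec i j = 0 := by simp [basisVec, h]

@[simp] lemma norm_basisVec (i : Fin d) : ‖basisVec i‖ = 1 := by simp [basisVec]

@[simp] lemma inner_basisVec_left (i : Fin d) (x : E d) : inner ℝ (basisVec i) x = x i := by
  simp [basisVec, EuclideanSpace.inner_single_left]

lemma abs_apply_le_norm (x : E d) (i : Fin d) : |x i| ≤ ‖x‖ := by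
  simpa using PiLp.norm_apply_le x i

/-- `s` does not depend on the `i`-th coordinate, and the shears `x ↦ x ± s(x) e_i` are compositions
of perceptron flows. -/
structure IsShear (i : Fin d) (s : E d → ℝ) : Prop where
  indep : ∀ (x : E d) (r : ℝ), s (x + r • basisVec i) = s x
  add : Reachable (fun x => x + s x • basisVec i) 0
  sub : Reachable (fun x => x - s x • basisVec i) 0

lemma isShear_zero (i : Fin d) : IsShear i (fun _ => 0) :=
  ⟨fun _ _ => rfl, by simpa using! Reachable.id, by simpa using! Reachable.id⟩

/-- Neither function sees the `i`-th coordinate, the only one that shears move, so composing the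
shears adds the functions. -/
lemma IsShear.sum_pair {i : Fin d} {s t : E d → ℝ} (hs : IsShear i s) (ht : IsShear i t) :
    IsShear i (fun x => s x + t x) := by
  refine ⟨fun x r => by rw [hs.indep, ht.indep], ?_, ?_⟩
  · have := ht.add.comp hs.add
    convert this using 1
    · ext1 x
      simp only [Function.comp, ht.indep]
      module
    · ext1; simp
  · have := ht.sub.comp hs.sub
    convert this using 1
    · ext1 x
      have := ht.indep x (-s x)
      simp only [neg_smul, ← sub_eq_add_neg] at this
      simp only [Function.comp, this]
      module
    · ext1; simp

lemma isShear_sum {ι : Type*} {i : Fin d} (J : Finset ι) {s : ι → E d → ℝ}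
    (h : ∀ j ∈ J, IsShear i (s j)) : IsShear i (fun x => ∑ j ∈ J, s j x) := by
  classical
  induction J using Finset.induction_on with
  | empty => simpa using isShear_zero i
  | insert a J ha ih =>
    simp only [Finset.sum_insert ha]
    exact (h a (Finset.mem_insert_self _ _)).sum_pair
      (ih fun j hj => h j (Finset.mem_insert_of_mem hj))

/-- Here `a` is orthogonal to `w`: the preactivation is constant in time, the motion is linear in
time and preserves volume. -/
lemma reachable_ridge {i j : Fin d} (hij : j ≠ i) (σ k b : ℝ) :
    Reachable (fun x : E d => x + (k * max (σ * x j + b) 0) • basisVec i) 0 := by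
  have h0 : rate (k • basisVec i, σ • basisVec j, b) = 0 := by
    simp [rate, inner_smul_left, inner_smul_right, basisVec_ne hij]
  convert reachable_flow (k • basisVec i, σ • basisVec j, b) using 1
  · ext1 x
    simp [flow, h0, expPrim, preact, inner_smul_left, smul_smul, mul_comm]
  · ext1 x
    simp [logJac, h0]

lemma isShear_ridge {i j : Fin d} (hij : j ≠ i) (σ k b : ℝ) :
    IsShear i (fun x : E d => k * max (σ * x j + b) 0) := by
  refine ⟨fun x r => by simp [basisVec_ne hij], reachable_ridge hij σ k b, ?_⟩
  simpa [sub_eq_add_neg] using reachable_ridge hij σ (-k) b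

/-- The dilation by the factor `e^c` of the half-line `(-∞, b]` about `b`. -/
def dil (b c y : ℝ) : ℝ := y - (Real.exp c - 1) * max (b - y) 0

/-- The logarithm of the derivative of `dil`. -/
def dilLog (b c y : ℝ) : ℝ := if y < b then c else 0

lemma reachable_dil (i : Fin d) (b c : ℝ) :
    Reachable (fun x : E d => x + (dil b c (x i) - x i) • basisVec i)
      (fun x => dilLog b c (x i)) := by
  have h0 : rate ((-c) • basisVec i, -basisVec i, b) = c := by
    simp [rate, inner_smul_right]
  have h1 := mul_expPrim c 1
  convert reachable_flow ((-c) • basisVec i, -basisVec i, b) using 1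
  · ext1 x
    simp only [flow, h0, preact, inner_neg_left, inner_basisVec_left, smul_smul, dil]
    rw [show -x i + b = b - x i by ring]
    congr 2
    rw [mul_one] at h1
    rw [← h1]; ring
  · ext1 x
    simp only [logJac, h0, dilLog, preact, inner_neg_left, inner_basisVec_left, neg_add_eq_sub,
      sub_pos, mul_one]

/-- Conjugating the dilation by the shear moves its threshold from `b` to `b - s x`, a threshold
that depends on the other coordinates. -/
lemma reachable_sheared_dil {i : Fin d} {s : E d → ℝ} (hs : IsShear i s) (b c : ℝ) :
    Reachable (fun x : E d => x + (dil b c (x i + s x) - (x i + s x)) • basisVec i)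
      (fun x => dilLog b c (x i + s x)) := by
  convert hs.sub.comp ((reachable_dil i b c).comp hs.add) using 1
  · ext1 x
    simp only [Function.comp, hs.indep, PiLp.add_apply, PiLp.smul_apply, basisVec_self,
      smul_eq_mul, mul_one]
    module
  · ext1 x; simp

/-- The half-open box of the points whose coordinates in `J` lie in `[α j, β j)`. -/
def cylinder (J : Finset (Fin d)) (α β : Fin d → ℝ) : Set (E d) :=
  {x | ∀ j ∈ J, α j ≤ x j ∧ x j < β j}

open Classical in
/-- Apply `h` to the `i`-th coordinate at the points of `Q`. -/
def localize (i : Fin d) (Q : Set (E d)) (h : ℝ → ℝ) (x : E d) : E d :=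
  if x ∈ Q then x + (h (x i) - x i) • basisVec i else x

open Classical in
/-- The logarithm of the Jacobian of `localize`. -/
def localizeLog (i : Fin d) (Q : Set (E d)) (l : ℝ → ℝ) (x : E d) : ℝ :=
  if x ∈ Q then l (x i) else 0

/-- The sum of ridge functions that tends to `0` on a half-open box and to `∞` off it. -/
def barrier (J : Finset (Fin d)) (α β : Fin d → ℝ) (n : ℕ) (x : E d) : ℝ :=
  ∑ j ∈ J, (((n : ℝ) + 1) ^ 2 * max (1 * x j + (((n : ℝ) + 1)⁻¹ - β j)) 0 +
    ((n : ℝ) + 1) ^ 2 * max ((-1) * x j + α j) 0)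

lemma isShear_barrier {i : Fin d} {J : Finset (Fin d)} (hi : i ∉ J) (α β : Fin d → ℝ) (n : ℕ) :
    IsShear i (barrier J α β n) :=
  isShear_sum J fun j hj =>
    have hji : j ≠ i := fun h => hi (h ▸ hj)
    (isShear_ridge hji _ _ _).sum_pair (isShear_ridge hji _ _ _)

lemma barrier_nonneg (J : Finset (Fin d)) (α β : Fin d → ℝ) (n : ℕ) (x : E d) :
    0 ≤ barrier J α β n x :=
  Finset.sum_nonneg fun j _ => by positivity

lemma barrier_eventually_eq_zero {J : Finset (Fin d)} {α β : Fin d → ℝ} {x : E d}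
    (hx : x ∈ cylinder J α β) : ∀ᶠ n in atTop, barrier J α β n x = 0 := by
  have h : ∀ j ∈ J, ∀ᶠ n : ℕ in atTop, ((n : ℝ) + 1)⁻¹ < β j - x j := fun j hj =>
    (tendsto_inv_atTop_zero.comp
      (tendsto_atTop_add_const_right _ 1 tendsto_natCast_atTop_atTop)).eventually_lt_const
      (sub_pos.2 (hx j hj).2)
  filter_upwards [(Filter.eventually_all_finset J).2 h] with n hn
  refine Finset.sum_eq_zero fun j hj => ?_
  have h1 := hn j hj
  rw [max_eq_right, max_eq_right]
  · simp
  · linarith [(hx j hj).1]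
  · linarith

/-- The delicate points have `x j = β j`: the ramp there has height only `1 / (n + 1)`, and the
slope `(n + 1) ^ 2` still makes it diverge. Shifting the ramp by `1 / (n + 1)` is what makes the
upper face excluded. -/
lemma tendsto_barrier {J : Finset (Fin d)} {α β : Fin d → ℝ} {x : E d}
    (hx : x ∉ cylinder J α β) : Tendsto (fun n => barrier J α β n x) atTop atTop := by
  simp only [cylinder, mem_ofPred_eq, not_forall] at hx
  obtain ⟨j, hj, hx⟩ := hx
  have hn : Tendsto (fun n : ℕ => (n : ℝ) + 1) atTop atTop :=
    tendsto_atTop_add_const_right _ 1 tendsto_natCast_atTop_atTop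
  have hle : ∀ n : ℕ, ((n : ℝ) + 1) ^ 2 * max (1 * x j + (((n : ℝ) + 1)⁻¹ - β j)) 0 +
      ((n : ℝ) + 1) ^ 2 * max ((-1) * x j + α j) 0 ≤ barrier J α β n x := fun n =>
    Finset.single_le_sum (f := fun j => ((n : ℝ) + 1) ^ 2 * max (1 * x j +
      (((n : ℝ) + 1)⁻¹ - β j)) 0 + ((n : ℝ) + 1) ^ 2 * max ((-1) * x j + α j) 0)
      (fun j _ => by positivity) hj
  refine tendsto_atTop_mono hle ?_
  by_cases h1 : α j ≤ x j
  · have h2 : β j ≤ x j := not_lt.1 fun h => hx ⟨h1, h⟩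
    refine tendsto_atTop_mono (fun n => ?_) hn
    have h3 : (0 : ℝ) < (n : ℝ) + 1 := by positivity
    have h4 : ((n : ℝ) + 1)⁻¹ ≤ max (1 * x j + (((n : ℝ) + 1)⁻¹ - β j)) 0 :=
      le_max_of_le_left (by linarith)
    calc (n : ℝ) + 1 = ((n : ℝ) + 1) ^ 2 * ((n : ℝ) + 1)⁻¹ := by field_simp
      _ ≤ ((n : ℝ) + 1) ^ 2 * max (1 * x j + (((n : ℝ) + 1)⁻¹ - β j)) 0 := by gcongr
      _ ≤ _ := le_add_of_nonneg_right (by positivity)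
  · push Not at h1
    have h2 : 0 < α j - x j := sub_pos.2 h1
    refine tendsto_atTop_mono (fun n => ?_) (hn.atTop_mul_const h2)
    have h3 : (1 : ℝ) ≤ (n : ℝ) + 1 := by simp
    calc ((n : ℝ) + 1) * (α j - x j) ≤ ((n : ℝ) + 1) ^ 2 * max ((-1) * x j + α j) 0 := by
          gcongr
          · nlinarith
          · exact le_max_of_le_left (by linarith)
      _ ≤ _ := le_add_of_nonneg_left (by positivity)

/-- A dilation acts only below `b`. The barrier is eventually `0` on the cylinder, and off it
eventually lifts the point above `b`, where the dilation does nothing. -/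
lemma limitReachable_localize_dil {i : Fin d} {J : Finset (Fin d)} (hi : i ∉ J)
    (α β : Fin d → ℝ) (b c : ℝ) :
    LimitReachable (localize i (cylinder J α β) (dil b c))
      (localizeLog i (cylinder J α β) (dilLog b c)) := by
  set κ := |Real.exp c - 1| with hκ
  refine ⟨fun n x => x + (dil b c (x i + barrier J α β n x) - (x i + barrier J α β n x)) •
    basisVec i, fun n x => dilLog b c (x i + barrier J α β n x), 1 + κ * (1 + |b|) + |c|,
    by positivity, fun n => reachable_sheared_dil (isShear_barrier hi α β n) b c,
    fun x => ?_, fun n x => ?_, fun n x => ?_⟩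
  · by_cases hx : x ∈ cylinder J α β
    · filter_upwards [barrier_eventually_eq_zero hx] with n hn
      simp [localize, localizeLog, hx, hn]
    · filter_upwards [(tendsto_barrier hx).eventually_ge_atTop (b - x i)] with n hn
      have h1 : ¬ x i + barrier J α β n x < b := by linarith
      simp [localize, localizeLog, hx, dil, dilLog, h1,
        max_eq_right (show b - (x i + barrier J α β n x) ≤ 0 by linarith)]
  · have h1 : |dil b c (x i + barrier J α β n x) - (x i + barrier J α β n x)| ≤
        κ * (|b| + ‖x‖) := by
      simp only [dil, sub_sub_cancel_left, abs_neg, abs_mul]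
      gcongr
      rw [abs_of_nonneg (le_max_right _ _)]
      refine max_le ?_ (by positivity)
      -- A nonnegative barrier only decreases `b - y`, so the displacement is bounded independently
      -- of `n`.
      have := barrier_nonneg J α β n x
      have h2 := neg_le_of_abs_le (abs_apply_le_norm x i)
      linarith [le_abs_self b]
    refine (norm_add_le _ _).trans ?_
    rw [norm_smul, norm_basisVec, mul_one, Real.norm_eq_abs]
    have h3 : 0 ≤ κ * |b| * ‖x‖ := by positivity
    have h4 : 0 ≤ |c| * (1 + ‖x‖) := by positivity
    have h5 : 0 ≤ κ := abs_nonneg _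
    nlinarith [h1]
  · have h0 : 0 ≤ κ * (1 + |b|) := by positivity
    have : |dilLog b c (x i + barrier J α β n x)| ≤ |c| := by
      unfold dilLog; split_ifs <;> simp
    linarith

/-- `h` is a composition of dilations of half-lines and `e^l` is its derivative. -/
inductive LineReachable : (ℝ → ℝ) → (ℝ → ℝ) → Prop
  | id : LineReachable id 0
  | dil_comp {h l} (b c : ℝ) : LineReachable h l →
      LineReachable (dil b c ∘ h) (fun y => l y + dilLog b c (h y))

lemma mem_cylinder_add {i : Fin d} {J : Finset (Fin d)} (hi : i ∉ J) (α β : Fin d → ℝ)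
    (x : E d) (r : ℝ) : x + r • basisVec i ∈ cylinder J α β ↔ x ∈ cylinder J α β := by
  refine forall₂_congr fun j hj => ?_
  simp [basisVec_ne (show j ≠ i from fun h => hi (h ▸ hj))]

/-- The cylinder does not constrain coordinate `i`, so localized maps compose exactly as the maps of
the line do. -/
lemma LineReachable.localize {h l : ℝ → ℝ} (hl : LineReachable h l) {i : Fin d}
    {J : Finset (Fin d)} (hi : i ∉ J) (α β : Fin d → ℝ) :
    LimitReachable (localize i (cylinder J α β) h) (localizeLog i (cylinder J α β) l) := by
  induction hl with
  | id =>
    convert limitReachable_id (d := d) using 1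
    · ext1 x; simp [NeuralFlow.localize]
    · ext1 x; simp [localizeLog]
  | dil_comp b c _ ih =>
    convert (limitReachable_localize_dil hi α β b c).comp ih using 1
    · ext1 x
      by_cases hx : x ∈ cylinder J α β
      · simp only [NeuralFlow.localize, hx, if_true, Function.comp, mem_cylinder_add hi,
          PiLp.add_apply, PiLp.smul_apply, basisVec_self, smul_eq_mul, mul_one]
        rw [add_sub_cancel]
        module
      · simp [NeuralFlow.localize, hx]
    · ext1 x
      by_cases hx : x ∈ cylinder J α β
      · simp [NeuralFlow.localize, localizeLog, hx, mem_cylinder_add hi]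
      · simp [NeuralFlow.localize, localizeLog, hx]

/-! ### Piecewise linear maps of the line -/

/-- The graph is built from right to left. Beyond the last knot nothing moves; left of the knots
treated so far the map is affine, and one more dilation resets its slope there. The free slope `s`
is what the induction hands over. -/
lemma LineReachable.exists_piecewise_linear (n : ℕ) (y v : ℕ → ℝ)
    (hy : ∀ j < n, y j < y (j + 1)) (hv : ∀ j < n, v j < v (j + 1)) (hn : y n = v n)
    (k m : ℕ) (hkm : m + k = n) (s : ℝ) (hs : 0 < s) :
    ∃ h l, LineReachable h l ∧ (∀ z, y n ≤ z → h z = z ∧ l z = 0) ∧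
      (∀ j, m ≤ j → j < n → ∀ z ∈ Ico (y j) (y (j + 1)),
        h z = v j + (v (j + 1) - v j) / (y (j + 1) - y j) * (z - y j) ∧
        l z = Real.log ((v (j + 1) - v j) / (y (j + 1) - y j))) ∧
      (∀ z, y m ≤ z → v m ≤ h z) ∧
      ∀ z, z < y m → h z = v m + s * (z - y m) ∧ l z = Real.log s := by
  induction k generalizing m s with
  | zero =>
    obtain rfl : m = n := hkm
    refine ⟨dil (y m) (Real.log s) ∘ _root_.id, _, LineReachable.id.dil_comp _ _, fun z hz => ?_,
      fun j h1 h2 => absurd h1 (not_le.2 h2), fun z hz => ?_, fun z hz => ?_⟩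
    · simp [dil, dilLog, max_eq_right (sub_nonpos.2 hz), not_lt.2 hz]
    · simp [dil, ← hn, hz]
    · simp only [dil, dilLog, Function.comp, _root_.id, max_eq_left (sub_nonneg.2 hz.le),
        Real.exp_log hs, hz, if_true, ← hn]
      refine ⟨by ring, by simp⟩
  | succ k ih =>
    have hmn : m < n := by omega
    have hym := hy m hmn
    have hvm := hv m hmn
    set s₁ := (v (m + 1) - v m) / (y (m + 1) - y m) with hs₁
    have hs₁p : 0 < s₁ := div_pos (sub_pos.2 hvm) (sub_pos.2 hym)
    have hs₁m : s₁ * (y (m + 1) - y m) = v (m + 1) - v m :=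
      div_mul_cancel₀ _ (sub_pos.2 hym).ne'
    obtain ⟨h, l, hr, h1, h2, h3, h4⟩ := ih (m + 1) (by omega) s₁ hs₁p
    have hlin : ∀ z, z < y (m + 1) → h z = v m + s₁ * (z - y m) := fun z hz => by
      rw [(h4 z hz).1]; linarith
    have hge : ∀ z, y m ≤ z → v m ≤ h z := fun z hz => by
      by_cases hz' : z < y (m + 1)
      · rw [hlin z hz']
        have := mul_nonneg hs₁p.le (sub_nonneg.2 hz)
        linarith
      · exact hvm.le.trans (h3 z (not_lt.1 hz'))
    have hid : ∀ z, y m ≤ z → (dil (v m) (Real.log (s / s₁)) ∘ h) z = h z ∧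
        l z + dilLog (v m) (Real.log (s / s₁)) (h z) = l z := fun z hz => by
      simp [dil, dilLog, max_eq_right (sub_nonpos.2 (hge z hz)), not_lt.2 (hge z hz)]
    -- The dilation acts on values, about `v m`: it does not touch the part at or right of `y m`,
    -- whose values are at least `v m`, and turns the slope `s₁` into `s` on the left.
    refine ⟨_, _, hr.dil_comp (v m) (Real.log (s / s₁)), fun z hz => ?_, fun j hj1 hj2 z hz => ?_,
      fun z hz => ?_, fun z hz => ?_⟩
    · have hmz : y m ≤ z := by
        have : ∀ i, m + i ≤ n → y m ≤ y (m + i) := by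
          intro i
          induction i with
          | zero => simp
          | succ i ih => exact fun hi => (ih (by omega)).trans (hy (m + i) (by omega)).le
        have := this (k + 1) (by omega)
        rw [hkm] at this
        exact this.trans hz
      rw [(hid z hmz).1, (hid z hmz).2]
      exact h1 z hz
    · rcases hj1.eq_or_lt with rfl | hj1
      · rw [(hid z hz.1).1, (hid z hz.1).2]
        exact ⟨hlin z hz.2, (h4 z hz.2).2⟩
      · have hmz : y m ≤ z := by
          have : ∀ i, m + i < n → y m ≤ y (m + i) := by
            intro i
            induction i with
            | zero => simp
            | succ i ih => exact fun hi => (ih (by omega)).trans (hy (m + i) (by omega)).le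
          have := this (j - m) (by omega)
          rw [show m + (j - m) = j by omega] at this
          exact this.trans hz.1
        rw [(hid z hmz).1, (hid z hmz).2]
        exact h2 j hj1 hj2 z hz
    · rw [(hid z hz).1]; exact hge z hz
    · have hz1 := hlin z (hz.trans hym)
      have hlt : h z < v m := by
        rw [hz1]
        have := mul_neg_of_pos_of_neg hs₁p (sub_neg.2 hz)
        linarith
      simp only [dil, dilLog, Function.comp, max_eq_left (sub_nonneg.2 hlt.le),
        Real.exp_log (div_pos hs hs₁p), hlt, if_true, (h4 z (hz.trans hym)).2]
      refine ⟨?_, ?_⟩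
      · rw [hz1]; field_simp; ring
      · rw [Real.log_div hs.ne' hs₁p.ne']; ring

/-! ### The standard Gaussian density on the line -/

/-- The density of the standard Gaussian on the line. -/
def gauss (x : ℝ) : ℝ := (√(2 * Real.pi))⁻¹ * Real.exp (-x ^ 2 / 2)

lemma gauss_pos (x : ℝ) : 0 < gauss x := by unfold gauss; positivity

@[fun_prop]
lemma continuous_gauss : Continuous gauss := by unfold gauss; fun_prop

lemma gauss_le_one (x : ℝ) : gauss x ≤ 1 := by
  have h1 : 1 ≤ √(2 * Real.pi) := by
    rw [Real.one_le_sqrt]; linarith [Real.pi_gt_three]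
  have h2 : Real.exp (-x ^ 2 / 2) ≤ 1 := Real.exp_le_one_iff.2 (by nlinarith [sq_nonneg x])
  exact mul_le_one₀ (inv_le_one_of_one_le₀ h1) (Real.exp_pos _).le h2

lemma log_gauss (x : ℝ) : Real.log (gauss x) = -(x ^ 2 / 2) - Real.log (√(2 * Real.pi)) := by
  have : √(2 * Real.pi) ≠ 0 := by positivity
  rw [gauss, Real.log_mul (inv_ne_zero this) (Real.exp_pos _).ne', Real.log_inv, Real.log_exp]
  ring

lemma gauss_eq_gaussianPDFReal : gauss = ProbabilityTheory.gaussianPDFReal 0 1 := by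
  ext x; simp [gauss, ProbabilityTheory.gaussianPDFReal]

/-- On `[-R, R]` the Gaussian density varies slowly. -/
lemma gauss_le_mul_gauss {R u v : ℝ} (hu : |u| ≤ R) (hv : |v| ≤ R) :
    gauss u ≤ Real.exp (R * |u - v|) * gauss v := by
  unfold gauss
  rw [mul_left_comm, ← Real.exp_add]
  gcongr
  have h1 : (v - u) * (v + u) ≤ |u - v| * (2 * R) := by
    refine (le_abs_self _).trans ?_
    rw [abs_mul, abs_sub_comm]
    gcongr
    exact (abs_add_le _ _).trans (by linarith)
  nlinarith

lemma gauss_le_of_abs_le {R u : ℝ} (hu : |u| ≤ R) : gauss R ≤ gauss u := by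
  unfold gauss
  have := sq_le_sq' (by linarith [neg_le_of_abs_le hu]) ((le_abs_self u).trans hu)
  gcongr 2
  linarith

/-- The Gaussian mass of `[-R, R]`. -/
def gaussMass (R : ℝ) : ℝ := ∫ x in (-R)..R, gauss x

/-- Division of natural numbers sends a fine index to its coarse cell, which is hit `M` times. -/
lemma sum_range_mul_div (f : ℕ → ℝ) (M N : ℕ) :
    ∑ i ∈ Finset.range (N * M), f (i / M) = M * ∑ k ∈ Finset.range N, f k := by
  induction N with
  | zero => simp
  | succ N ih =>
    rw [Nat.succ_mul, Finset.sum_range_add, ih, Finset.sum_range_succ, mul_add]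
    congr 1
    have : ∀ r ∈ Finset.range M, f ((N * M + r) / M) = f N := fun r hr => by
      rw [Nat.div_eq_of_lt_le] <;> nlinarith [Finset.mem_range.1 hr]
    rw [Finset.sum_congr rfl this]
    simp

/-- Every positive weighting of `N` equal cells of `[-R, R)` is, up to the factor `e^{-δ}`, bounded
above by the pullback of the Gaussian under a composition of dilations of half-lines. -/
lemma exists_lineReachable_of_weights {R : ℝ} (hR : 0 < R) {N : ℕ} (hN : 0 < N) (w : ℕ → ℝ)
    (hw : ∀ k < N, 0 < w k) (hsum : ∑ k ∈ Finset.range N, w k = 1) {δ : ℝ} (hδ : 0 < δ) :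
    ∃ h l, LineReachable h l ∧ (∀ z, R ≤ z → h z = z ∧ l z = 0) ∧
      (∀ z, z < -R → h z = z ∧ l z = 0) ∧
      ∀ k < N, ∀ z ∈ Ico (-R + 2 * R * k / N) (-R + 2 * R * (k + 1) / N),
        Real.exp (-δ) * gaussMass R * (w k * N / (2 * R)) ≤ gauss (h z) * Real.exp (l z) := by
  -- Each cell is cut into `M` pieces. An image interval has mass at most `1 / M`, hence length at
  -- most `1 / (M * gauss R)`, and this `M` makes `R` times that length at most `δ`.
  obtain ⟨M, hM⟩ := exists_nat_gt (R / (gauss R * δ))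
  have hgR := gauss_pos R
  have hMpos' : (0 : ℝ) < M := lt_of_le_of_lt (by positivity) hM
  have hMpos : 0 < M := by exact_mod_cast hMpos'
  have hNpos : (0 : ℝ) < N := by exact_mod_cast hN
  set G : ℝ → ℝ := fun u => ∫ x in (-R)..u, gauss x with hG
  set m := gaussMass R with hm
  have hint : ∀ a b, IntervalIntegrable gauss volume a b := fun a b =>
    continuous_gauss.intervalIntegrable a b
  have hGsub : ∀ a b, G b - G a = ∫ x in a..b, gauss x := fun a b =>
    intervalIntegral.integral_interval_sub_left (hint _ _) (hint _ _)
  have hGlt : ∀ a b, a < b → G a < G b := fun a b hab => by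
    rw [← sub_pos, hGsub]
    exact intervalIntegral.intervalIntegral_pos_of_pos (hint a b) gauss_pos hab
  have hGmono : StrictMono G := fun a b hab => hGlt a b hab
  have hGc : Continuous G := intervalIntegral.continuous_primitive hint (-R)
  have hG0 : G (-R) = 0 := by simp [hG]
  have hGR : G R = m := rfl
  have hmpos : 0 < m := by rw [← hGR, ← hG0]; exact hGlt _ _ (by linarith)
  have hm1 : m ≤ 1 := by
    rw [hm, gaussMass, intervalIntegral.integral_of_le (by linarith), gauss_eq_gaussianPDFReal,
      ← ProbabilityTheory.integral_gaussianPDFReal_eq_one 0 (one_ne_zero)]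
    exact setIntegral_le_integral (ProbabilityTheory.integrable_gaussianPDFReal 0 1)
      (ae_of_all _ fun x => ProbabilityTheory.gaussianPDFReal_nonneg 0 1 x)
  set n := N * M with hn
  have hnpos : (0 : ℝ) < n := by rw [hn]; push_cast; positivity
  have hdiv : ∀ i < n, i / M < N := fun i hi => Nat.div_lt_of_lt_mul (by rwa [mul_comm])
  -- The Gaussian mass wanted to the left of the `j`-th value: each piece of cell `k` receives an
  -- equal share of `m * w k`.
  set F : ℕ → ℝ := fun j => m * ∑ i ∈ Finset.range j, w (i / M) / M with hF
  have hFs : ∀ j, F (j + 1) = F j + m * (w (j / M) / M) := fun j => by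
    simp only [hF, Finset.sum_range_succ]; ring
  have hFn : F n = m := by
    simp only [hF]
    rw [← Finset.sum_div, hn, sum_range_mul_div w, hsum]
    field_simp
  have hF0 : F 0 = 0 := by simp [hF]
  have hFlt : ∀ j < n, F j < F (j + 1) := fun j hj => by
    rw [hFs]
    have := hw _ (hdiv j hj)
    have : 0 < m * (w (j / M) / M) := by positivity
    linarith
  have hFle : ∀ i j, i + j ≤ n → F i ≤ F (i + j) := by
    intro i j
    induction j with
    | zero => simp
    | succ j ih => exact fun hi => (ih (by omega)).trans (hFlt (i + j) (by omega)).le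
  -- The values are Gaussian quantiles, found by the intermediate value theorem; beyond `n` an
  -- arbitrary number is returned.
  have hex : ∀ j, ∃ u, j ≤ n → u ∈ Icc (-R) R ∧ G u = F j := by
    intro j
    by_cases hj : j ≤ n
    · have h1 : F j ∈ Icc (G (-R)) (G R) := by
        rw [hG0, hGR, ← hF0, ← hFn]
        have := hFle 0 j (by omega)
        have h2 := hFle j (n - j) (by omega)
        rw [zero_add] at this
        rw [Nat.add_sub_cancel' hj] at h2
        exact ⟨this, h2⟩
      obtain ⟨u, hu, hu'⟩ := intermediate_value_Icc (by linarith) hGc.continuousOn h1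
      exact ⟨u, fun _ => ⟨hu, hu'⟩⟩
    · exact ⟨0, fun h => absurd h hj⟩
  choose v hv using hex
  have hvlt : ∀ j < n, v j < v (j + 1) := fun j hj => by
    rw [← hGmono.lt_iff_lt, (hv j hj.le).2, (hv (j + 1) hj).2]
    exact hFlt j hj
  have hv0 : v 0 = -R := hGmono.injective (by rw [(hv 0 (Nat.zero_le _)).2, hF0, hG0])
  have hvn : v n = R := hGmono.injective (by rw [(hv n le_rfl).2, hFn, hGR])
  set y : ℕ → ℝ := fun j => -R + 2 * R * j / n with hy
  have hys : ∀ j, y (j + 1) - y j = 2 * R / n := fun j => by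
    simp only [hy]; push_cast; field_simp; ring
  have hylt : ∀ j < n, y j < y (j + 1) := fun j _ => by
    rw [← sub_pos, hys]; positivity
  have hyn : y n = R := by simp only [hy]; field_simp; ring
  have hy0 : y 0 = -R := by simp [hy]
  -- Slope `1` on the far left, together with `v 0 = y 0 = -R`, gives the identity below `-R`.
  obtain ⟨h, l, hr, h1, h2, -, h4⟩ := LineReachable.exists_piecewise_linear n y v hylt hvlt
    (hyn.trans hvn.symm) n 0 (by simp) 1 one_pos
  refine ⟨h, l, hr, fun z hz => h1 z (hyn ▸ hz), fun z hz => ?_, fun k hk z hz => ?_⟩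
  · have := h4 z (hy0 ▸ hz)
    rw [hv0, hy0] at this
    refine ⟨by rw [this.1]; ring, by rw [this.2, Real.log_one]⟩
  · set t := (z + R) * N / (2 * R) with ht
    have ht1 : (k : ℝ) ≤ t := by
      rw [ht, le_div_iff₀ (by positivity)]
      have := hz.1
      rw [← sub_nonneg] at this ⊢
      have h5 : (z + R) * N - k * (2 * R) = N * (z - (-R + 2 * R * k / N)) := by
        field_simp; ring
      rw [h5]; positivity
    have ht2 : t < k + 1 := by
      rw [ht, div_lt_iff₀ (by positivity)]
      have := hz.2
      rw [← sub_pos] at this ⊢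
      have h5 : (k + 1) * (2 * R) - (z + R) * N = N * ((-R + 2 * R * (k + 1) / N) - z) := by
        field_simp; ring
      rw [h5]; positivity
    have ht0 : 0 ≤ t * M := mul_nonneg ((Nat.cast_nonneg k).trans ht1) hMpos'.le
    set j := ⌊t * M⌋₊ with hj
    have hj1 : (j : ℝ) ≤ t * M := Nat.floor_le ht0
    have hj2 : t * M < j + 1 := Nat.lt_floor_add_one _
    have hkM : k * M ≤ j := Nat.le_floor (by push_cast; gcongr)
    have hjM : j < (k + 1) * M := (Nat.floor_lt ht0).2 (by push_cast; gcongr)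
    have hjk : j / M = k := Nat.div_eq_of_lt_le (by linarith) (by linarith)
    have hjn : j < n := hjM.trans_le (Nat.mul_le_mul_right M hk)
    have hzt : z = -R + 2 * R * (t * M) / n := by
      rw [ht, hn]; push_cast; field_simp; ring
    have hzj : z ∈ Ico (y j) (y (j + 1)) := by
      simp only [hy]
      rw [hzt]
      push_cast
      constructor
      · gcongr
      · gcongr
    obtain ⟨e1, e2⟩ := h2 j (Nat.zero_le _) hjn z hzj
    have hvj := hvlt j hjn
    have hslope : 0 < (v (j + 1) - v j) / (y (j + 1) - y j) :=
      div_pos (sub_pos.2 hvj) (sub_pos.2 (hylt j hjn))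
    rw [e2, Real.exp_log hslope]
    obtain ⟨⟨b1, b2⟩, b3⟩ := hv j hjn.le
    obtain ⟨⟨c1, c2⟩, c3⟩ := hv (j + 1) hjn
    have hz1 : v j ≤ h z := by
      rw [e1]
      have := mul_nonneg hslope.le (sub_nonneg.2 hzj.1)
      linarith
    have hz2 : h z ≤ v (j + 1) := by
      have h6 : (v (j + 1) - v j) / (y (j + 1) - y j) * (z - y j) ≤
          (v (j + 1) - v j) / (y (j + 1) - y j) * (y (j + 1) - y j) := by
        gcongr
        exact hzj.2.le
      rw [div_mul_cancel₀ _ (sub_pos.2 (hylt j hjn)).ne'] at h6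
      rw [e1]; linarith
    have hmass : ∫ x in (v j)..(v (j + 1)), gauss x = m * (w k / M) := by
      rw [← hGsub, b3, c3, hFs, hjk]; ring
    have hwk : w k ≤ 1 := by
      rw [← hsum]
      exact Finset.single_le_sum (fun i hi => (hw i (Finset.mem_range.1 hi)).le)
        (Finset.mem_range.2 hk)
    have habs : ∀ u ∈ Icc (v j) (v (j + 1)), |u| ≤ R := fun u hu =>
      abs_le.2 ⟨b1.trans hu.1, hu.2.trans c2⟩
    have hgap : gauss R * (v (j + 1) - v j) ≤ m * (w k / M) := by
      rw [← hmass]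
      have : ∫ _ in (v j)..(v (j + 1)), gauss R ≤ ∫ x in (v j)..(v (j + 1)), gauss x :=
        intervalIntegral.integral_mono_on hvj.le (by simp) (hint _ _)
          fun u hu => gauss_le_of_abs_le (habs u hu)
      rw [intervalIntegral.integral_const, smul_eq_mul] at this
      linarith
    have hgap2 : R * (v (j + 1) - v j) ≤ δ := by
      have h7 : m * (w k / M) ≤ 1 / M := by
        have : m * w k ≤ 1 := mul_le_one₀ hm1 (hw k hk).le hwk
        rw [← mul_div_assoc]; gcongr
      rw [div_lt_iff₀ (by positivity)] at hM
      have h8 : gauss R * (v (j + 1) - v j) * M ≤ 1 := by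
        have := hgap.trans h7
        rwa [le_div_iff₀ hMpos'] at this
      have h9 : gauss R * (R * (v (j + 1) - v j) * M) ≤ gauss R * (δ * M) := by
        nlinarith
      have h10 := le_of_mul_le_mul_left h9 hgR
      exact le_of_mul_le_mul_right h10 hMpos'
    -- On so short an interval the Gaussian density is at most `exp δ` times its value at `h z`; the
    -- prescribed mass therefore bounds the slope from below.
    have hup : m * (w k / M) ≤ (v (j + 1) - v j) * (Real.exp δ * gauss (h z)) := by
      rw [← hmass]
      have : ∫ x in (v j)..(v (j + 1)), gauss x ≤
          ∫ _ in (v j)..(v (j + 1)), Real.exp δ * gauss (h z) := by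
        refine intervalIntegral.integral_mono_on hvj.le (hint _ _) (by simp) fun u hu => ?_
        refine (gauss_le_mul_gauss (habs u hu) (habs (h z) ⟨hz1, hz2⟩)).trans ?_
        have hgz := gauss_pos (h z)
        gcongr
        refine le_trans ?_ hgap2
        gcongr
        rw [abs_le]
        constructor <;> linarith [hu.1, hu.2]
      rwa [intervalIntegral.integral_const, smul_eq_mul] at this
    have hexp : Real.exp (-δ) * Real.exp δ = 1 := by rw [← Real.exp_add]; simp
    have hgz := gauss_pos (h z)
    rw [hys]
    calc Real.exp (-δ) * m * (w k * N / (2 * R))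
        = Real.exp (-δ) * (m * (w k / M)) * (n / (2 * R)) := by
          rw [hn]; push_cast; field_simp
      _ ≤ Real.exp (-δ) * ((v (j + 1) - v j) * (Real.exp δ * gauss (h z))) * (n / (2 * R)) := by
          gcongr
      _ = (Real.exp (-δ) * Real.exp δ) * ((v (j + 1) - v j) * gauss (h z)) * (n / (2 * R)) := by
          ring
      _ = gauss (h z) * ((v (j + 1) - v j) / (2 * R / n)) := by
          rw [hexp]; field_simp

/-! ### Triangular maps -/

/-- Compose the localized maps over all `k`. Moving coordinate `i` does not affect membership in the
cylinders, and these are disjoint, so at most one factor acts on a given point. -/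
lemma exists_limitReachable_coordinate {K : Type*} [Finite K] {i : Fin d} {J : Finset (Fin d)}
    (hi : i ∉ J) (α β : K → Fin d → ℝ)
    (hdisj : ∀ k k' x, x ∈ cylinder J (α k) (β k) → x ∈ cylinder J (α k') (β k') → k = k')
    {h l : K → ℝ → ℝ} (hl : ∀ k, LineReachable (h k) (l k)) :
    ∃ Ψ ℓ, LimitReachable Ψ ℓ ∧ ∀ x,
      (∀ k, x ∈ cylinder J (α k) (β k) →
        Ψ x = x + (h k (x i) - x i) • basisVec i ∧ ℓ x = l k (x i)) ∧
      ((∀ k, x ∉ cylinder J (α k) (β k)) → Ψ x = x ∧ ℓ x = 0) := by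
  classical
  have := Fintype.ofFinite K
  suffices H : ∀ S : Finset K, ∃ Ψ ℓ, LimitReachable Ψ ℓ ∧ ∀ x,
      (∀ k ∈ S, x ∈ cylinder J (α k) (β k) →
        Ψ x = x + (h k (x i) - x i) • basisVec i ∧ ℓ x = l k (x i)) ∧
      ((∀ k ∈ S, x ∉ cylinder J (α k) (β k)) → Ψ x = x ∧ ℓ x = 0) by
    simpa using H Finset.univ
  intro S
  induction S using Finset.induction_on with
  | empty => exact ⟨id, 0, limitReachable_id, by simp⟩
  | insert k₀ S hk₀ ih =>
    obtain ⟨Ψ, ℓ, hr, hΨ⟩ := ih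
    refine ⟨_, _, ((hl k₀).localize hi (α k₀) (β k₀)).comp hr, fun x => ⟨fun k hk hx => ?_,
      fun hx => ?_⟩⟩
    · rcases Finset.mem_insert.1 hk with rfl | hkS
      · have h1 := (hΨ x).2 fun k' hk' hx' => hk₀ (hdisj _ _ x hx hx' ▸ hk')
        simp [h1.1, h1.2, localize, localizeLog, hx]
      · have h1 := (hΨ x).1 k hkS hx
        have h2 : x ∉ cylinder J (α k₀) (β k₀) := fun hx' => hk₀ (hdisj _ _ x hx hx' ▸ hkS)
        simp [h1.1, h1.2, localize, localizeLog, mem_cylinder_add hi, h2]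
    · have h1 := (hΨ x).2 fun k hk => hx k (Finset.mem_insert_of_mem hk)
      have h2 := hx k₀ (Finset.mem_insert_self _ _)
      simp [h1.1, h1.2, localize, localizeLog, h2]

/-- Coordinates are moved from the last to the first: when the turn of `i` comes, the coordinates
below `i`, which select its map, still have their original values. The number `r i` is the share of
coordinate `i` in the log-Jacobian. -/
lemma exists_limitReachable_triangular {K : Fin d → Type*} [∀ i, Finite (K i)]
    (α β : ∀ i, K i → Fin d → ℝ)
    (hdisj : ∀ i k k' x, x ∈ cylinder (Finset.Iio i) (α i k) (β i k) →
      x ∈ cylinder (Finset.Iio i) (α i k') (β i k') → k = k')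
    {h l : ∀ i, K i → ℝ → ℝ} (hl : ∀ i k, LineReachable (h i k) (l i k)) :
    ∃ Ψ ℓ, LimitReachable Ψ ℓ ∧ ∀ x, ∃ r : Fin d → ℝ, ℓ x = ∑ i, r i ∧ ∀ i,
      (∀ k, x ∈ cylinder (Finset.Iio i) (α i k) (β i k) →
        Ψ x i = h i k (x i) ∧ r i = l i k (x i)) ∧
      ((∀ k, x ∉ cylinder (Finset.Iio i) (α i k) (β i k)) → Ψ x i = x i ∧ r i = 0) := by
  suffices H : ∀ n m : ℕ, m + n = d → ∃ Ψ ℓ, LimitReachable Ψ ℓ ∧ ∀ x : E d,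
      (∀ j : Fin d, j.val < m → Ψ x j = x j) ∧ ∃ r : Fin d → ℝ, ℓ x = ∑ i, r i ∧
      (∀ j : Fin d, j.val < m → r j = 0) ∧ ∀ i : Fin d, m ≤ i.val →
      (∀ k, x ∈ cylinder (Finset.Iio i) (α i k) (β i k) →
        Ψ x i = h i k (x i) ∧ r i = l i k (x i)) ∧
      ((∀ k, x ∉ cylinder (Finset.Iio i) (α i k) (β i k)) → Ψ x i = x i ∧ r i = 0) by
    obtain ⟨Ψ, ℓ, hr, hΨ⟩ := H d 0 (zero_add d)
    refine ⟨Ψ, ℓ, hr, fun x => ?_⟩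
    obtain ⟨-, r, h1, -, h3⟩ := hΨ x
    exact ⟨r, h1, fun i => h3 i (Nat.zero_le _)⟩
  intro n
  induction n with
  | zero =>
    intro m hm
    refine ⟨id, 0, limitReachable_id, fun x => ⟨fun _ _ => rfl, 0, by simp, by simp,
      fun i hi => absurd i.2 (by omega)⟩⟩
  | succ n ih =>
    intro m hm
    obtain ⟨Ψ, ℓ, hr, hΨ⟩ := ih (m + 1) (by omega)
    set i : Fin d := ⟨m, by omega⟩ with hi
    obtain ⟨Θ, ϑ, hr', hΘ⟩ := exists_limitReachable_coordinate (i := i) (J := Finset.Iio i)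
      (by simp) (α i) (β i) (hdisj i) (hl i)
    -- `Ψ`, which moves only coordinates above `m`, acts first.
    refine ⟨_, _, hr'.comp hr, fun x => ?_⟩
    obtain ⟨h1, r, h2, h3, h4⟩ := hΨ x
    have hmem : ∀ k, Ψ x ∈ cylinder (Finset.Iio i) (α i k) (β i k) ↔
        x ∈ cylinder (Finset.Iio i) (α i k) (β i k) := fun k =>
      forall₂_congr fun j hj => by
        rw [h1 j]
        have : j < i := by simpa using hj
        have : j.val < m := this
        omega
    have hxi : Ψ x i = x i := h1 i (by simp [hi])
    have hri : r i = 0 := h3 i (by simp [hi])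
    have hne : ∀ j : Fin d, j.val ≠ m → j ≠ i := fun j hj h => hj (by rw [h])
    have hΘj : ∀ j : Fin d, j ≠ i → Θ (Ψ x) j = Ψ x j := fun j hj => by
      by_cases hex : ∃ k, Ψ x ∈ cylinder (Finset.Iio i) (α i k) (β i k)
      · obtain ⟨k, hk⟩ := hex
        rw [((hΘ (Ψ x)).1 k hk).1]
        simp [basisVec_ne hj]
      · rw [((hΘ (Ψ x)).2 (not_exists.1 hex)).1]
    refine ⟨fun j hj => ?_, Function.update r i (ϑ (Ψ x)), ?_, fun j hj => ?_, fun j hj => ?_⟩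
    · rw [Function.comp, hΘj j (hne j hj.ne), h1 j (by omega)]
    · rw [Finset.sum_update_of_mem (Finset.mem_univ i), h2,
        ← Finset.add_sum_erase _ _ (Finset.mem_univ i), hri, zero_add, add_comm]
      congr 1
      refine Finset.sum_congr ?_ fun _ _ => rfl
      ext; simp
    · rw [Function.update_of_ne (hne j hj.ne), h3 j (by omega)]
    · rcases eq_or_ne j i with rfl | hji
      · refine ⟨fun k hk => ?_, fun hk => ?_⟩
        · have := (hΘ (Ψ x)).1 k ((hmem k).2 hk)
          simp [this.1, this.2, hxi]
        · have := (hΘ (Ψ x)).2 fun k hk' => hk k ((hmem k).1 hk')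
          simp [this.1, this.2, hxi]
      · have hmj : m + 1 ≤ j.val := by
          have : j.val ≠ m := fun h => hji (Fin.ext h)
          omega
        simpa only [Function.comp, hΘj j hji, Function.update_of_ne hji] using h4 j hmj

/-! ### Realizing the cell masses of a measure on a grid -/

/-- The `c`-th of the `N` equal cells of `[-R, R)`. -/
def gridIco (R : ℝ) (N c : ℕ) : Set ℝ := Ico (-R + 2 * R * c / N) (-R + 2 * R * (c + 1) / N)

lemma gridIco_index_le {R : ℝ} (hR : 0 < R) {N : ℕ} (hN : 0 < N) {c c' : ℕ} {z : ℝ}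
    (h : z ∈ gridIco R N c) (h' : z ∈ gridIco R N c') : c ≤ c' := by
  have hN' : (0 : ℝ) < N := by exact_mod_cast hN
  have h1 : -R + 2 * R * c / N < -R + 2 * R * (c' + 1) / N := h.1.trans_lt h'.2
  have h2 : 2 * R * c < 2 * R * (c' + 1) := by
    have : 2 * R * c / N < 2 * R * (c' + 1) / N := by linarith
    rwa [div_lt_div_iff_of_pos_right hN'] at this
  have h3 : (c : ℝ) < c' + 1 := lt_of_mul_lt_mul_left h2 (by linarith)
  have h4 : c < c' + 1 := by exact_mod_cast h3
  omega

lemma gridIco_index_unique {R : ℝ} (hR : 0 < R) {N : ℕ} (hN : 0 < N) {c c' : ℕ} {z : ℝ}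
    (h : z ∈ gridIco R N c) (h' : z ∈ gridIco R N c') : c = c' :=
  le_antisymm (gridIco_index_le hR hN h h') (gridIco_index_le hR hN h' h)

lemma exists_mem_gridIco {R : ℝ} (hR : 0 < R) {N : ℕ} (hN : 0 < N) {z : ℝ}
    (hz : z ∈ Ico (-R) R) : ∃ c : Fin N, z ∈ gridIco R N c := by
  have hN' : (0 : ℝ) < N := by exact_mod_cast hN
  set t := (z + R) * N / (2 * R) with ht
  have ht0 : 0 ≤ t := by
    have := hz.1
    have : 0 ≤ z + R := by linarith
    positivity
  have htN : t < N := by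
    rw [ht, div_lt_iff₀ (by positivity)]
    have := hz.2
    nlinarith
  have hzt : z = -R + 2 * R * t / N := by rw [ht]; field_simp; ring
  refine ⟨⟨⌊t⌋₊, (Nat.floor_lt ht0).2 htN⟩, ?_, ?_⟩
  · conv_rhs => rw [hzt]
    gcongr
    exact Nat.floor_le ht0
  · conv_lhs => rw [hzt]
    gcongr
    exact Nat.lt_floor_add_one t

lemma gridIco_subset {R : ℝ} (hR : 0 < R) {N c : ℕ} (hc : c < N) : gridIco R N c ⊆ Ico (-R) R := by
  have hN' : (0 : ℝ) < N := by exact_mod_cast (Nat.zero_le c).trans_lt hc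
  intro z hz
  refine ⟨le_trans ?_ hz.1, hz.2.trans_le ?_⟩
  · have : 0 ≤ 2 * R * c / N := by positivity
    linarith
  · have : 2 * R * (c + 1) / N ≤ 2 * R := by
      rw [div_le_iff₀ hN']
      gcongr
      exact_mod_cast hc
    linarith

/-- The half-open box `[-R, R)^d`. -/
def box (d : ℕ) (R : ℝ) : Set (E d) := {x | ∀ j, x j ∈ Ico (-R) R}

/-- The points of the box whose first `n` coordinates lie in the cells `k j`. -/
def slab (R : ℝ) (N : ℕ) (k : Fin d → Fin N) (n : ℕ) : Set (E d) :=
  {x | x ∈ box d R ∧ ∀ j : Fin d, j.val < n → x j ∈ gridIco R N (k j)}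

/-- The grid cell with multi-index `k`. -/
def gridCell (R : ℝ) (N : ℕ) (k : Fin d → Fin N) : Set (E d) := {x | ∀ j, x j ∈ gridIco R N (k j)}

lemma measurableSet_box (R : ℝ) : MeasurableSet (box d R) := by
  have : box d R = ⋂ j, (fun x : E d => x j) ⁻¹' Ico (-R) R := by ext; simp [box]
  rw [this]
  exact MeasurableSet.iInter fun j => measurableSet_Ico.preimage (by fun_prop)

lemma measurableSet_gridCell (R : ℝ) (N : ℕ) (k : Fin d → Fin N) :
    MeasurableSet (gridCell R N k) := by
  have : gridCell R N k = ⋂ j, (fun x : E d => x j) ⁻¹' gridIco R N (k j) := by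
    ext; simp [gridCell]
  rw [this]
  exact MeasurableSet.iInter fun j => measurableSet_Ico.preimage (by fun_prop)

lemma measurableSet_slab (R : ℝ) (N : ℕ) (k : Fin d → Fin N) (n : ℕ) :
    MeasurableSet (slab R N k n) := by
  have : slab R N k n = box d R ∩ ⋂ j : Fin d, ⋂ _ : j.val < n,
      (fun x : E d => x j) ⁻¹' gridIco R N (k j) := by ext; simp [slab]
  rw [this]
  exact (measurableSet_box R).inter (MeasurableSet.iInter fun j => MeasurableSet.iInter fun _ =>
    measurableSet_Ico.preimage (by fun_prop))

lemma gridCell_subset_box {R : ℝ} (hR : 0 < R) {N : ℕ} (k : Fin d → Fin N) :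
    gridCell R N k ⊆ box d R := fun _ hx j => gridIco_subset hR (k j).2 (hx j)

lemma slab_zero (R : ℝ) {N : ℕ} (k : Fin d → Fin N) : slab R N k 0 = box d R := by
  ext; simp [slab]

lemma slab_top {R : ℝ} (hR : 0 < R) {N : ℕ} (k : Fin d → Fin N) :
    slab R N k d = gridCell R N k := by
  ext x
  refine ⟨fun h j => h.2 j j.2, fun h => ⟨gridCell_subset_box hR k h, fun j _ => h j⟩⟩

lemma slab_succ (R : ℝ) {N : ℕ} (k : Fin d → Fin N) (i : Fin d) :
    slab R N k (i + 1) = slab R N k i ∩ {x | x i ∈ gridIco R N (k i)} := by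
  ext x
  refine ⟨fun h => ⟨⟨h.1, fun j hj => h.2 j (by omega)⟩, h.2 i (Nat.lt_succ_self _)⟩,
    fun h => ⟨h.1.1, fun j hj => ?_⟩⟩
  rcases eq_or_ne j i with rfl | hji
  · exact h.2
  · exact h.1.2 j (by have : j.val ≠ i.val := fun e => hji (Fin.ext e); omega)

lemma slab_congr (R : ℝ) {N : ℕ} {k k' : Fin d → Fin N} {n : ℕ}
    (h : ∀ j : Fin d, j.val < n → k j = k' j) : slab R N k n = slab R N k' n := by
  ext x
  refine and_congr_right fun _ => forall₂_congr fun j hj => by rw [h j hj]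

/-- The chain rule for conditional probabilities, telescoping over nested slabs. A null slab does no
harm: division by zero gives `0`, and the smaller slabs are null as well. -/
lemma measureReal_gridCell_eq_prod (μ : Measure (E d)) [IsFiniteMeasure μ] {R : ℝ} (hR : 0 < R)
    {N : ℕ} (k : Fin d → Fin N) :
    μ.real (gridCell R N k) = μ.real (box d R) *
      ∏ i : Fin d, (μ.real (slab R N k (i + 1)) / μ.real (slab R N k i)) := by
  have H : ∀ n ≤ d, μ.real (slab R N k n) = μ.real (box d R) *
      ∏ i ∈ Finset.range n, (μ.real (slab R N k (i + 1)) / μ.real (slab R N k i)) := by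
    intro n
    induction n with
    | zero => simp [slab_zero]
    | succ n ih =>
      intro hn
      rw [Finset.prod_range_succ, ← mul_assoc, ← ih (by omega)]
      have hle : μ.real (slab R N k (n + 1)) ≤ μ.real (slab R N k n) :=
        measureReal_mono fun x hx => ⟨hx.1, fun j hj => hx.2 j (by omega)⟩
      by_cases h0 : μ.real (slab R N k n) = 0
      · rw [h0, zero_mul]
        exact le_antisymm (h0 ▸ hle) measureReal_nonneg
      · field_simp
  rw [← slab_top hR, H d le_rfl, Finset.prod_range]

/-- Mixing with the uniform weights. -/
lemma exists_weights {N : ℕ} (hN : 0 < N) {q : ℕ → ℝ} (hq : ∀ c, 0 ≤ q c)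
    (hq1 : ∑ c ∈ Finset.range N, q c ≤ 1) {η : ℝ} (h0 : 0 < η) (h1 : η < 1) :
    ∃ w : ℕ → ℝ, (∀ c < N, 0 < w c) ∧ ∑ c ∈ Finset.range N, w c = 1 ∧
      (∀ c, (1 - η) * q c ≤ w c) ∧ ∀ c, η ≤ w c * N := by
  have hN' : (0 : ℝ) < N := by exact_mod_cast hN
  set s := ∑ c ∈ Finset.range N, q c with hs
  -- After damping by `1 - η` a mass of at least `η` is missing. Spread uniformly, it makes every
  -- weight positive, even where `q` vanishes.
  have hη : η ≤ 1 - (1 - η) * s := by nlinarith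
  have hpos : 0 < (1 - (1 - η) * s) / N := div_pos (by linarith) hN'
  have hqη : ∀ c, 0 ≤ (1 - η) * q c := fun c => mul_nonneg (by linarith) (hq c)
  refine ⟨fun c => (1 - η) * q c + (1 - (1 - η) * s) / N, fun c _ => ?_, ?_, fun c => ?_,
    fun c => ?_⟩
  · have := hqη c; positivity
  · rw [Finset.sum_add_distrib, ← Finset.mul_sum, ← hs]
    simp only [Finset.sum_const, Finset.card_range, nsmul_eq_mul]
    field_simp; ring
  · linarith
  · rw [add_mul, div_mul_cancel₀ _ hN'.ne']
    have := mul_nonneg (hqη c) hN'.le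
    linarith

/-- The pieces are disjoint subsets of the slab. Only an inequality can hold, since over a null slab
all the quotients are `0`. -/
lemma sum_measureReal_slab_le (μ : Measure (E d)) [IsFiniteMeasure μ] {R : ℝ} (hR : 0 < R)
    {N : ℕ} (hN : 0 < N) (k : Fin d → Fin N) (i : Fin d) :
    ∑ c ∈ Finset.range N, μ.real (slab R N k i ∩ {x | x i ∈ gridIco R N c}) /
      μ.real (slab R N k i) ≤ 1 := by
  rw [← Finset.sum_div]
  refine div_le_one_of_le₀ ?_ measureReal_nonneg
  rw [← measureReal_biUnion_finset]
  · exact measureReal_mono (iUnion₂_subset fun c _ => inter_subset_left)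
  · intro c _ c' _ hcc
    refine disjoint_left.2 fun x hx hx' => hcc (gridIco_index_unique hR hN hx.2 hx'.2)
  · intro c _
    refine (measurableSet_slab R N k i).inter ?_
    exact measurableSet_Ico.preimage (f := fun x : E d => x i) (by fun_prop)

/-- There is a limit of compositions of perceptron flows that pulls the standard Gaussian back to a
density which, up to constants, dominates the cell averages of `μ` on the box and the Gaussian
everywhere. -/
lemma exists_limitReachable_grid (μ : Measure (E d)) [IsFiniteMeasure μ] {R : ℝ} (hR : 0 < R)
    {N : ℕ} (hN : 0 < N) {δ η : ℝ} (hδ : 0 < δ) (h0 : 0 < η) (h1 : η < 1) :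
    ∃ Ψ ℓ, LimitReachable Ψ ℓ ∧
      (∀ k : Fin d → Fin N, ∀ x ∈ gridCell R N k,
        (Real.exp (-δ) * gaussMass R * (1 - η) * (N / (2 * R))) ^ d * μ.real (gridCell R N k) ≤
          μ.real (box d R) * ((∏ i, gauss (Ψ x i)) * Real.exp (ℓ x))) ∧
      ∀ x, min 1 (Real.exp (-δ) * gaussMass R * η / (2 * R)) ^ d * ∏ i, gauss (x i) ≤
        (∏ i, gauss (Ψ x i)) * Real.exp (ℓ x) := by
  have hN' : (0 : ℝ) < N := by exact_mod_cast hN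
  have hm : 0 ≤ gaussMass R :=
    intervalIntegral.integral_nonneg (by linarith) fun x _ => (gauss_pos x).le
  -- The map of coordinate `i` is indexed by the cells of the earlier coordinates. The extension
  -- `ex` fills the others with cell `0`, which neither the cylinder nor the slab reads.
  let K : Fin d → Type := fun i => {j : Fin d // j < i} → Fin N
  let ex : ∀ i, K i → Fin d → Fin N := fun i k j => if h : j < i then k ⟨j, h⟩ else ⟨0, hN⟩
  have hex : ∀ i (k : Fin d → Fin N), ∀ j < i, ex i (fun j => k j.1) j = k j := fun i k j hj => by
    simp [ex, hj]
  let α : ∀ i, K i → Fin d → ℝ := fun i k j => -R + 2 * R * (ex i k j : ℕ) / N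
  let β : ∀ i, K i → Fin d → ℝ := fun i k j => -R + 2 * R * ((ex i k j : ℕ) + 1) / N
  have hmem : ∀ i (k : K i) x, x ∈ cylinder (Finset.Iio i) (α i k) (β i k) ↔
      ∀ j < i, x j ∈ gridIco R N (ex i k j) := fun i k x => by
    simp [cylinder, α, β, gridIco]
  -- The conditional probability of cell `c` for coordinate `i`, given the cells of the coordinates
  -- before it.
  let q : ∀ i, K i → ℕ → ℝ := fun i k c =>
    μ.real (slab R N (ex i k) i ∩ {x | x i ∈ gridIco R N c}) / μ.real (slab R N (ex i k) i)
  have hw : ∀ i k, ∃ w : ℕ → ℝ, (∀ c < N, 0 < w c) ∧ ∑ c ∈ Finset.range N, w c = 1 ∧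
      (∀ c, (1 - η) * q i k c ≤ w c) ∧ ∀ c, η ≤ w c * N := fun i k =>
    exists_weights hN (fun c => div_nonneg measureReal_nonneg measureReal_nonneg)
      (sum_measureReal_slab_le μ hR hN (ex i k) i) h0 h1
  choose w hw1 hw2 hw3 hw4 using hw
  have hline := fun i k => exists_lineReachable_of_weights hR hN (w i k) (hw1 i k) (hw2 i k) hδ
  choose h l hr hhi hlo hcell using hline
  obtain ⟨Ψ, ℓ, hΨ, hval⟩ := exists_limitReachable_triangular α β
    (fun i k k' x hx hx' => by
      rw [hmem] at hx hx'
      ext j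
      have := gridIco_index_unique hR hN (hx j.1 j.2) (hx' j.1 j.2)
      simpa [ex, j.2] using this) hr
  refine ⟨Ψ, ℓ, hΨ, fun k x hx => ?_, fun x => ?_⟩
  · obtain ⟨r, hr1, hr2⟩ := hval x
    rw [hr1, Real.exp_sum, ← Finset.prod_mul_distrib, measureReal_gridCell_eq_prod μ hR,
      mul_left_comm]
    refine mul_le_mul_of_nonneg_left ?_ measureReal_nonneg
    have hconst : (Real.exp (-δ) * gaussMass R * (1 - η) * (N / (2 * R))) ^ d =
        ∏ _i : Fin d, (Real.exp (-δ) * gaussMass R * (1 - η) * (N / (2 * R))) := by simp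
    rw [hconst, ← Finset.prod_mul_distrib]
    refine Finset.prod_le_prod (fun i _ => ?_) fun i _ => ?_
    · have : 0 ≤ 1 - η := by linarith
      positivity
    · set k' : K i := fun j => k j.1 with hk'
      have hsl : slab R N (ex i k') i = slab R N k i :=
        slab_congr R fun j hj => hex i k j hj
      obtain ⟨e1, e2⟩ := (hr2 i).1 k' ((hmem i k' x).2 fun j hj => by
        rw [hk', hex i k j hj]; exact hx j)
      rw [e1, e2]
      refine le_trans ?_ (hcell i k' (k i) (k i).2 (x i) (hx i))
      have h3 := hw3 i k' (k i)
      simp only [q, hsl, ← slab_succ] at h3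
      calc Real.exp (-δ) * gaussMass R * (1 - η) * (N / (2 * R)) *
            (μ.real (slab R N k (i + 1)) / μ.real (slab R N k i))
          = Real.exp (-δ) * gaussMass R * (((1 - η) *
            (μ.real (slab R N k (i + 1)) / μ.real (slab R N k i))) * N / (2 * R)) := by ring
        _ ≤ _ := by gcongr
  · obtain ⟨r, hr1, hr2⟩ := hval x
    rw [hr1, Real.exp_sum, ← Finset.prod_mul_distrib]
    set κ := min 1 (Real.exp (-δ) * gaussMass R * η / (2 * R)) with hκ
    have hκ0 : 0 ≤ κ := le_min zero_le_one (by positivity)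
    have hκ1 : κ ≤ 1 := min_le_left _ _
    have hconst : κ ^ d = ∏ _i : Fin d, κ := by simp
    rw [hconst, ← Finset.prod_mul_distrib]
    refine Finset.prod_le_prod (fun i _ => mul_nonneg hκ0 (gauss_pos _).le) fun i _ => ?_
    have htriv : κ * gauss (x i) ≤ gauss (x i) := mul_le_of_le_one_left (gauss_pos _).le hκ1
    by_cases hc : ∃ k, x ∈ cylinder (Finset.Iio i) (α i k) (β i k)
    · obtain ⟨k, hk⟩ := hc
      obtain ⟨e1, e2⟩ := (hr2 i).1 k hk
      rw [e1, e2]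
      by_cases hx1 : R ≤ x i
      · simpa [(hhi i k _ hx1).1, (hhi i k _ hx1).2] using htriv
      by_cases hx2 : x i < -R
      · simpa [(hlo i k _ hx2).1, (hlo i k _ hx2).2] using htriv
      obtain ⟨c, hc⟩ := exists_mem_gridIco hR hN ⟨not_lt.1 hx2, not_le.1 hx1⟩
      refine le_trans ?_ (hcell i k c c.2 (x i) hc)
      -- The floor `η ≤ w c * N` makes this bound independent of `N`, which may thus be chosen after
      -- the tail has been estimated.
      calc κ * gauss (x i) ≤ κ * 1 := by gcongr; exact gauss_le_one _
        _ ≤ Real.exp (-δ) * gaussMass R * η / (2 * R) := by rw [mul_one]; exact min_le_right _ _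
        _ = Real.exp (-δ) * gaussMass R * (η / (2 * R)) := by ring
        _ ≤ _ := by gcongr; exact hw4 i k c
    · obtain ⟨e1, e2⟩ := (hr2 i).2 (not_exists.1 hc)
      simpa [e1, e2] using htriv

/-! ### Averages over the cells of a grid -/

lemma gridCell_eq_preimage (R : ℝ) (N : ℕ) (k : Fin d → Fin N) :
    gridCell R N k = (@WithLp.ofLp 2 (Fin d → ℝ)) ⁻¹' (univ.pi fun j => gridIco R N (k j)) := by
  ext; simp [gridCell]

lemma volume_gridCell {R : ℝ} (hR : 0 < R) {N : ℕ} (hN : 0 < N) (k : Fin d → Fin N) :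
    volume (gridCell R N k) = ENNReal.ofReal ((2 * R / N) ^ d) := by
  have hN' : (0 : ℝ) < N := by exact_mod_cast hN
  have hm : MeasurableSet (univ.pi fun j => gridIco R N (k j)) :=
    MeasurableSet.univ_pi fun j => measurableSet_Ico
  rw [gridCell_eq_preimage,
    (PiLp.volume_preserving_ofLp (Fin d)).measure_preimage hm.nullMeasurableSet, volume_pi_pi]
  have : ∀ j, volume (gridIco R N (k j)) = ENNReal.ofReal (2 * R / N) := fun j => by
    rw [gridIco, Real.volume_Ico]
    congr 1
    ring
  simp only [this, Finset.prod_const, Finset.card_univ, Fintype.card_fin]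
  rw [ENNReal.ofReal_pow (by positivity)]

lemma volumeReal_gridCell {R : ℝ} (hR : 0 < R) {N : ℕ} (hN : 0 < N) (k : Fin d → Fin N) :
    volume.real (gridCell R N k) = (2 * R / N) ^ d := by
  have hN' : (0 : ℝ) < N := by exact_mod_cast hN
  rw [measureReal_def, volume_gridCell hR hN, ENNReal.toReal_ofReal (by positivity)]

lemma volume_gridCell_ne_top {R : ℝ} (hR : 0 < R) {N : ℕ} (hN : 0 < N) (k : Fin d → Fin N) :
    volume (gridCell R N k) ≠ ∞ := by
  rw [volume_gridCell hR hN]; exact ENNReal.ofReal_ne_top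

lemma gridCell_index_unique {R : ℝ} (hR : 0 < R) {N : ℕ} (hN : 0 < N) {k k' : Fin d → Fin N}
    {x : E d} (h : x ∈ gridCell R N k) (h' : x ∈ gridCell R N k') : k = k' :=
  funext fun j => Fin.ext (gridIco_index_unique hR hN (h j) (h' j))

lemma exists_mem_gridCell {R : ℝ} (hR : 0 < R) {N : ℕ} (hN : 0 < N) {x : E d} (hx : x ∈ box d R) :
    ∃ k : Fin d → Fin N, x ∈ gridCell R N k := by
  choose k hk using fun j => exists_mem_gridIco hR hN (hx j)
  exact ⟨k, hk⟩

lemma iUnion_gridCell {R : ℝ} (hR : 0 < R) {N : ℕ} (hN : 0 < N) :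
    ⋃ k : Fin d → Fin N, gridCell R N k = box d R := by
  ext x
  rw [mem_iUnion]
  exact ⟨fun ⟨k, hk⟩ => gridCell_subset_box hR k hk, fun hx => exists_mem_gridCell hR hN hx⟩

lemma setIntegral_box_eq_sum {R : ℝ} (hR : 0 < R) {N : ℕ} (hN : 0 < N) {F : E d → ℝ}
    (hF : ∀ k : Fin d → Fin N, IntegrableOn F (gridCell R N k)) :
    ∫ x in box d R, F x = ∑ k : Fin d → Fin N, ∫ x in gridCell R N k, F x := by
  rw [← iUnion_gridCell hR hN, integral_iUnion_fintype (fun k => measurableSet_gridCell R N k)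
    (fun k k' hkk => disjoint_left.2 fun x hx hx' => hkk (gridCell_index_unique hR hN hx hx')) hF]

lemma integrableOn_box_of_cells {R : ℝ} (hR : 0 < R) {N : ℕ} (hN : 0 < N) {F : E d → ℝ}
    (hF : ∀ k : Fin d → Fin N, IntegrableOn F (gridCell R N k)) : IntegrableOn F (box d R) := by
  rw [← iUnion_gridCell hR hN]
  exact integrableOn_finite_iUnion.2 hF

lemma volume_box_ne_top (R : ℝ) : volume (box d R) ≠ ∞ := by
  by_cases hR : 0 < R
  · rw [← iUnion_gridCell hR one_pos]
    rw [← lt_top_iff_ne_top, ← biUnion_univ]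
    exact measure_biUnion_lt_top finite_univ fun k _ =>
      (volume_gridCell_ne_top hR one_pos k).lt_top
  · rcases isEmpty_or_nonempty (Fin d) with h | ⟨⟨j⟩⟩
    · have : (box d R) ⊆ {0} := fun x _ => Subsingleton.elim _ _
      exact ((measure_mono this).trans_lt isCompact_singleton.measure_lt_top).ne
    · have : box d R = ∅ := by
        ext x
        simp only [mem_empty_iff_false, iff_false]
        intro hx
        have := hx j
        linarith [this.1, this.2]
      simp [this]

/-- The average of `f` over a cell of the grid. -/
def cellAvg (f : E d → ℝ) (R : ℝ) (N : ℕ) (k : Fin d → Fin N) : ℝ :=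
  (N / (2 * R)) ^ d * ∫ x in gridCell R N k, f x

/-- The step function of the averages of `f` over the cells of the grid. -/
def stepAvg (f : E d → ℝ) (R : ℝ) (N : ℕ) (x : E d) : ℝ :=
  ∑ k : Fin d → Fin N, (gridCell R N k).indicator (fun _ => cellAvg f R N k) x

lemma stepAvg_of_mem (f : E d → ℝ) {R : ℝ} (hR : 0 < R) {N : ℕ} (hN : 0 < N) {k : Fin d → Fin N}
    {x : E d} (hx : x ∈ gridCell R N k) : stepAvg f R N x = cellAvg f R N k := by
  rw [stepAvg, Finset.sum_eq_single k]
  · simp [hx]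
  · intro k' _ hk'
    exact indicator_of_notMem (fun hx' => hk' (gridCell_index_unique hR hN hx' hx)) _
  · simp

lemma measurable_stepAvg (f : E d → ℝ) (R : ℝ) (N : ℕ) : Measurable (stepAvg f R N) :=
  Finset.measurable_sum _ fun k _ => measurable_const.indicator (measurableSet_gridCell R N k)

lemma stepAvg_nonneg {f : E d → ℝ} (hf : ∀ x, 0 ≤ f x) {R : ℝ} (hR : 0 < R) (N : ℕ) (x : E d) :
    0 ≤ stepAvg f R N x :=
  Finset.sum_nonneg fun k _ => indicator_nonneg
    (fun _ _ => mul_nonneg (by positivity) (integral_nonneg hf)) _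

lemma integrableOn_mul_comp_stepAvg {f F : E d → ℝ} {R : ℝ} (hR : 0 < R) {N : ℕ} (hN : 0 < N)
    (hF : Integrable F) (g : ℝ → ℝ) (k : Fin d → Fin N) :
    IntegrableOn (fun x => F x * g (stepAvg f R N x)) (gridCell R N k) := by
  refine (hF.integrableOn.mul_const (g (cellAvg f R N k))).congr ?_
  filter_upwards [ae_restrict_mem (measurableSet_gridCell R N k)] with x hx
  rw [stepAvg_of_mem f hR hN hx]

lemma integrableOn_comp_stepAvg {f : E d → ℝ} {R : ℝ} (hR : 0 < R) {N : ℕ} (hN : 0 < N)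
    (g : ℝ → ℝ) (k : Fin d → Fin N) :
    IntegrableOn (fun x => g (stepAvg f R N x)) (gridCell R N k) := by
  have h : IntegrableOn (fun _ : E d => g (cellAvg f R N k)) (gridCell R N k) :=
    integrableOn_const (volume_gridCell_ne_top hR hN k)
  refine h.congr ?_
  filter_upwards [ae_restrict_mem (measurableSet_gridCell R N k)] with x hx
  rw [stepAvg_of_mem f hR hN hx]

/-- Averaging over cells is self-adjoint. -/
lemma setIntegral_stepAvg_mul {f : E d → ℝ} {R : ℝ} (hR : 0 < R) {N : ℕ} (hN : 0 < N)
    (hf : Integrable f) (g : ℝ → ℝ) :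
    ∫ x in box d R, stepAvg f R N x * g (stepAvg f R N x) =
      ∫ x in box d R, f x * g (stepAvg f R N x) := by
  have hN' : (0 : ℝ) < N := by exact_mod_cast hN
  rw [setIntegral_box_eq_sum hR hN (integrableOn_mul_comp_stepAvg hR hN hf g),
    setIntegral_box_eq_sum hR hN (integrableOn_comp_stepAvg hR hN fun t => t * g t)]
  refine Finset.sum_congr rfl fun k _ => ?_
  have h1 : ∫ x in gridCell R N k, stepAvg f R N x * g (stepAvg f R N x) =
      ∫ _ in gridCell R N k, cellAvg f R N k * g (cellAvg f R N k) :=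
    setIntegral_congr_fun (measurableSet_gridCell R N k) fun x hx => by
      simp only [stepAvg_of_mem f hR hN hx]
  have h2 : ∫ x in gridCell R N k, f x * g (stepAvg f R N x) =
      ∫ x in gridCell R N k, f x * g (cellAvg f R N k) :=
    setIntegral_congr_fun (measurableSet_gridCell R N k) fun x hx => by
      simp only [stepAvg_of_mem f hR hN hx]
  rw [h1, h2, setIntegral_const, integral_mul_const, volumeReal_gridCell hR hN, smul_eq_mul,
    cellAvg]
  have : (2 * R / N) ^ d * (N / (2 * R)) ^ d = 1 := by
    rw [← mul_pow]
    have : 2 * R / N * (N / (2 * R)) = 1 := by field_simp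
    rw [this, one_pow]
  rw [← mul_assoc, ← mul_assoc, this, one_mul]

/-- The center of a grid cell. -/
def gridCenter (R : ℝ) (N : ℕ) (k : Fin d → Fin N) (j : Fin d) : ℝ :=
  -R + 2 * R * (k j) / N + R / N

/-- In the sup norm of `Fin d → ℝ` a closed cell is a ball, and the half-open cell differs from it
by a null set. This is the form that Lebesgue differentiation accepts. -/
lemma cellAvg_eq_average (f : E d → ℝ) {R : ℝ} (hR : 0 < R) {N : ℕ} (hN : 0 < N)
    (k : Fin d → Fin N) :
    cellAvg f R N k = ⨍ y in Metric.closedBall (gridCenter R N k) (R / N),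
      f (WithLp.toLp 2 y) := by
  have hN' : (0 : ℝ) < N := by exact_mod_cast hN
  have hball : Metric.closedBall (gridCenter R N k) (R / N) =
      univ.pi fun j => Icc (-R + 2 * R * (k j) / N) (-R + 2 * R * (k j + 1) / N) := by
    rw [closedBall_pi _ (by positivity)]
    congr 1
    ext1 j
    rw [Real.closedBall_eq_Icc, gridCenter]
    congr 1 <;> ring
  have hae : (univ.pi fun j => gridIco R N (k j)) =ᵐ[volume]
      Metric.closedBall (gridCenter R N k) (R / N) := by
    rw [hball, volume_pi]
    have := Measure.univ_pi_Ico_ae_eq_Icc (μ := fun _ : Fin d => (volume : Measure ℝ))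
      (f := fun j => -R + 2 * R * (k j) / N) (g := fun j => -R + 2 * R * (k j + 1) / N)
    rw [← pi_univ_Icc] at this
    exact this
  rw [setAverage_eq, measureReal_def, Real.volume_pi_closedBall _ (by positivity),
    ENNReal.toReal_ofReal (by positivity), ← setIntegral_congr_set hae, cellAvg, smul_eq_mul,
    gridCell_eq_preimage]
  congr 1
  · rw [← inv_pow, Fintype.card_fin]
    congr 1
    field_simp
  · exact (PiLp.volume_preserving_ofLp (Fin d)).setIntegral_preimage_emb
      (MeasurableEquiv.toLp 2 (Fin d → ℝ)).symm.measurableEmbedding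
      (fun y => f (WithLp.toLp 2 y)) _

/-- The cell averages converge almost everywhere. -/
lemma ae_tendsto_stepAvg {f : E d → ℝ} (hf : Integrable f) {R : ℝ} (hR : 0 < R) :
    ∀ᵐ x, x ∈ box d R → Tendsto (fun n : ℕ => stepAvg f R (n + 1) x) atTop (𝓝 (f x)) := by
  have hf' : Integrable fun y : Fin d → ℝ => f (WithLp.toLp 2 y) :=
    (PiLp.volume_preserving_toLp (Fin d)).integrable_comp_of_integrable hf
  -- Differentiation along balls not centred at the point; the constant `1` asks only that the point
  -- lie in the ball.
  have h := IsUnifLocDoublingMeasure.ae_tendsto_average (μ := (volume : Measure (Fin d → ℝ)))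
    hf'.locallyIntegrable 1
  have h2 := (PiLp.volume_preserving_ofLp (Fin d)).quasiMeasurePreserving.ae h
  filter_upwards [h2] with x hx hxB
  have hN : ∀ n : ℕ, 0 < n + 1 := fun n => n.succ_pos
  choose k hk using fun n : ℕ => exists_mem_gridCell hR (hN n) hxB
  have hlim : Tendsto (fun n : ℕ => R / ((n + 1 : ℕ) : ℝ)) atTop (𝓝[>] 0) := by
    refine tendsto_nhdsWithin_iff.2 ⟨?_, Eventually.of_forall fun n => ?_⟩
    · exact (tendsto_const_nhds.div_atTop tendsto_natCast_atTop_atTop).comp (tendsto_add_atTop_nat 1)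
    · simp only [mem_Ioi]; positivity
  have h3 := hx (fun n : ℕ => gridCenter R (n + 1) (k n)) (fun n : ℕ => R / ((n + 1 : ℕ) : ℝ)) hlim
    (Eventually.of_forall fun n => by
      rw [one_mul, mem_closedBall_iff_norm, pi_norm_le_iff_of_nonneg (by positivity)]
      intro j
      have h4 := hk n j
      rw [gridIco, mem_Ico] at h4
      have h5 : 2 * R * ((k n j : ℕ) + 1) / ((n + 1 : ℕ) : ℝ) =
          2 * R * (k n j : ℕ) / ((n + 1 : ℕ) : ℝ) + 2 * (R / ((n + 1 : ℕ) : ℝ)) := by ring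
      rw [h5] at h4
      rw [Pi.sub_apply, Real.norm_eq_abs, gridCenter, abs_le]
      constructor <;> linarith [h4.1, h4.2])
  refine h3.congr fun n => ?_
  rw [stepAvg_of_mem f hR (hN n) (hk n), cellAvg_eq_average f hR (hN n)]

open InformationTheory in
/-- The entropy of the cell averages of a density approaches that of the density. -/
lemma exists_entropy_stepAvg_le {ρ : E d → ℝ} (hρ : Integrable ρ) (h0 : ∀ x, 0 ≤ ρ x)
    (hlog : Integrable fun x => ρ x * Real.log (ρ x)) {R : ℝ} (hR : 0 < R) {ε : ℝ} (hε : 0 < ε) :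
    ∃ N : ℕ, 0 < N ∧ ∫ x in box d R, ρ x * Real.log (ρ x) ≤
      (∫ x in box d R, ρ x * Real.log (stepAvg ρ R N x)) + ε := by
  by_contra! hcon
  have hvol : IntegrableOn (fun _ : E d => (1 : ℝ)) (box d R) :=
    integrableOn_const (volume_box_ne_top R)
  have hs0 := fun (n : ℕ) x => stepAvg_nonneg h0 hR (n + 1) x
  have hkl : IntegrableOn (fun x => klFun (ρ x)) (box d R) :=
    (hlog.integrableOn.add hvol).sub hρ.integrableOn
  have hkls : ∀ n : ℕ, IntegrableOn (fun x => klFun (stepAvg ρ R (n + 1) x)) (box d R) :=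
    fun n => integrableOn_box_of_cells hR n.succ_pos (integrableOn_comp_stepAvg hR n.succ_pos klFun)
  -- By self-adjointness of averaging, the two integrals of `klFun` differ from the two sides being
  -- compared by the same constant.
  have hIs : ∀ n : ℕ, ∫ x in box d R, klFun (stepAvg ρ R (n + 1) x) =
      (∫ x in box d R, ρ x * Real.log (stepAvg ρ R (n + 1) x)) + (∫ _ in box d R, (1 : ℝ)) -
        ∫ x in box d R, ρ x := fun n => by
    have h1 := setIntegral_stepAvg_mul hR n.succ_pos hρ Real.log
    have h2 := setIntegral_stepAvg_mul hR n.succ_pos hρ fun _ => 1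
    simp only [mul_one] at h2
    have i1 := integrableOn_box_of_cells hR n.succ_pos
      (integrableOn_comp_stepAvg (f := ρ) hR n.succ_pos fun t => t * Real.log t)
    have i2 := integrableOn_box_of_cells hR n.succ_pos
      (integrableOn_comp_stepAvg (f := ρ) hR n.succ_pos fun t => t)
    rw [← h1, ← h2, ← integral_add i1 hvol]
    exact integral_sub (i1.add hvol) i2
  have hI : ∫ x in box d R, klFun (ρ x) = (∫ x in box d R, ρ x * Real.log (ρ x)) +
      (∫ _ in box d R, (1 : ℝ)) - ∫ x in box d R, ρ x := by
    rw [← integral_add hlog.integrableOn hvol]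
    exact integral_sub (hlog.integrableOn.add hvol) hρ.integrableOn
  have hlt : ∀ n : ℕ, ∫ x in box d R, klFun (stepAvg ρ R (n + 1) x) <
      (∫ x in box d R, klFun (ρ x)) - ε := fun n => by
    rw [hIs, hI]; linarith [hcon (n + 1) n.succ_pos]
  have hpos : 0 ≤ (∫ x in box d R, klFun (ρ x)) - ε :=
    le_trans (integral_nonneg fun x => klFun_nonneg (hs0 0 x)) (hlt 0).le
  -- Passing to `klFun`, which is nonnegative and continuous, makes Fatou's lemma applicable; lower
  -- semicontinuity is the only direction needed.
  have hfatou : ∫⁻ x in box d R, ENNReal.ofReal (klFun (ρ x)) ≤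
      liminf (fun n : ℕ => ∫⁻ x in box d R, ENNReal.ofReal (klFun (stepAvg ρ R (n + 1) x)))
        atTop := by
    refine le_trans (lintegral_mono_ae ?_) (lintegral_liminf_le fun n =>
      (measurable_klFun.comp (measurable_stepAvg ρ R (n + 1))).ennreal_ofReal)
    filter_upwards [ae_restrict_of_ae (ae_tendsto_stepAvg hρ hR),
      ae_restrict_mem (measurableSet_box R)] with x hx hxB
    have := (ENNReal.continuous_ofReal.comp continuous_klFun).continuousAt.tendsto.comp (hx hxB)
    exact this.liminf_eq.ge
  have hle : ENNReal.ofReal (∫ x in box d R, klFun (ρ x)) ≤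
      ENNReal.ofReal ((∫ x in box d R, klFun (ρ x)) - ε) := by
    rw [ofReal_integral_eq_lintegral_ofReal hkl (ae_of_all _ fun x => klFun_nonneg (h0 x))]
    refine hfatou.trans (liminf_le_of_le (by isBoundedDefault) fun b hb => ?_)
    obtain ⟨n, hn⟩ := hb.exists
    refine hn.trans ?_
    rw [← ofReal_integral_eq_lintegral_ofReal (hkls n) (ae_of_all _ fun x => klFun_nonneg (hs0 n x))]
    exact ENNReal.ofReal_le_ofReal (hlt n).le
  rw [ENNReal.ofReal_le_ofReal_iff hpos] at hle
  linarith

/-! ### Small divergence from the pullback of the standard Gaussian -/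

/-- The density of the standard Gaussian on `ℝ^d`. -/
def gaussD (x : E d) : ℝ := ∏ i, gauss (x i)

/-- The logarithm of the density of the standard Gaussian on `ℝ^d`. -/
def logGaussD (x : E d) : ℝ := -(‖x‖ ^ 2 / 2) - d * Real.log (√(2 * Real.pi))

lemma gaussD_pos (x : E d) : 0 < gaussD x := Finset.prod_pos fun i _ => gauss_pos (x i)

lemma gaussD_le_one (x : E d) : gaussD x ≤ 1 :=
  Finset.prod_le_one (fun i _ => (gauss_pos (x i)).le) fun i _ => gauss_le_one (x i)

lemma log_gaussD (x : E d) : Real.log (gaussD x) = logGaussD x := by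
  rw [gaussD, Real.log_prod fun i _ => (gauss_pos (x i)).ne']
  simp only [log_gauss, Finset.sum_sub_distrib, Finset.sum_neg_distrib, ← Finset.sum_div,
    Finset.sum_const, Finset.card_univ, Fintype.card_fin, nsmul_eq_mul, logGaussD,
    EuclideanSpace.real_norm_sq_eq]

@[fun_prop]
lemma continuous_gaussD : Continuous (gaussD : E d → ℝ) := by unfold gaussD; fun_prop

@[fun_prop]
lemma continuous_logGaussD : Continuous (logGaussD : E d → ℝ) := by unfold logGaussD; fun_prop

lemma tendsto_gaussMass : Tendsto gaussMass atTop (𝓝 1) := by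
  have h : Integrable gauss := by
    rw [gauss_eq_gaussianPDFReal]; exact ProbabilityTheory.integrable_gaussianPDFReal 0 1
  have := intervalIntegral_tendsto_integral h tendsto_neg_atTop_atBot tendsto_id
  rwa [gauss_eq_gaussianPDFReal,
    ProbabilityTheory.integral_gaussianPDFReal_eq_one 0 one_ne_zero,
    ← gauss_eq_gaussianPDFReal] at this

lemma densityMeasure_apply {ρ : E d → ℝ} (hρ : Integrable ρ) (h0 : ∀ x, 0 ≤ ρ x) {s : Set (E d)}
    (hs : MeasurableSet s) : densityMeasure ρ s = ENNReal.ofReal (∫ x in s, ρ x) := by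
  rw [densityMeasure, withDensity_apply _ hs,
    ofReal_integral_eq_lintegral_ofReal hρ.integrableOn (ae_of_all _ h0)]

lemma densityMeasure_real {ρ : E d → ℝ} (hρ : Integrable ρ) (h0 : ∀ x, 0 ≤ ρ x) {s : Set (E d)}
    (hs : MeasurableSet s) : (densityMeasure ρ).real s = ∫ x in s, ρ x := by
  rw [measureReal_def, densityMeasure_apply hρ h0 hs,
    ENNReal.toReal_ofReal (integral_nonneg h0)]

/-- The integrand of the divergence from the pullback of the standard Gaussian under `Ψ`. -/
def divIntegrand (ρ : E d → ℝ) (Ψ : E d → E d) (ℓ : E d → ℝ) (x : E d) : ℝ :=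
  ρ x * Real.log (ρ x) - ρ x * (logGaussD (Ψ x) + ℓ x)

/-- Dominated convergence: linear growth of the maps makes the log-Gaussian grow at most
quadratically, so entropy, mass and second moment of `ρ` supply a common majorant. -/
lemma LimitReachable.exists_reachable {ρ : E d → ℝ} (h0 : ∀ x, 0 ≤ ρ x) (hρ : Integrable ρ)
    (hlog : Integrable fun x => ρ x * Real.log (ρ x))
    (hsq : Integrable fun x => ρ x * ‖x‖ ^ 2) {Ψ : E d → E d} {ℓ : E d → ℝ}
    (h : LimitReachable Ψ ℓ) {ε : ℝ} (hε : 0 < ε) :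
    Integrable (divIntegrand ρ Ψ ℓ) ∧ ∃ Ψ' ℓ', Reachable Ψ' ℓ' ∧
      Integrable (divIntegrand ρ Ψ' ℓ') ∧
      ∫ x, divIntegrand ρ Ψ' ℓ' x ≤ (∫ x, divIntegrand ρ Ψ ℓ x) + ε := by
  obtain ⟨Ψn, ℓn, C, hC, hr, heq, hgrow, hbd⟩ := h
  set D := |d * Real.log (√(2 * Real.pi))| with hD
  set g : E d → ℝ := fun x => |ρ x * Real.log (ρ x)| +
    ((C ^ 2 + D + C) * ρ x + C ^ 2 * (ρ x * ‖x‖ ^ 2)) with hg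
  have hgi : Integrable g := hlog.abs.add ((hρ.const_mul _).add (hsq.const_mul _))
  have hmeas : ∀ n, AEStronglyMeasurable (divIntegrand ρ (Ψn n) (ℓn n)) volume := fun n => by
    refine hlog.1.sub (hρ.1.mul ?_)
    exact ((continuous_logGaussD.comp (hr n).continuous).measurable.add
      (hr n).isChange.measurable_log).aestronglyMeasurable
  have hle : ∀ n, ∀ x, ‖divIntegrand ρ (Ψn n) (ℓn n) x‖ ≤ g x := fun n x => by
    have h1 : |logGaussD (Ψn n x) + ℓn n x| ≤ C ^ 2 + D + C + C ^ 2 * ‖x‖ ^ 2 := by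
      have h2 : ‖Ψn n x‖ ^ 2 / 2 ≤ C ^ 2 + C ^ 2 * ‖x‖ ^ 2 := by
        have h3 : ‖Ψn n x‖ ^ 2 ≤ (C * (1 + ‖x‖)) ^ 2 := by
          gcongr; exact hgrow n x
        nlinarith [sq_nonneg (C * (1 - ‖x‖))]
      refine (abs_add_le _ _).trans ?_
      have h4 : |logGaussD (Ψn n x)| ≤ ‖Ψn n x‖ ^ 2 / 2 + D := by
        refine (abs_sub _ _).trans ?_
        rw [abs_neg, abs_of_nonneg (by positivity)]
      linarith [hbd n x]
    rw [Real.norm_eq_abs]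
    refine (abs_sub _ _).trans ?_
    rw [abs_mul (ρ x) (logGaussD (Ψn n x) + ℓn n x), abs_of_nonneg (h0 x)]
    have := mul_le_mul_of_nonneg_left h1 (h0 x)
    simp only [hg]
    linarith
  have hlim : ∀ x, Tendsto (fun n => divIntegrand ρ (Ψn n) (ℓn n) x) atTop
      (𝓝 (divIntegrand ρ Ψ ℓ x)) := fun x => by
    refine tendsto_const_nhds.congr' ?_
    filter_upwards [heq x] with n hn
    simp [divIntegrand, hn.1, hn.2]
  have hint : ∀ n, Integrable (divIntegrand ρ (Ψn n) (ℓn n)) := fun n =>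
    hgi.mono' (hmeas n) (ae_of_all _ (hle n))
  refine ⟨hgi.mono' (aestronglyMeasurable_of_tendsto_ae atTop hmeas (ae_of_all _ hlim))
    (ae_of_all _ fun x => le_of_tendsto (hlim x).norm (Eventually.of_forall fun n => hle n x)), ?_⟩
  have hconv := tendsto_integral_of_dominated_convergence g hmeas hgi
    (fun n => ae_of_all _ (hle n)) (ae_of_all _ hlim)
  obtain ⟨n, hn⟩ := (hconv.eventually_le_const (lt_add_of_pos_right _ hε)).exists
  exact ⟨Ψn n, ℓn n, hr n, hint n, hn⟩

lemma box_mono {R R' : ℝ} (h : R ≤ R') : box d R ⊆ box d R' := fun _ hx j =>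
  ⟨(neg_le_neg h).trans (hx j).1, (hx j).2.trans_le h⟩

lemma le_norm_of_notMem_box {R : ℝ} {x : E d} (hx : x ∉ box d R) : R ≤ ‖x‖ := by
  simp only [box, mem_ofPred_eq, not_forall, mem_Ico, not_and_or, not_le, not_lt] at hx
  obtain ⟨j, hj⟩ := hx
  refine le_trans ?_ (abs_apply_le_norm x j)
  rcases hj with hj | hj
  · exact (by linarith : R ≤ -x j).trans (neg_le_abs _)
  · exact hj.trans (le_abs_self _)

lemma tendsto_setIntegral_box_compl {H : E d → ℝ} (hH : Integrable H) :
    Tendsto (fun n : ℕ => ∫ x in (box d n)ᶜ, H x) atTop (𝓝 0) := by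
  have h1 := tendsto_setIntegral_of_antitone (μ := (volume : Measure (E d))) (f := H)
    (s := fun n : ℕ => (box d n)ᶜ) (fun n => (measurableSet_box n).compl)
    (fun m n hmn => compl_subset_compl.2 (box_mono (by exact_mod_cast hmn)))
    ⟨0, hH.integrableOn⟩
  have h2 : ⋂ n : ℕ, (box d n)ᶜ = ∅ := by
    ext x
    simp only [mem_iInter, mem_compl_iff, mem_empty_iff_false, iff_false, not_forall, not_not]
    obtain ⟨n, hn⟩ := exists_nat_gt ‖x‖
    exact ⟨n, by_contra fun h => absurd (le_norm_of_notMem_box h) (not_le.2 hn)⟩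
  rwa [h2, setIntegral_empty] at h1

/-- Covers the cells where the logarithm of the average has its conventional value `0`: there `ρ`
itself vanishes, so the integrands do too. -/
lemma ae_eq_zero_of_stepAvg_eq_zero {ρ : E d → ℝ} (h0 : ∀ x, 0 ≤ ρ x) (hρ : Integrable ρ)
    {R : ℝ} (hR : 0 < R) {N : ℕ} (hN : 0 < N) :
    ∀ᵐ x, x ∈ box d R → stepAvg ρ R N x = 0 → ρ x = 0 := by
  have hN' : (0 : ℝ) < N := by exact_mod_cast hN
  have h : ∀ k : Fin d → Fin N, ∀ᵐ x, x ∈ gridCell R N k → cellAvg ρ R N k = 0 → ρ x = 0 := by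
    intro k
    by_cases hk : cellAvg ρ R N k = 0
    · rw [cellAvg, mul_eq_zero, or_iff_right (by positivity),
        setIntegral_eq_zero_iff_of_nonneg_ae (ae_of_all _ h0) hρ.integrableOn] at hk
      filter_upwards [(ae_restrict_iff' (measurableSet_gridCell R N k)).1 hk] with x hx hxk _
      exact hx hxk
    · exact ae_of_all _ fun x _ h => absurd h hk
  filter_upwards [ae_all_iff.2 h] with x hx hxB hs
  obtain ⟨k, hk⟩ := exists_mem_gridCell hR hN hxB
  exact hx k hk (by rwa [stepAvg_of_mem ρ hR hN hk] at hs)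

/-- Every density with finite entropy and second moment is within `ε`, in divergence, of the
pullback of the standard Gaussian under a composition of perceptron flows. -/
lemma exists_reachable_divergence_le {ρ : E d → ℝ} (hρ : IsProbDensity ρ)
    (hlog : Integrable fun x => ρ x * Real.log (ρ x))
    (hsq : Integrable fun x => ρ x * ‖x‖ ^ 2) {ε : ℝ} (hε : 0 < ε) :
    ∃ Ψ ℓ, Reachable Ψ ℓ ∧ Integrable (divIntegrand ρ Ψ ℓ) ∧
      ∫ x, divIntegrand ρ Ψ ℓ x ≤ ε := by
  obtain ⟨h0, hint, hone⟩ := hρ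
  -- Each coordinate loses three factors `exp (-δ)`: from the variation of the Gaussian on a piece,
  -- from `gaussMass R`, and from `1 - η`. Their total `3 * d * δ` must fit in `ε / 4`; the `+ 1`
  -- covers `d = 0`.
  set δ := ε / (12 * (d + 1)) with hδ
  have hδ0 : 0 < δ := by positivity
  have hdδ : 3 * d * δ ≤ ε / 4 := by
    have : (d : ℝ) * δ ≤ ε / 12 := by
      rw [hδ, ← mul_div_assoc, div_le_div_iff₀ (by positivity) (by positivity)]
      nlinarith
    linarith
  set η := 1 - Real.exp (-δ) with hη
  have hη0 : 0 < η := by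
    have : Real.exp (-δ) < 1 := Real.exp_lt_one_iff.2 (by linarith)
    linarith
  have hη1 : η < 1 := by linarith [Real.exp_pos (-δ)]
  set C₀ := 2 * δ - Real.log η with hC₀
  have hC₀0 : 0 ≤ C₀ := by linarith [Real.log_neg hη0 hη1]
  set D := (d : ℝ) * Real.log (√(2 * Real.pi)) with hD
  -- The majorant for the outside of the box. `R` is chosen next so that its tail is small, hence
  -- its constants may involve `δ` but neither `R` nor `N`.
  set H : E d → ℝ := fun x => |ρ x * Real.log (ρ x)| +
    ((D + d * C₀ + d) * ρ x + (1 / 2 + d) * (ρ x * ‖x‖ ^ 2)) with hH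
  have hHi : Integrable H := hlog.abs.add ((hint.const_mul _).add (hsq.const_mul _))
  obtain ⟨n, hn1, hn2, hn3⟩ := (((tendsto_setIntegral_box_compl hHi).eventually_le_const
    (show 0 < ε / 4 by positivity)).and (((tendsto_gaussMass.comp
      tendsto_natCast_atTop_atTop).eventually_const_le
      (show Real.exp (-δ) < 1 from Real.exp_lt_one_iff.2 (by linarith))).and
      (eventually_ge_atTop 1))).exists
  set R : ℝ := (n : ℝ) with hRn
  have hR : 0 < R := by rw [hRn]; exact_mod_cast hn3
  have hm : Real.exp (-δ) ≤ gaussMass R := hn2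
  obtain ⟨N, hN, hNe⟩ := exists_entropy_stepAvg_le hint h0 hlog hR (show 0 < ε / 4 by positivity)
  have hfin : IsFiniteMeasure (densityMeasure ρ) := ⟨by
    rw [densityMeasure_apply hint h0 MeasurableSet.univ]; exact ENNReal.ofReal_lt_top⟩
  obtain ⟨Ψ, ℓ, hΨ, hcell, hall⟩ := exists_limitReachable_grid (densityMeasure ρ) hR hN hδ0 hη0 hη1
  obtain ⟨hi, Ψ', ℓ', hr, hi', hle⟩ := hΨ.exists_reachable h0 hint hlog hsq
    (show 0 < ε / 4 by positivity)
  refine ⟨Ψ', ℓ', hr, hi', hle.trans ?_⟩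
  suffices hmain : ∫ x, divIntegrand ρ Ψ ℓ x ≤ 3 * (ε / 4) by linarith
  have hlogr : ∀ x, Real.log (gaussD (Ψ x) * Real.exp (ℓ x)) = logGaussD (Ψ x) + ℓ x := fun x => by
    rw [Real.log_mul (gaussD_pos _).ne' (Real.exp_pos _).ne', log_gaussD, Real.log_exp]
  have hin : ∀ᵐ x, x ∈ box d R → divIntegrand ρ Ψ ℓ x ≤
      ρ x * Real.log (ρ x) - ρ x * Real.log (stepAvg ρ R N x) + 3 * d * δ * ρ x := by
    filter_upwards [ae_eq_zero_of_stepAvg_eq_zero h0 hint hR hN] with x hx hxB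
    rcases (stepAvg_nonneg h0 hR N x).eq_or_lt with hs | hs
    · simp [divIntegrand, hx hxB hs.symm]
    obtain ⟨k, hk⟩ := exists_mem_gridCell hR hN hxB
    have h1 := hcell k x hk
    rw [densityMeasure_real hint h0 (measurableSet_gridCell R N k),
      densityMeasure_real hint h0 (measurableSet_box R)] at h1
    have hb1 : ∫ x in box d R, ρ x ≤ 1 := by
      rw [← hone]; exact setIntegral_le_integral hint (ae_of_all _ h0)
    have h2 : Real.exp (-(3 * d * δ)) * stepAvg ρ R N x ≤ gaussD (Ψ x) * Real.exp (ℓ x) := by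
      rw [stepAvg_of_mem ρ hR hN hk, cellAvg]
      have hpos : 0 ≤ gaussD (Ψ x) * Real.exp (ℓ x) :=
        mul_nonneg (gaussD_pos _).le (Real.exp_pos _).le
      have hI : 0 ≤ ∫ x in gridCell R N k, ρ x := integral_nonneg h0
      calc Real.exp (-(3 * d * δ)) * ((N / (2 * R)) ^ d * ∫ x in gridCell R N k, ρ x)
          = (Real.exp (-δ) * Real.exp (-δ) * Real.exp (-δ) * (N / (2 * R))) ^ d *
              ∫ x in gridCell R N k, ρ x := by
            have e : Real.exp (-(3 * d * δ)) =
                (Real.exp (-δ) * Real.exp (-δ) * Real.exp (-δ)) ^ d := by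
              rw [← Real.exp_add, ← Real.exp_add, ← Real.exp_nat_mul]
              congr 1; ring
            rw [mul_pow _ ((N : ℝ) / (2 * R)), ← e]
            exact (mul_assoc _ _ _).symm
        _ ≤ (Real.exp (-δ) * gaussMass R * (1 - η) * (N / (2 * R))) ^ d *
              ∫ x in gridCell R N k, ρ x := by
            have : 1 - η = Real.exp (-δ) := by rw [hη]; ring
            rw [this]
            gcongr
        _ ≤ (∫ x in box d R, ρ x) * (gaussD (Ψ x) * Real.exp (ℓ x)) := h1
        _ ≤ gaussD (Ψ x) * Real.exp (ℓ x) := mul_le_of_le_one_left hpos hb1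
    have h3 := Real.log_le_log (mul_pos (Real.exp_pos _) hs) h2
    rw [hlogr, Real.log_mul (Real.exp_pos _).ne' hs.ne', Real.log_exp] at h3
    have h4 := mul_le_mul_of_nonneg_left h3 (h0 x)
    simp only [divIntegrand]
    linarith
  have hout : ∀ x, x ∈ (box d R)ᶜ → divIntegrand ρ Ψ ℓ x ≤ H x := fun x hx => by
    set κ := min 1 (Real.exp (-δ) * gaussMass R * η / (2 * R)) with hκ
    -- The logarithmic cost per coordinate is affine in `R`, because `exp (-(2 * R)) ≤ 1 / (2 * R)`.
    have hκ1 : Real.exp (-(C₀ + 2 * R)) ≤ κ := by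
      refine le_min (Real.exp_le_one_iff.2 (by linarith)) ?_
      have e1 : Real.exp (-(C₀ + 2 * R)) =
          Real.exp (-δ) * Real.exp (-δ) * η * Real.exp (-(2 * R)) := by
        conv_rhs => rw [← Real.exp_log hη0]
        rw [← Real.exp_add, ← Real.exp_add, ← Real.exp_add, hC₀]
        congr 1; ring
      have e2 : Real.exp (-(2 * R)) ≤ (2 * R)⁻¹ := by
        rw [Real.exp_neg]
        exact inv_anti₀ (by positivity) (by linarith [Real.add_one_le_exp (2 * R)])
      rw [e1, div_eq_mul_inv]
      exact mul_le_mul (by gcongr) e2 (Real.exp_pos _).le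
        (mul_nonneg (mul_nonneg (Real.exp_pos _).le ((Real.exp_pos _).le.trans hm)) hη0.le)
    have h1 : Real.exp (-(C₀ + 2 * R)) ^ d * gaussD x ≤ gaussD (Ψ x) * Real.exp (ℓ x) := by
      refine le_trans ?_ (hall x)
      have := (gaussD_pos x).le
      change _ ≤ κ ^ d * gaussD x
      gcongr
    have h2 := Real.log_le_log (mul_pos (pow_pos (Real.exp_pos _) d) (gaussD_pos x)) h1
    rw [hlogr, Real.log_mul (pow_pos (Real.exp_pos _) d).ne' (gaussD_pos x).ne', Real.log_pow,
      Real.log_exp, log_gaussD, logGaussD] at h2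
    have hRx : R ≤ ‖x‖ := le_norm_of_notMem_box hx
    have h3 : -(logGaussD (Ψ x) + ℓ x) ≤ (D + d * C₀ + d) + (1 / 2 + d) * ‖x‖ ^ 2 := by
      -- Off the box `R ≤ ‖x‖`, so the dependence on `R` is absorbed by the second moment.
      have h4 : (d : ℝ) * (2 * R) ≤ d * (1 + ‖x‖ ^ 2) := by
        gcongr
        nlinarith [sq_nonneg (1 - ‖x‖)]
      rw [← hD] at h2
      nlinarith
    have h5 := mul_le_mul_of_nonneg_left h3 (h0 x)
    have h6 := le_abs_self (ρ x * Real.log (ρ x))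
    simp only [divIntegrand, hH]
    nlinarith
  have hstep : IntegrableOn (fun x => ρ x * Real.log (stepAvg ρ R N x)) (box d R) :=
    integrableOn_box_of_cells hR hN (integrableOn_mul_comp_stepAvg hR hN hint Real.log)
  rw [← integral_add_compl (measurableSet_box R) hi]
  -- One quarter for the entropy lost by averaging, one for `3 * d * δ`. The tail and the
  -- replacement of the limit map by `Ψ'` take the other two.
  have hA : ∫ x in box d R, divIntegrand ρ Ψ ℓ x ≤ ε / 4 + ε / 4 := by
    have h1 : ∫ x in box d R, divIntegrand ρ Ψ ℓ x ≤ ∫ x in box d R,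
        (ρ x * Real.log (ρ x) - ρ x * Real.log (stepAvg ρ R N x) + 3 * d * δ * ρ x) := by
      refine setIntegral_mono_on_ae hi.integrableOn
        ((hlog.integrableOn.sub hstep).add (hint.integrableOn.const_mul _)) (measurableSet_box R) hin
    have h2 : ∫ x in box d R, (ρ x * Real.log (ρ x) - ρ x * Real.log (stepAvg ρ R N x) +
        3 * d * δ * ρ x) = (∫ x in box d R, ρ x * Real.log (ρ x)) -
        (∫ x in box d R, ρ x * Real.log (stepAvg ρ R N x)) + 3 * d * δ * ∫ x in box d R, ρ x := by
      have e1 := integral_add (hlog.integrableOn.sub hstep) (hint.integrableOn.const_mul (3 * d * δ))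
      have e2 := integral_sub hlog.integrableOn hstep
      have e3 := integral_const_mul (μ := volume.restrict (box d R)) (3 * d * δ) ρ
      rw [← e2, ← e3]
      exact e1
    have hb1 : ∫ x in box d R, ρ x ≤ 1 := by
      rw [← hone]; exact setIntegral_le_integral hint (ae_of_all _ h0)
    have h3 : 3 * d * δ * ∫ x in box d R, ρ x ≤ 3 * d * δ * 1 := by gcongr
    linarith
  have hB : ∫ x in (box d R)ᶜ, divIntegrand ρ Ψ ℓ x ≤ ε / 4 :=
    (setIntegral_mono_on hi.integrableOn hHi.integrableOn (measurableSet_box R).compl hout).trans hn1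
  linarith

/-! ### Gaussian measures -/

lemma integrable_exp_neg_mul_sq_norm {b : ℝ} (hb : 0 < b) :
    Integrable fun x : E d => Real.exp (-b * ‖x‖ ^ 2) := by
  have h := (GaussianFourier.integrable_cexp_neg_mul_sq_norm_add (V := E d) (b := (b : ℂ))
    (by simpa using hb) 0 0).norm
  refine h.congr (ae_of_all _ fun x => ?_)
  show ‖Complex.exp _‖ = _
  rw [Complex.norm_exp]
  simp [← Complex.ofReal_pow]

/-- A density with a Gaussian tail has a finite second moment. -/
lemma integrable_mul_sq_norm_of_tail {ρ : E d → ℝ} (h0 : ∀ x, 0 ≤ ρ x) (hρ : Integrable ρ)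
    {M σ K : ℝ} (hσ : 0 < σ)
    (htail : ∀ x, M ≤ ‖x‖ → ρ x ≤ K * Real.exp (-‖x‖ ^ 2 / (2 * σ ^ 2))) :
    Integrable fun x => ρ x * ‖x‖ ^ 2 := by
  have hb : 0 < 1 / (4 * σ ^ 2) := by positivity
  have hg : Integrable fun x : E d =>
      M ^ 2 * ρ x + |K| * (4 * σ ^ 2) * Real.exp (-(1 / (4 * σ ^ 2)) * ‖x‖ ^ 2) :=
    (hρ.const_mul _).add ((integrable_exp_neg_mul_sq_norm hb).const_mul _)
  refine hg.mono' (hρ.1.mul (by fun_prop)) (ae_of_all _ fun x => ?_)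
  rw [Real.norm_of_nonneg (mul_nonneg (h0 x) (by positivity))]
  by_cases hx : M ≤ ‖x‖
  -- Half of the Gaussian exponent absorbs `‖x‖ ^ 2`; the other half remains as an integrable
  -- majorant.
  · set t := ‖x‖ ^ 2 / (4 * σ ^ 2) with ht
    have e1 : Real.exp (-‖x‖ ^ 2 / (2 * σ ^ 2)) = Real.exp (-t) * Real.exp (-t) := by
      rw [← Real.exp_add, ht]; congr 1; field_simp; ring
    have e2 : Real.exp (-(1 / (4 * σ ^ 2)) * ‖x‖ ^ 2) = Real.exp (-t) := by
      rw [ht]; congr 1; ring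
    have e3 : ‖x‖ ^ 2 = 4 * σ ^ 2 * t := by rw [ht]; field_simp
    have h1 : t * Real.exp (-t) ≤ 1 := by
      rw [Real.exp_neg, ← div_eq_mul_inv, div_le_one (Real.exp_pos _)]
      linarith [Real.add_one_le_exp t]
    have h2 := htail x hx
    rw [e1] at h2
    have h3 : ρ x ≤ |K| * (Real.exp (-t) * Real.exp (-t)) :=
      h2.trans (mul_le_mul_of_nonneg_right (le_abs_self K) (by positivity))
    have h4 : ρ x * ‖x‖ ^ 2 ≤ |K| * (Real.exp (-t) * Real.exp (-t)) * ‖x‖ ^ 2 := by gcongr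
    have h5 : |K| * (Real.exp (-t) * Real.exp (-t)) * ‖x‖ ^ 2 =
        |K| * (4 * σ ^ 2) * Real.exp (-t) * (t * Real.exp (-t)) := by
      rw [e3]; ring
    have h6 : |K| * (4 * σ ^ 2) * Real.exp (-t) * (t * Real.exp (-t)) ≤
        |K| * (4 * σ ^ 2) * Real.exp (-t) * 1 := by gcongr
    have h7 : 0 ≤ M ^ 2 * ρ x := mul_nonneg (sq_nonneg _) (h0 x)
    rw [e2]
    linarith
  · push Not at hx
    have h1 : ‖x‖ ^ 2 ≤ M ^ 2 := by gcongr
    have h2 := mul_le_mul_of_nonneg_left h1 (h0 x)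
    have h3 : 0 ≤ |K| * (4 * σ ^ 2) * Real.exp (-(1 / (4 * σ ^ 2)) * ‖x‖ ^ 2) := by positivity
    linarith

lemma stdGaussian_eq_withDensity :
    ProbabilityTheory.stdGaussian (E d) = volume.withDensity fun x => ENNReal.ofReal (gaussD x) := by
  have hgi : Integrable gauss := by
    rw [gauss_eq_gaussianPDFReal]; exact ProbabilityTheory.integrable_gaussianPDFReal 0 1
  have hpi : Measure.pi (fun _ : Fin d => ProbabilityTheory.gaussianReal 0 1) =
      volume.withDensity fun x : Fin d → ℝ => ENNReal.ofReal (∏ i, gauss (x i)) := by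
    refine Measure.pi_eq fun s hs => ?_
    rw [withDensity_apply _ (MeasurableSet.univ_pi hs), volume_pi, Measure.restrict_pi_pi,
      ← ofReal_integral_eq_lintegral_ofReal
        (Integrable.fintype_prod (f := fun _ => gauss) fun i => hgi.restrict)
        (ae_of_all _ fun x => Finset.prod_nonneg fun i _ => (gauss_pos _).le),
      integral_fintype_prod_eq_prod (fun _ => gauss),
      ENNReal.ofReal_prod_of_nonneg fun i _ => integral_nonneg fun x => (gauss_pos x).le]
    refine Finset.prod_congr rfl fun i _ => ?_
    rw [ProbabilityTheory.gaussianReal_apply_eq_integral 0 one_ne_zero, gauss_eq_gaussianPDFReal]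
  rw [← ProbabilityTheory.map_pi_eq_stdGaussian, hpi]
  ext s hs
  rw [Measure.map_apply (by fun_prop) hs, withDensity_apply _ ((by fun_prop :
    Measurable (WithLp.toLp 2 : (Fin d → ℝ) → E d)) hs), withDensity_apply _ hs]
  exact (PiLp.volume_preserving_toLp (Fin d)).setLIntegral_comp_preimage hs
    (f := fun x => ENNReal.ofReal (gaussD x)) (by fun_prop)

lemma reachable_translation (m : E d) : Reachable (fun x : E d => x + m) 0 := by
  have h0 : rate (m, (0 : E d), (1 : ℝ)) = 0 := by simp [rate]
  convert reachable_flow (m, (0 : E d), (1 : ℝ)) using 1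
  · ext1 x; simp [flow, h0, expPrim, preact]
  · ext1 x; simp [logJac, h0]

/-- One field stretches only one side of the hyperplane orthogonal to `u`. A second one, with `a`
and `w` reversed, stretches the other side, and neither carries points across. -/
lemma exists_reachable_dilation {u : E d} (hu : ‖u‖ = 1) {r : ℝ} (hr : 0 < r) :
    ∃ ℓ, Reachable (fun x : E d => x + ((r - 1) * inner ℝ u x) • u) ℓ := by
  set c := Real.log r with hc
  have huu : inner ℝ u u = (1 : ℝ) := by rw [real_inner_self_eq_norm_sq, hu]; norm_num
  have h1 : rate (c • u, u, (0 : ℝ)) = c := by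
    simp only [rate, inner_smul_right, huu, mul_one]
  have h2 : rate ((-c) • u, -u, (0 : ℝ)) = c := by
    simp only [rate, inner_smul_right, inner_neg_left, huu]; ring
  have he : expPrim c 1 * c = r - 1 := by
    rw [mul_comm, mul_expPrim, mul_one, hc, Real.exp_log hr]
  have h := (reachable_flow ((-c) • u, -u, (0 : ℝ))).comp (reachable_flow (c • u, u, (0 : ℝ)))
  suffices hfun : (fun x : E d => x + ((r - 1) * inner ℝ u x) • u) =
      flow ((-c) • u, -u, (0 : ℝ)) 1 ∘ flow (c • u, u, (0 : ℝ)) 1 from ⟨_, hfun ▸ h⟩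
  ext1 x
  rcases le_or_gt (inner ℝ u x) 0 with hx | hx
  · have hfix : flow (c • u, u, (0 : ℝ)) 1 x = x := flow_of_nonpos (by simpa [preact] using hx) 1
    rw [Function.comp, hfix, flow, h2, preact]
    simp only [inner_neg_left, add_zero, max_eq_left (neg_nonneg.2 hx), smul_smul, ← he]
    congr 2; ring
  · have hpos : 0 < preact (c • u, u, (0 : ℝ)) x := by simpa [preact] using hx
    rw [Function.comp, flow_of_nonpos (p := ((-c) • u, -u, (0 : ℝ)))]
    · rw [flow, h1, preact]
      simp only [add_zero, max_eq_left hx.le, smul_smul, ← he]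
      congr 2; ring
    · have := (preact_flow_pos_iff (c • u, u, (0 : ℝ)) 1 x).2 hpos
      simp only [preact, inner_neg_left, add_zero] at this ⊢
      linarith

/-- By orthogonality each dilation leaves the remaining coefficients unchanged, so the displacements
simply add up. -/
lemma exists_reachable_of_orthonormalBasis {ι : Type*} [Fintype ι]
    (u : OrthonormalBasis ι ℝ (E d)) {r : ι → ℝ} (hr : ∀ k, 0 < r k) :
    ∃ ℓ, Reachable (fun x : E d => ∑ k, (r k * inner ℝ (u k) x) • u k) ℓ := by
  classical
  suffices H : ∀ S : Finset ι, ∃ ℓ,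
      Reachable (fun x : E d => x + ∑ k ∈ S, ((r k - 1) * inner ℝ (u k) x) • u k) ℓ by
    obtain ⟨ℓ, hℓ⟩ := H Finset.univ
    refine ⟨ℓ, ?_⟩
    convert hℓ using 1
    ext1 x
    calc ∑ k, (r k * inner ℝ (u k) x) • u k
        = ∑ k, inner ℝ (u k) x • u k + ∑ k, ((r k - 1) * inner ℝ (u k) x) • u k := by
          rw [← Finset.sum_add_distrib]
          refine Finset.sum_congr rfl fun k _ => ?_
          module
      _ = _ := by rw [u.sum_repr' x]
  intro S
  induction S using Finset.induction_on with
  | empty => exact ⟨0, by simpa using! Reachable.id⟩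
  | insert k S hk ih =>
    obtain ⟨ℓ, hℓ⟩ := ih
    obtain ⟨ℓ', hℓ'⟩ := exists_reachable_dilation (u.orthonormal.1 k) (hr k)
    suffices hfun : (fun x : E d => x + ∑ j ∈ insert k S, ((r j - 1) * inner ℝ (u j) x) • u j) =
        (fun x : E d => x + ((r k - 1) * inner ℝ (u k) x) • u k) ∘
          fun x : E d => x + ∑ j ∈ S, ((r j - 1) * inner ℝ (u j) x) • u j from
      ⟨_, hfun ▸ hℓ'.comp hℓ⟩
    ext1 x
    have : inner ℝ (u k) (∑ j ∈ S, ((r j - 1) * inner ℝ (u j) x) • u j) = (0 : ℝ) := by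
      rw [inner_sum]
      refine Finset.sum_eq_zero fun j hj => ?_
      rw [inner_smul_right, u.orthonormal.2 (fun h : k = j => hk (h.symm ▸ hj)), mul_zero]
    simp only [Function.comp, Finset.sum_insert hk, inner_add_right, this, add_zero]
    abel

-- Diagonalizing the square root writes it as dilations by its positive eigenvalues along an
-- orthonormal eigenbasis; this affine map is the one by which `multivariateGaussian` is defined
-- from `stdGaussian`.
open scoped MatrixOrder in
lemma exists_reachable_sqrt {S : Matrix (Fin d) (Fin d) ℝ} (hS : S.PosDef) (m : E d) :
    ∃ ℓ, Reachable (fun x : E d => m + Matrix.toEuclideanCLM (𝕜 := ℝ) (CFC.sqrt S) x) ℓ := by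
  have hQ0 : (CFC.sqrt S).PosSemidef := Matrix.nonneg_iff_posSemidef.1 (CFC.sqrt_nonneg S)
  have hQS : CFC.sqrt S * CFC.sqrt S = S := CFC.sqrt_mul_sqrt_self S hS.posSemidef.nonneg
  have hQ : (CFC.sqrt S).PosDef := by
    rw [hQ0.posDef_iff_isUnit]
    have := hS.isUnit
    rw [← hQS] at this
    exact isUnit_of_mul_isUnit_left this
  obtain ⟨ℓ, hℓ⟩ := exists_reachable_of_orthonormalBasis hQ.1.eigenvectorBasis
    (r := hQ.1.eigenvalues) hQ.eigenvalues_pos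
  suffices hfun : (fun x : E d => m + Matrix.toEuclideanCLM (𝕜 := ℝ) (CFC.sqrt S) x) =
      (fun x : E d => x + m) ∘ fun x : E d => ∑ k, (hQ.1.eigenvalues k *
        inner ℝ (hQ.1.eigenvectorBasis k) x) • hQ.1.eigenvectorBasis k from
    ⟨_, hfun ▸ (reachable_translation m).comp hℓ⟩
  ext1 x
  rw [Function.comp, add_comm]
  congr 1
  conv_lhs => rw [← hQ.1.eigenvectorBasis.sum_repr' x, map_sum]
  refine Finset.sum_congr rfl fun k _ => ?_
  have h1 : Matrix.toEuclideanCLM (𝕜 := ℝ) (CFC.sqrt S) (hQ.1.eigenvectorBasis k) =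
      hQ.1.eigenvalues k • hQ.1.eigenvectorBasis k := by
    have := hQ.1.mulVec_eigenvectorBasis k
    ext j
    exact congrFun this j
  rw [map_smul, h1, smul_smul, mul_comm]

open scoped MatrixOrder in
/-- The density of a nondegenerate Gaussian is carried to the standard one by a composition of
perceptron flows. -/
lemma exists_reachable_multivariateGaussian (m : E d) {S : Matrix (Fin d) (Fin d) ℝ}
    (hS : S.PosDef) :
    ∃ A ℓ, Reachable A ℓ ∧
      (∀ᵐ y, lebesgueDensity (ProbabilityTheory.multivariateGaussian m S) (A y) *
        Real.exp (ℓ y) = gaussD y) ∧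
      densityMeasure (lebesgueDensity (ProbabilityTheory.multivariateGaussian m S)) =
        ProbabilityTheory.multivariateGaussian m S ∧
      Integrable (lebesgueDensity (ProbabilityTheory.multivariateGaussian m S)) ∧
      ∃ C, ∀ᵐ x, |lebesgueDensity (ProbabilityTheory.multivariateGaussian m S) x| ≤ C := by
  obtain ⟨ℓ, hA⟩ := exists_reachable_sqrt hS m
  set A : E d → E d := fun x => m + Matrix.toEuclideanCLM (𝕜 := ℝ) (CFC.sqrt S) x with hAdef
  set μ := ProbabilityTheory.multivariateGaussian m S with hμ
  have hch := hA.isChange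
  have hmap : μ = (ProbabilityTheory.stdGaussian (E d)).map A := rfl
  have hac : μ ≪ volume := by
    rw [hmap, stdGaussian_eq_withDensity]
    exact ((withDensity_absolutelyContinuous _ _).map hch.embedding.measurable).trans
      hch.quasiMeasurePreserving.absolutelyContinuous
  have hdens : densityMeasure (lebesgueDensity μ) = μ := by
    conv_rhs => rw [← Measure.withDensity_rnDeriv_eq μ volume hac]
    refine withDensity_congr_ae ?_
    filter_upwards [Measure.rnDeriv_lt_top μ volume] with x hx
    exact ENNReal.ofReal_toReal hx.ne
  have hmeas : Measurable (lebesgueDensity μ) := (Measure.measurable_rnDeriv μ volume).ennreal_toReal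
  have hae : ∀ᵐ y, lebesgueDensity μ (A y) * Real.exp (ℓ y) = gaussD y := by
    have hm1 : Measurable fun y => ENNReal.ofReal (lebesgueDensity μ (A y) * Real.exp (ℓ y)) :=
      ((hmeas.comp hch.embedding.measurable).mul hch.measurable_log.exp).ennreal_ofReal
    have hm2 : Measurable fun y : E d => ENNReal.ofReal (gaussD y) :=
      continuous_gaussD.measurable.ennreal_ofReal
    -- The Jacobian of `A` is known only through the change of variables formula, so the identity of
    -- densities is deduced from that of the measures they define.
    have heq : volume.withDensity (fun y => ENNReal.ofReal (lebesgueDensity μ (A y) *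
        Real.exp (ℓ y))) = volume.withDensity fun y => ENNReal.ofReal (gaussD y) := by
      ext t ht
      have hAt : MeasurableSet (A '' t) := hch.embedding.measurableSet_image.2 ht
      have h1 : volume.withDensity (fun y => ENNReal.ofReal (gaussD y)) t = μ (A '' t) := by
        rw [hmap, ← stdGaussian_eq_withDensity, hch.embedding.map_apply,
          hch.embedding.injective.preimage_image]
      have h2 : μ (A '' t) = ∫⁻ x in A '' t, ENNReal.ofReal (lebesgueDensity μ x) := by
        conv_lhs => rw [← hdens]
        rw [densityMeasure, withDensity_apply _ hAt]
      rw [h1, h2, withDensity_apply _ ht, ← lintegral_indicator hAt, ← lintegral_indicator ht,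
        ← hch.lintegral_comp ((A '' t).indicator _)]
      refine lintegral_congr fun y => ?_
      by_cases hy : y ∈ t
      · rw [indicator_of_mem hy, indicator_of_mem (mem_image_of_mem A hy), mul_comm,
          ENNReal.ofReal_mul (Real.exp_pos _).le]
      · rw [indicator_of_notMem hy, indicator_of_notMem, mul_zero]
        rwa [hch.embedding.injective.mem_set_image]
    have hfin : ∫⁻ y, ENNReal.ofReal (lebesgueDensity μ (A y) * Real.exp (ℓ y)) ≠ ∞ := by
      have : volume.withDensity (fun y => ENNReal.ofReal (lebesgueDensity μ (A y) *
        Real.exp (ℓ y))) univ = 1 := by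
        rw [heq, ← stdGaussian_eq_withDensity, measure_univ]
      rw [withDensity_apply _ MeasurableSet.univ, Measure.restrict_univ] at this
      rw [this]; exact ENNReal.one_ne_top
    have := (withDensity_eq_iff hm1.aemeasurable hm2.aemeasurable hfin).1 heq
    filter_upwards [this] with y hy
    have h0 : 0 ≤ lebesgueDensity μ (A y) := ENNReal.toReal_nonneg
    rwa [ENNReal.ofReal_eq_ofReal_iff (mul_nonneg h0 (Real.exp_pos _).le) (gaussD_pos y).le] at hy
  refine ⟨A, ℓ, hA, hae, hdens, ?_, ?_⟩
  · exact integrable_toReal_of_lintegral_ne_top (Measure.measurable_rnDeriv μ volume).aemeasurable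
      (Measure.lintegral_rnDeriv_lt_top μ volume).ne
  · obtain ⟨C, hC⟩ := hA.exists_abs_log_le
    refine ⟨Real.exp C, (hch.ae_iff (P := fun x => |lebesgueDensity μ x| ≤ Real.exp C)).2 ?_⟩
    filter_upwards [hae] with y hy
    have h1 : lebesgueDensity μ (A y) = gaussD y * Real.exp (-ℓ y) := by
      rw [← hy, mul_assoc, ← Real.exp_add]; simp
    rw [h1, abs_of_nonneg (mul_nonneg (gaussD_pos y).le (Real.exp_pos _).le)]
    calc gaussD y * Real.exp (-ℓ y) ≤ 1 * Real.exp (-ℓ y) := by gcongr; exact gaussD_le_one y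
      _ ≤ Real.exp C := by rw [one_mul]; gcongr; linarith [neg_le_of_abs_le (hC y)]

/-! ### Piecewise constant controls -/

/-- The control that equals `p k` on `[k * τ, (k + 1) * τ)`. -/
def control (p : ℕ → Param d) (τ : ℝ) (s : ℝ) : Param d := p ⌊s / τ⌋₊

lemma control_eq (p : ℕ → Param d) {τ : ℝ} (hτ : 0 < τ) {k : ℕ} {s : ℝ}
    (hs : s ∈ Ico (k * τ) ((k + 1 : ℕ) * τ)) : control p τ s = p k := by
  have h : ⌊s / τ⌋₊ = k := by
    rw [Nat.floor_eq_iff (div_nonneg ((by positivity : (0 : ℝ) ≤ k * τ).trans hs.1) hτ.le),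
      le_div_iff₀ hτ, div_lt_iff₀ hτ]
    exact ⟨hs.1, by simpa using hs.2⟩
  rw [control, h]

lemma isPiecewiseConstant_control (p : ℕ → Param d) {τ : ℝ} (hτ : 0 < τ) (n : ℕ) :
    IsPiecewiseConstant (n * τ) (control p τ) := by
  refine ⟨n, fun k => (k : ℕ) * τ, fun k => p k, fun i j hij => ?_, by simp, by simp,
    fun k s hs => control_eq p hτ (by simpa using! hs)⟩
  have : ((i : ℕ) : ℝ) < (j : ℕ) := by exact_mod_cast hij
  simp only
  gcongr

lemma grid_mono {τ : ℝ} (hτ : 0 < τ) {k l : ℕ} (h : k ≤ l) : (k : ℝ) * τ ≤ l * τ := by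
  gcongr

lemma continuousOn_grid {F : Type*} [TopologicalSpace F] {τ : ℝ} (hτ : 0 < τ) {n : ℕ} (hn : 0 < n)
    {f : ℝ → F} (hf : ∀ k < n, ContinuousOn f (Icc (k * τ) ((k + 1 : ℕ) * τ))) :
    ContinuousOn f (Icc 0 (n * τ)) := by
  induction n, hn using Nat.le_induction with
  | base => simpa using hf 0 one_pos
  | succ n hn ih =>
    have h := (ih fun k hk => hf k (hk.trans n.lt_succ_self)).union_of_isClosed
      (hf n n.lt_succ_self) isClosed_Icc isClosed_Icc
    rwa [Icc_union_Icc_eq_Icc (by positivity) (grid_mono hτ n.le_succ)] at h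

lemma intervalIntegrable_grid {F : Type*} [NormedAddCommGroup F] {τ : ℝ} {n : ℕ} {g : ℝ → F}
    (hg : ∀ k < n, IntervalIntegrable g volume (k * τ) ((k + 1 : ℕ) * τ)) :
    IntervalIntegrable g volume 0 (n * τ) := by
  have := IntervalIntegrable.trans_iterate (a := fun k : ℕ => (k : ℝ) * τ) hg
  simpa using this

section Grid

variable {F : Type*} [NormedAddCommGroup F] [NormedSpace ℝ F]

/-- Glues integral equations over consecutive stages; `grid_of_integral_eq` is the converse. They
serve both trajectories and tested densities. -/
lemma integral_eq_of_grid {τ : ℝ} (hτ : 0 < τ) {n : ℕ} {f g : ℝ → F}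
    (hg : ∀ k < n, IntervalIntegrable g volume (k * τ) ((k + 1 : ℕ) * τ))
    (h : ∀ k < n, ∀ t ∈ Icc (k * τ) ((k + 1 : ℕ) * τ), f t = f (k * τ) + ∫ s in (k * τ)..t, g s) :
    ∀ t ∈ Icc 0 (n * τ), f t = f 0 + ∫ s in (0 : ℝ)..t, g s := by
  induction n with
  | zero =>
    intro t ht
    have : t = 0 := by simpa using ht
    simp [this]
  | succ n ih =>
    have hg' : ∀ k < n, IntervalIntegrable g volume (k * τ) ((k + 1 : ℕ) * τ) :=
      fun k hk => hg k (hk.trans n.lt_succ_self)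
    have ih' := ih hg' fun k hk => h k (hk.trans n.lt_succ_self)
    intro t ht
    rcases le_total t (n * τ) with h1 | h1
    · exact ih' t ⟨ht.1, h1⟩
    · rw [h n n.lt_succ_self t ⟨h1, ht.2⟩, ih' (n * τ) ⟨by positivity, le_rfl⟩, add_assoc,
        intervalIntegral.integral_add_adjacent_intervals (intervalIntegrable_grid hg')]
      exact (hg n n.lt_succ_self).mono_set
        (by rw [uIcc_of_le h1, uIcc_of_le (grid_mono hτ n.le_succ)]; exact Icc_subset_Icc_right ht.2)

lemma grid_of_integral_eq {τ : ℝ} (hτ : 0 < τ) {n : ℕ} {f g : ℝ → F}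
    (hg : ∀ k < n, IntervalIntegrable g volume (k * τ) ((k + 1 : ℕ) * τ))
    (h : ∀ t ∈ Icc 0 (n * τ), f t = f 0 + ∫ s in (0 : ℝ)..t, g s) :
    ∀ k < n, ∀ t ∈ Icc (k * τ) ((k + 1 : ℕ) * τ),
      f t = f (k * τ) + ∫ s in (k * τ)..t, g s := by
  intro k hk t ht
  have hk0 : (0 : ℝ) ≤ k * τ := by positivity
  rw [h t ⟨hk0.trans ht.1, ht.2.trans (grid_mono hτ hk)⟩,
    h (k * τ) ⟨hk0, grid_mono hτ hk.le⟩, add_assoc,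
    intervalIntegral.integral_add_adjacent_intervals
      (intervalIntegrable_grid fun j hj => hg j (hj.trans hk))]
  exact (hg k hk).mono_set
    (by rw [uIcc_of_le ht.1, uIcc_of_le (grid_mono hτ k.le_succ)]; exact Icc_subset_Icc_right ht.2)

end Grid

/-! ### The flow of a piecewise constant control -/

lemma exists_lipschitzWith_velocity (p : Param d) :
    ∃ K, LipschitzWith K fun x => velocity x p := by
  refine ⟨_, LipschitzWith.of_dist_le_mul (K := ‖p.2.1‖₊ * ‖p.1‖₊) fun x y => ?_⟩
  rw [dist_eq_norm, dist_eq_norm, velocity_eq, velocity_eq, ← sub_smul, norm_smul]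
  have h1 : ‖max (preact p x) 0 - max (preact p y) 0‖ ≤ ‖p.2.1‖ * ‖x - y‖ := by
    refine (abs_max_sub_max_le_abs _ _ _).trans ?_
    have : preact p x - preact p y = inner ℝ p.2.1 (x - y) := by
      simp only [preact, inner_sub_right]; ring
    rw [this]
    exact abs_real_inner_le_norm _ _
  calc _ ≤ ‖p.2.1‖ * ‖x - y‖ * ‖p.1‖ := by gcongr
    _ = _ := by push_cast; ring

/-- Continuity of `γ` upgrades the integral equation to a right derivative, and the field is
Lipschitz, so ODE uniqueness applies. -/
lemma eq_flow_of_integral_eq (p : Param d) {γ : ℝ → E d} {a b : ℝ}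
    (hc : ContinuousOn γ (Icc a b))
    (h : ∀ t ∈ Icc a b, γ t = γ a + ∫ s in a..t, velocity (γ s) p) :
    ∀ t ∈ Icc a b, γ t = flow p (t - a) (γ a) := by
  obtain ⟨K, hK⟩ := exists_lipschitzWith_velocity p
  have hv : ContinuousOn (fun s => velocity (γ s) p) (Icc a b) :=
    (continuous_velocity p).comp_continuousOn hc
  refine ODE_solution_unique (v := fun _ x => velocity x p) (fun _ => hK) hc (fun t ht => ?_)
    ((continuous_flow_time p (γ a)).comp (continuous_sub_right a)).continuousOn (fun t _ => ?_)
    (by simp [flow_zero])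
  · have hint : IntervalIntegrable (fun s => velocity (γ s) p) volume a t :=
      (hv.mono (Icc_subset_Icc_right ht.2.le)).intervalIntegrable_of_Icc ht.1
    have hmem : Icc a b ∈ 𝓝[Ioi t] t := mem_of_superset (Ioo_mem_nhdsGT ht.2)
      (Ioo_subset_Icc_self.trans (Icc_subset_Icc_left ht.1))
    have hcw : ContinuousWithinAt (fun s => velocity (γ s) p) (Ioi t) t :=
      (hv t ⟨ht.1, ht.2.le⟩).mono_of_mem_nhdsWithin hmem
    have hsm : StronglyMeasurableAtFilter (fun s => velocity (γ s) p) (𝓝[Ioi t] t) volume :=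
      ⟨Icc a b, hmem, hv.aestronglyMeasurable measurableSet_Icc⟩
    have hd := (intervalIntegral.integral_hasDerivWithinAt_right hint (s := Ici t) hsm hcw).const_add
      (γ a)
    refine hd.congr_of_eventuallyEq ?_ (h t ⟨ht.1, ht.2.le⟩)
    filter_upwards [Icc_mem_nhdsGE ht.2] with s hs
    exact h s ⟨ht.1.trans hs.1, hs.2⟩
  · have := (hasDerivAt_flow p (γ a) (t - a)).scomp t ((hasDerivAt_id t).sub_const a)
    simpa [Function.comp_def] using! this.hasDerivWithinAt

lemma integral_velocity_flow (p : Param d) (x : E d) (a t : ℝ) :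
    flow p (t - a) x = x + ∫ s in a..t, velocity (flow p (s - a) x) p := by
  have h1 : ∀ s ∈ uIcc a t, HasDerivAt (fun s => flow p (s - a) x) (velocity (flow p (s - a) x) p) s :=
    fun s _ => by
      have := (hasDerivAt_flow p x (s - a)).scomp s ((hasDerivAt_id s).sub_const a)
      simpa [Function.comp_def] using! this
  rw [intervalIntegral.integral_eq_sub_of_hasDerivAt h1]
  · simp [flow_zero]
  · exact ((continuous_velocity p).comp
      ((continuous_flow_time p x).comp (continuous_sub_right a))).intervalIntegrable _ _

lemma intervalIntegrable_velocity_control (p : ℕ → Param d) {τ : ℝ} (hτ : 0 < τ) {γ : ℝ → E d}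
    {k : ℕ} (hc : ContinuousOn γ (Icc (k * τ) ((k + 1 : ℕ) * τ))) :
    IntervalIntegrable (fun s => velocity (γ s) (control p τ s)) volume
      (k * τ) ((k + 1 : ℕ) * τ) := by
  have h1 : IntervalIntegrable (fun s => velocity (γ s) (p k)) volume (k * τ) ((k + 1 : ℕ) * τ) :=
    ((continuous_velocity _).comp_continuousOn hc).intervalIntegrable_of_Icc
      (grid_mono hτ k.le_succ)
  refine h1.congr_uIoo fun s hs => ?_
  rw [uIoo_of_le (grid_mono hτ k.le_succ)] at hs
  simp only [control_eq p hτ (Ioo_subset_Ico_self hs)]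

lemma integral_control_congr {F : Type*} [NormedAddCommGroup F] [NormedSpace ℝ F]
    (p : ℕ → Param d) {τ : ℝ} (hτ : 0 < τ) (g : ℝ → Param d → F) {k : ℕ} {t : ℝ}
    (ht : t ∈ Icc (k * τ) ((k + 1 : ℕ) * τ)) :
    ∫ s in (k * τ)..t, g s (control p τ s) = ∫ s in (k * τ)..t, g s (p k) := by
  refine intervalIntegral.integral_congr_Ioo_of_le ht.1 fun s hs => ?_
  simp only [control_eq p hτ (⟨hs.1.le, hs.2.trans_le ht.2⟩ :
    s ∈ Ico ((k : ℝ) * τ) ((k + 1 : ℕ) * τ))]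

lemma IsFlow.eq_stageMap {p : ℕ → Param d} {τ : ℝ} (hτ : 0 < τ) {n : ℕ} {Φ : ℝ → E d → E d}
    (h : IsFlow (n * τ) (control p τ) Φ) : Φ (n * τ) = stageMap p τ n := by
  ext1 x
  have h0 : Φ 0 x = x := by simpa using h.eq_integral x 0 ⟨le_rfl, by positivity⟩
  have hc : ∀ k < n, ContinuousOn (fun t => Φ t x) (Icc (k * τ) ((k + 1 : ℕ) * τ)) := fun k hk =>
    (h.continuousOn x).mono (Icc_subset_Icc (by positivity) (grid_mono hτ hk))
  have hst := grid_of_integral_eq hτ (f := fun t => Φ t x)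
    (fun k hk => intervalIntegrable_velocity_control p hτ (hc k hk))
    (fun t ht => by simpa only [h0] using h.eq_integral x t ht)
  suffices H : ∀ k ≤ n, Φ (k * τ) x = stageMap p τ k x from H n le_rfl
  intro k
  induction k with
  | zero => intro _; simpa [stageMap] using h0
  | succ k ih =>
    intro hk
    have := eq_flow_of_integral_eq (p k) (hc k hk) (fun t ht => (hst k hk t ht).trans (by
      rw [integral_control_congr p hτ (fun s q => velocity (Φ s x) q) ht])) _
      (right_mem_Icc.2 (grid_mono hτ k.le_succ))
    simp only [stageMap, Function.comp] at this ⊢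
    rw [this, ih (Nat.le_of_succ_le hk)]
    congr 1
    push_cast; ring

/-- The trajectory obtained by following the stages one after the other. -/
def stageCurve (p : ℕ → Param d) (τ : ℝ) (t : ℝ) (x : E d) : E d :=
  flow (p ⌊t / τ⌋₊) (t - ⌊t / τ⌋₊ * τ) (stageMap p τ ⌊t / τ⌋₊ x)

/-- The interval is closed: at its right end the floor already selects stage `k + 1`, at elapsed
time `0`, and the two descriptions agree. -/
lemma stageCurve_eq (p : ℕ → Param d) {τ : ℝ} (hτ : 0 < τ) {k : ℕ} {t : ℝ}
    (ht : t ∈ Icc (k * τ) ((k + 1 : ℕ) * τ)) (x : E d) :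
    stageCurve p τ t x = flow (p k) (t - k * τ) (stageMap p τ k x) := by
  rcases ht.2.eq_or_lt with h | h
  · have hfl : ⌊t / τ⌋₊ = k + 1 := by
      rw [h, mul_div_assoc, div_self hτ.ne', mul_one, Nat.floor_natCast]
    rw [stageCurve, hfl, h, sub_self, flow_zero, stageMap, Function.comp]
    congr 1
    push_cast; ring
  · have hfl : ⌊t / τ⌋₊ = k := by
      rw [Nat.floor_eq_iff (div_nonneg ((by positivity : (0 : ℝ) ≤ k * τ).trans ht.1) hτ.le),
        le_div_iff₀ hτ, div_lt_iff₀ hτ]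
      exact ⟨ht.1, by simpa using h⟩
    rw [stageCurve, hfl]

lemma isFlow_stageCurve (p : ℕ → Param d) {τ : ℝ} (hτ : 0 < τ) {n : ℕ} (hn : 0 < n) :
    IsFlow (n * τ) (control p τ) (stageCurve p τ) := by
  have hc : ∀ x, ∀ k < n, ContinuousOn (fun t => stageCurve p τ t x)
      (Icc (k * τ) ((k + 1 : ℕ) * τ)) := fun x k _ =>
    ((continuous_flow_time (p k) _).comp (continuous_sub_right _)).continuousOn.congr
      fun t ht => stageCurve_eq p hτ ht x
  have h0 : ∀ x, stageCurve p τ 0 x = x := fun x => by simp [stageCurve, stageMap, flow_zero]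
  refine ⟨fun x => continuousOn_grid hτ hn (hc x), fun x => ?_⟩
  have := integral_eq_of_grid hτ (f := fun t => stageCurve p τ t x)
    (fun k hk => intervalIntegrable_velocity_control p hτ (hc x k hk)) (n := n) ?_
  · simpa only [h0] using this
  · intro k hk t ht
    rw [integral_control_congr p hτ (fun s q => velocity (stageCurve p τ s x) q) ht,
      stageCurve_eq p hτ ht, stageCurve_eq p hτ (left_mem_Icc.2 (grid_mono hτ k.le_succ)), sub_self,
      flow_zero, integral_velocity_flow]
    congr 1
    refine intervalIntegral.integral_congr fun s hs => ?_
    rw [uIcc_of_le ht.1] at hs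
    simp only [stageCurve_eq p hτ ⟨hs.1, hs.2.trans ht.2⟩]

/-! ### Transport of densities by one perceptron flow -/

/-- The density of the image of `f dx` under `flow p t`. -/
def push (p : Param d) (t : ℝ) (f : E d → ℝ) (x : E d) : ℝ :=
  Real.exp (logJac p (-t) x) * f (flow p (-t) x)

lemma push_zero (p : Param d) (f : E d → ℝ) : push p 0 f = f := by
  ext1 x; simp [push, logJac_zero, flow_zero]

lemma push_push_neg (p : Param d) (t : ℝ) (f : E d → ℝ) : push p t (push p (-t) f) = f := by
  ext1 x
  have h := logJac_add p t (-t) x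
  rw [add_neg_cancel, logJac_zero] at h
  simp only [push, neg_neg, flow_flow_neg]
  rw [← mul_assoc, ← Real.exp_add, ← h, Real.exp_zero, one_mul]

lemma integrable_push (p : Param d) (t : ℝ) {f : E d → ℝ} (hf : Integrable f) :
    Integrable (push p t f) := (isChange_flow p (-t)).integrable_comp hf

lemma push_congr_ae (p : Param d) (t : ℝ) {f g : E d → ℝ} (h : f =ᵐ[volume] g) :
    push p t f =ᵐ[volume] push p t g := by
  filter_upwards [(isChange_flow p (-t)).quasiMeasurePreserving.ae h] with x hx
  simp only [push, hx]

lemma integral_mul_push (p : Param d) (t : ℝ) (φ f : E d → ℝ) :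
    ∫ x, φ x * push p t f x = ∫ y, φ (flow p t y) * f y := by
  rw [← (isChange_flow p (-t)).integral_comp fun y => φ (flow p t y) * f y]
  refine integral_congr_ae (ae_of_all _ fun x => ?_)
  simp only [push, flow_flow_neg]
  ring

lemma integral_norm_push_sub (p : Param d) (t : ℝ) (f g : E d → ℝ) :
    ∫ x, ‖push p t f x - push p t g x‖ = ∫ x, ‖f x - g x‖ := by
  rw [← (isChange_flow p (-t)).integral_comp fun y => ‖f y - g y‖]
  refine integral_congr_ae (ae_of_all _ fun x => ?_)
  simp only [push, ← mul_sub, norm_mul, Real.norm_eq_abs, Real.abs_exp]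

lemma ae_abs_push_le (p : Param d) (t : ℝ) {f : E d → ℝ} {C : ℝ} (h : ∀ᵐ x, |f x| ≤ C) :
    ∀ᵐ x, |push p t f x| ≤ Real.exp (|rate p| * |t|) * C := by
  filter_upwards [(isChange_flow p (-t)).quasiMeasurePreserving.ae h] with x hx
  rw [push, abs_mul, Real.abs_exp]
  have h1 := (le_abs_self _).trans (abs_logJac_le p (-t) x)
  rw [abs_neg] at h1
  gcongr

/-- Keeps transported supports in one ball for nearby times: the inverse flow is jointly continuous,
so it sends a compact set of times and points to a bounded set. -/
lemma exists_norm_flow_le (p : Param d) (t₀ r : ℝ) :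
    ∃ B, ∀ t ∈ Icc (t₀ - 1) (t₀ + 1), ∀ x : E d, ‖flow p t x‖ ≤ r → ‖x‖ ≤ B := by
  have hK : IsCompact ((fun z : ℝ × E d => flow p (-z.1) z.2) ''
      (Icc (t₀ - 1) (t₀ + 1) ×ˢ Metric.closedBall 0 r)) :=
    (isCompact_Icc.prod (isCompact_closedBall _ _)).image
      ((continuous_flow_uncurry p).comp (by fun_prop : Continuous fun z : ℝ × E d => (-z.1, z.2)))
  obtain ⟨B, hB⟩ := hK.isBounded.subset_closedBall 0
  refine ⟨B, fun t ht x hx => ?_⟩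
  have := hB ⟨(t, flow p t x), ⟨ht, by simpa using hx⟩, flow_neg_flow p t x⟩
  simpa using this

/-- The derivative of `ψ` along the perceptron field. -/
def lieDeriv (p : Param d) (ψ : E d → ℝ) (x : E d) : ℝ := fderiv ℝ ψ x (velocity x p)

lemma continuous_lieDeriv (p : Param d) {ψ : E d → ℝ} (hψ : ContDiff ℝ 1 ψ) :
    Continuous (lieDeriv p ψ) :=
  (hψ.continuous_fderiv one_ne_zero).clm_apply (continuous_velocity p)

lemma exists_abs_lieDeriv_le (p : Param d) {ψ : E d → ℝ} (hψ : ContDiff ℝ 1 ψ)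
    (hψc : HasCompactSupport ψ) : ∃ C, ∀ x, |lieDeriv p ψ x| ≤ C := by
  have h : HasCompactSupport (lieDeriv p ψ) := (hψc.fderiv (𝕜 := ℝ)).mono fun x hx => by
    rw [Function.mem_support] at hx ⊢
    intro h0
    exact hx (by simp [lieDeriv, h0])
  exact h.exists_bound_of_continuous (continuous_lieDeriv p hψ)

lemma hasDerivAt_comp_flow (p : Param d) {ψ : E d → ℝ} (hψ : ContDiff ℝ 1 ψ) (x : E d) (t : ℝ) :
    HasDerivAt (fun s => ψ (flow p s x)) (lieDeriv p ψ (flow p t x)) t :=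
  ((hψ.differentiable one_ne_zero _).hasFDerivAt).comp_hasDerivAt t (hasDerivAt_flow p x t)

/-! ### Convergence of integrals against densities -/

lemma integrable_mul_L1 {g : E d → ℝ} {C : ℝ} (hm : AEStronglyMeasurable g volume)
    (hb : ∀ x, |g x| ≤ C) (R : E d →₁[volume] ℝ) : Integrable fun x => g x * R x :=
  (L1.integrable_coeFn R).bdd_mul hm (ae_of_all _ hb)

lemma abs_integral_mul_L1_le {g : E d → ℝ} {C : ℝ} (hm : AEStronglyMeasurable g volume)
    (hb : ∀ x, |g x| ≤ C) (R : E d →₁[volume] ℝ) : |∫ x, g x * R x| ≤ C * ‖R‖ := by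
  rw [L1.norm_eq_integral_norm, ← integral_const_mul]
  refine (norm_integral_le_integral_norm _).trans
    (integral_mono (integrable_mul_L1 hm hb R).norm ((L1.integrable_coeFn R).norm.const_mul C)
      fun x => ?_)
  simp only [norm_mul, Real.norm_eq_abs]
  exact mul_le_mul_of_nonneg_right (hb x) (abs_nonneg _)

lemma integral_mul_L1_sub {g : E d → ℝ} {C : ℝ} (hm : AEStronglyMeasurable g volume)
    (hb : ∀ x, |g x| ≤ C) (R S : E d →₁[volume] ℝ) :
    ∫ x, g x * (R - S) x = (∫ x, g x * R x) - ∫ x, g x * S x := by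
  rw [← integral_sub (integrable_mul_L1 hm hb R) (integrable_mul_L1 hm hb S)]
  refine integral_congr_ae ?_
  filter_upwards [Lp.coeFn_sub R S] with x hx
  rw [hx, Pi.sub_apply, mul_sub]

/-- Test function and density may both vary. Against `R₀` dominated convergence applies; the error
`R i - R₀` is controlled by the uniform bound on `g`. -/
lemma tendsto_integral_mul_L1 {ι : Type*} {l : Filter ι} [l.IsCountablyGenerated]
    {g : ι → E d → ℝ} {g₀ : E d → ℝ} {C : ℝ}
    (hm : ∀ᶠ i in l, AEStronglyMeasurable (g i) volume) (hb : ∀ᶠ i in l, ∀ x, |g i x| ≤ C)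
    (hlim : ∀ x, Tendsto (fun i => g i x) l (𝓝 (g₀ x)))
    {R : ι → (E d →₁[volume] ℝ)} {R₀ : E d →₁[volume] ℝ} (hR : Tendsto R l (𝓝 R₀)) :
    Tendsto (fun i => ∫ x, g i x * R i x) l (𝓝 (∫ x, g₀ x * R₀ x)) := by
  have h1 : Tendsto (fun i => ∫ x, g i x * R₀ x) l (𝓝 (∫ x, g₀ x * R₀ x)) := by
    refine tendsto_integral_filter_of_dominated_convergence (fun x => C * |R₀ x|) ?_ ?_
      ((L1.integrable_coeFn R₀).abs.const_mul C)
      (ae_of_all _ fun x => (hlim x).mul_const _)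
    · filter_upwards [hm] with i hi using hi.mul (L1.integrable_coeFn R₀).1
    · filter_upwards [hb] with i hi
      refine ae_of_all _ fun x => ?_
      rw [norm_mul, Real.norm_eq_abs, Real.norm_eq_abs]
      exact mul_le_mul_of_nonneg_right (hi x) (abs_nonneg _)
  have h2 : Tendsto (fun i => ∫ x, g i x * (R i - R₀) x) l (𝓝 0) := by
    have h3 : Tendsto (fun i => C * ‖R i - R₀‖) l (𝓝 0) := by
      simpa using (tendsto_iff_norm_sub_tendsto_zero.1 hR).const_mul C
    refine squeeze_zero_norm' ?_ h3
    filter_upwards [hm, hb] with i hi1 hi2 using abs_integral_mul_L1_le hi1 hi2 _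
  have h3 := h2.add h1
  rw [zero_add] at h3
  refine h3.congr' ?_
  filter_upwards [hm, hb] with i hi1 hi2
  rw [integral_mul_L1_sub hi1 hi2]; ring

lemma continuousOn_integral_mul_L1 {g : E d → ℝ} {C : ℝ} (hm : AEStronglyMeasurable g volume)
    (hb : ∀ x, |g x| ≤ C) {R : ℝ → (E d →₁[volume] ℝ)} {S : Set ℝ} (hR : ContinuousOn R S) :
    ContinuousOn (fun t => ∫ x, g x * R t x) S := fun t ht =>
  tendsto_integral_mul_L1 (g := fun _ => g) (Eventually.of_forall fun _ => hm)
    (Eventually.of_forall fun _ => hb) (fun _ => tendsto_const_nhds) (hR t ht)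

/-! ### Smoothing the rectifier -/

/-- A smooth approximation of `u ↦ max u 0`. -/
def softRelu (δ u : ℝ) : ℝ := (u + √(u ^ 2 + δ ^ 2)) / 2

/-- The derivative of `softRelu`. -/
def softStep (δ u : ℝ) : ℝ := (1 + u / √(u ^ 2 + δ ^ 2)) / 2

lemma hasDerivAt_softRelu {δ : ℝ} (hδ : δ ≠ 0) (u : ℝ) :
    HasDerivAt (softRelu δ) (softStep δ u) u := by
  have hpos : 0 < u ^ 2 + δ ^ 2 := by positivity
  have h1 : HasDerivAt (fun u : ℝ => u ^ 2 + δ ^ 2) (2 * u) u := by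
    simpa using! (hasDerivAt_pow 2 u).add_const (δ ^ 2)
  have h := ((hasDerivAt_id u).add (h1.sqrt hpos.ne')).div_const 2
  refine h.congr_deriv ?_
  rw [softStep, mul_div_mul_left _ _ two_ne_zero]

lemma contDiff_softRelu {δ : ℝ} (hδ : δ ≠ 0) : ContDiff ℝ 1 (softRelu δ) := by
  unfold softRelu
  refine (contDiff_id.add (ContDiff.sqrt (by fun_prop) fun u => ?_)).div_const 2
  positivity

lemma abs_softStep_le (δ u : ℝ) : |softStep δ u| ≤ 1 := by
  have h : |u / √(u ^ 2 + δ ^ 2)| ≤ 1 := by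
    rw [abs_div, abs_of_nonneg (Real.sqrt_nonneg _)]
    refine div_le_one_of_le₀ (Real.abs_le_sqrt ?_) (Real.sqrt_nonneg _)
    nlinarith [sq_nonneg δ]
  rw [abs_le] at h
  rw [softStep, abs_le]
  constructor <;> linarith [h.1, h.2]

lemma abs_softRelu_sub_le (δ u : ℝ) : |softRelu δ u - max u 0| ≤ |δ| := by
  have h1 : max u 0 = (u + |u|) / 2 := by
    rcases le_total u 0 with h | h
    · rw [max_eq_right h, abs_of_nonpos h]; ring
    · rw [max_eq_left h, abs_of_nonneg h]; ring
  have h2 : |u| ≤ √(u ^ 2 + δ ^ 2) := Real.abs_le_sqrt (by nlinarith [sq_nonneg δ])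
  have h3 : √(u ^ 2 + δ ^ 2) ≤ |u| + |δ| := by
    rw [Real.sqrt_le_left (by positivity)]
    nlinarith [sq_abs u, sq_abs δ, mul_nonneg (abs_nonneg u) (abs_nonneg δ)]
  rw [h1, softRelu, abs_le]
  constructor <;> linarith [abs_nonneg δ]

lemma tendsto_softStep {u : ℝ} (hu : 0 < u) : Tendsto (fun δ => softStep δ u) (𝓝 0) (𝓝 1) := by
  have hne : ∀ δ : ℝ, √(u ^ 2 + δ ^ 2) ≠ 0 := fun δ => by positivity
  have h : Continuous fun δ => softStep δ u := by
    unfold softStep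
    exact (continuous_const.add (continuous_const.div (by fun_prop) hne)).div_const 2
  have h1 := h.tendsto 0
  have h2 : softStep 0 u = 1 := by
    simp [softStep, Real.sqrt_sq hu.le, hu.ne']
  rwa [h2] at h1

/-- A smooth approximation of the flow map `x ↦ x + g (aᵀ x + b)_+ w`. -/
def softFlow (p : Param d) (g δ : ℝ) (x : E d) : E d := x + (g * softRelu δ (preact p x)) • p.1

lemma norm_softFlow_sub_flow_le (p : Param d) (t δ : ℝ) (x : E d) :
    ‖softFlow p (expPrim (rate p) t) δ x - flow p t x‖ ≤ |expPrim (rate p) t| * |δ| * ‖p.1‖ := by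
  have : softFlow p (expPrim (rate p) t) δ x - flow p t x =
      (expPrim (rate p) t * (softRelu δ (preact p x) - max (preact p x) 0)) • p.1 := by
    rw [softFlow, flow]; module
  rw [this, norm_smul, norm_mul, Real.norm_eq_abs, Real.norm_eq_abs]
  exact mul_le_mul_of_nonneg_right (mul_le_mul_of_nonneg_left (abs_softRelu_sub_le _ _)
    (abs_nonneg _)) (norm_nonneg _)

lemma hasFDerivAt_preact (p : Param d) (x : E d) : HasFDerivAt (preact p) (innerSL ℝ p.2.1) x :=
  (innerSL ℝ p.2.1).hasFDerivAt.add_const _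

lemma contDiff_preact (p : Param d) : ContDiff ℝ 1 (preact p) :=
  (innerSL ℝ p.2.1).contDiff.add contDiff_const

lemma contDiff_softFlow (p : Param d) (g : ℝ) {δ : ℝ} (hδ : δ ≠ 0) :
    ContDiff ℝ 1 (softFlow p g δ) :=
  contDiff_id.add ((contDiff_const.mul ((contDiff_softRelu hδ).comp (contDiff_preact p))).smul
    contDiff_const)

/-- Only the test function is smoothed, not the field. The factor `max (preact p x) 0` of the true
field hides the behaviour of `softStep` at and behind the kink. -/
lemma lieDeriv_comp_softFlow (p : Param d) (g : ℝ) {δ : ℝ} (hδ : δ ≠ 0) {ψ : E d → ℝ}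
    (hψ : ContDiff ℝ 1 ψ) (x : E d) :
    lieDeriv p (ψ ∘ softFlow p g δ) x = max (preact p x) 0 *
      (1 + g * rate p * softStep δ (preact p x)) * fderiv ℝ ψ (softFlow p g δ x) p.1 := by
  have h1 : HasFDerivAt (fun x => g * softRelu δ (preact p x))
      (g • softStep δ (preact p x) • innerSL ℝ p.2.1) x :=
    ((hasDerivAt_softRelu hδ _).comp_hasFDerivAt x (hasFDerivAt_preact p x)).const_mul g
  have h2 := (hasFDerivAt_id x).add (h1.smul_const p.1)
  have h3 := (hψ.differentiable one_ne_zero (softFlow p g δ x)).hasFDerivAt.comp x h2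
  rw [lieDeriv, h3.fderiv, velocity_eq]
  simp only [ContinuousLinearMap.comp_apply, map_smul, map_add, add_apply,
    ContinuousLinearMap.smulRight_apply, smul_apply, innerSL_apply_apply,
    smul_eq_mul, ContinuousLinearMap.id_apply]
  change _ * (_ + g * (_ * rate p) * _) = _
  ring

/-! ### The continuity equation with a constant parameter -/

/-- `R` solves `∂ₜR + div (velocity · p R) = 0` on `[a, b]` in the weak sense. -/
def IsWeakOn (p : Param d) (a b : ℝ) (R : ℝ → (E d →₁[volume] ℝ)) : Prop :=
  ∀ φ : E d → ℝ, ContDiff ℝ 1 φ → HasCompactSupport φ → ∀ t ∈ Icc a b,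
    ∫ x, φ x * R t x = (∫ x, φ x * R a x) + ∫ s in a..t, ∫ x, lieDeriv p φ x * R s x

/-- The weak equation extends to test functions transported by the flow, which are only
Lipschitz. -/
lemma IsWeakOn.comp_flow {p : Param d} {a b : ℝ} {R : ℝ → (E d →₁[volume] ℝ)}
    (h : IsWeakOn p a b R) (hc : ContinuousOn R (Icc a b)) {ψ : E d → ℝ} (hψ : ContDiff ℝ 1 ψ)
    (hψc : HasCompactSupport ψ) (q : ℝ) {t : ℝ} (ht : t ∈ Icc a b) :
    ∫ x, ψ (flow p q x) * R t x = (∫ x, ψ (flow p q x) * R a x) +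
      ∫ s in a..t, ∫ x, lieDeriv p ψ (flow p q x) * R s x := by
  set g := expPrim (rate p) q with hg
  set δ : ℕ → ℝ := fun n => 1 / ((n : ℝ) + 1) with hδ
  have hδ0 : ∀ n, δ n ≠ 0 := fun n => by simp only [hδ]; positivity
  have hδ1 : ∀ n, |δ n| ≤ 1 := fun n => by
    rw [abs_of_nonneg (by simp only [hδ]; positivity)]
    exact div_le_one_of_le₀ (by linarith [n.cast_nonneg (α := ℝ)]) (by positivity)
  have hδlim : Tendsto δ atTop (𝓝 0) := tendsto_one_div_add_atTop_nhds_zero_nat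
  obtain ⟨Cψ, hCψ⟩ := hψc.exists_bound_of_continuous hψ.continuous
  obtain ⟨D, hD⟩ := (hψc.fderiv (𝕜 := ℝ)).exists_bound_of_continuous
    (hψ.continuous_fderiv one_ne_zero)
  obtain ⟨r, hr⟩ := hψc.isCompact.isBounded.subset_closedBall 0
  -- The smoothed flow stays within `|g| * ‖p.1‖` of the true one, as `|δ n| ≤ 1`; all smoothed test
  -- functions are thus supported in the ball of radius `B`.
  obtain ⟨B, hB⟩ := exists_norm_flow_le p q (r + |g| * ‖p.1‖)
  have hsoft : ∀ n x, ‖softFlow p g (δ n) x - flow p q x‖ ≤ |g| * |δ n| * ‖p.1‖ := fun n x =>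
    norm_softFlow_sub_flow_le p q (δ n) x
  have hmem : ∀ n x, softFlow p g (δ n) x ∈ tsupport ψ → ‖x‖ ≤ B := fun n x hx => by
    refine hB q ⟨by linarith, by linarith⟩ x ?_
    have h1 : ‖softFlow p g (δ n) x‖ ≤ r := by simpa using hr hx
    have h2 := norm_sub_norm_le (flow p q x) (softFlow p g (δ n) x)
    rw [norm_sub_rev] at h2
    have h3 : |g| * |δ n| * ‖p.1‖ ≤ |g| * 1 * ‖p.1‖ := by gcongr; exact hδ1 n
    linarith [hsoft n x]
  have hlimflow : ∀ x, Tendsto (fun n => softFlow p g (δ n) x) atTop (𝓝 (flow p q x)) := fun x => by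
    rw [tendsto_iff_norm_sub_tendsto_zero]
    refine squeeze_zero (fun _ => norm_nonneg _) (fun n => hsoft n x) ?_
    have := (hδlim.abs.const_mul |g|).mul_const ‖p.1‖
    simpa using this
  set φ : ℕ → E d → ℝ := fun n => ψ ∘ softFlow p g (δ n) with hφ
  have hφ1 : ∀ n, ContDiff ℝ 1 (φ n) := fun n => hψ.comp (contDiff_softFlow p g (hδ0 n))
  have hφc : ∀ n, HasCompactSupport (φ n) := fun n => by
    refine HasCompactSupport.of_support_subset_isCompact (isCompact_closedBall (0 : E d) B)
      fun x hx => ?_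
    simpa using hmem n x (subset_tsupport _ hx)
  set U := ‖p.2.1‖ * |B| + |p.2.2| with hU
  set C := U * (1 + |g| * |rate p|) * (D * ‖p.1‖) with hC
  have hlieb : ∀ n x, |lieDeriv p (φ n) x| ≤ C := fun n x => by
    rw [hφ, lieDeriv_comp_softFlow p g (hδ0 n) hψ, abs_mul, abs_mul]
    have hD0 : 0 ≤ D := (norm_nonneg _).trans (hD 0)
    by_cases hx : softFlow p g (δ n) x ∈ tsupport ψ
    · have h1 : |max (preact p x) 0| ≤ U := by
        have h1 : |preact p x| ≤ ‖p.2.1‖ * ‖x‖ + |p.2.2| :=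
          (abs_add_le _ _).trans (by gcongr; exact abs_real_inner_le_norm _ _)
        have h2 : ‖p.2.1‖ * ‖x‖ ≤ ‖p.2.1‖ * |B| := by
          gcongr; exact (hmem n x hx).trans (le_abs_self B)
        rw [abs_of_nonneg (le_max_right _ _)]
        exact max_le (by linarith [le_abs_self (preact p x)])
          (by linarith [abs_nonneg (preact p x)])
      have h2 : |1 + g * rate p * softStep (δ n) (preact p x)| ≤ 1 + |g| * |rate p| := by
        refine (abs_add_le _ _).trans ?_
        rw [abs_one, abs_mul, abs_mul]
        have := mul_le_mul_of_nonneg_left (abs_softStep_le (δ n) (preact p x))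
          (by positivity : 0 ≤ |g| * |rate p|)
        linarith
      have h3 : |fderiv ℝ ψ (softFlow p g (δ n) x) p.1| ≤ D * ‖p.1‖ :=
        (ContinuousLinearMap.le_opNorm _ _).trans
          (mul_le_mul_of_nonneg_right (hD _) (norm_nonneg _))
      have hU0 : 0 ≤ U := (abs_nonneg _).trans h1
      exact mul_le_mul (mul_le_mul h1 h2 (abs_nonneg _) hU0) h3 (abs_nonneg _) (by positivity)
    · have h0 : fderiv ℝ ψ (softFlow p g (δ n) x) = 0 :=
        image_eq_zero_of_notMem_tsupport fun hx' => hx (tsupport_fderiv_subset ℝ hx')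
      have hC0 : 0 ≤ C := by positivity
      simpa [h0] using hC0
  -- The field is invariant under its own flow: `1 + g * rate p` is the exponential by which the
  -- preactivation grows. On the hyperplane `softStep` does not tend to `1`, but the field vanishes
  -- there.
  have hlielim : ∀ x, Tendsto (fun n => lieDeriv p (φ n) x) atTop
      (𝓝 (lieDeriv p ψ (flow p q x))) := fun x => by
    have h1 : lieDeriv p ψ (flow p q x) = max (preact p x) 0 * (1 + g * rate p * 1) *
        fderiv ℝ ψ (flow p q x) p.1 := by
      rw [lieDeriv, velocity_flow, map_smul, smul_eq_mul]
      have := mul_expPrim (rate p) q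
      rw [show 1 + g * rate p * 1 = Real.exp (rate p * q) by rw [hg]; linarith]
      ring
    have h2 : Tendsto (fun n => fderiv ℝ ψ (softFlow p g (δ n) x) p.1) atTop
        (𝓝 (fderiv ℝ ψ (flow p q x) p.1)) :=
      (((hψ.continuous_fderiv one_ne_zero).clm_apply continuous_const).tendsto _).comp (hlimflow x)
    rw [h1]
    simp only [hφ, lieDeriv_comp_softFlow p g (hδ0 _) hψ]
    refine Tendsto.mul ?_ h2
    rcases lt_or_ge 0 (preact p x) with hx | hx
    · exact tendsto_const_nhds.mul (tendsto_const_nhds.add (tendsto_const_nhds.mul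
        ((tendsto_softStep hx).comp hδlim)))
    · simp [max_eq_right hx]
  have hφlim : ∀ s, Tendsto (fun n => ∫ x, φ n x * R s x) atTop
      (𝓝 (∫ x, ψ (flow p q x) * R s x)) := fun s =>
    tendsto_integral_mul_L1
      (Eventually.of_forall fun n => (hφ1 n).continuous.aestronglyMeasurable)
      (Eventually.of_forall fun n x => hCψ _)
      (fun x => (hψ.continuous.tendsto _).comp (hlimflow x)) tendsto_const_nhds
  have hlim : ∀ s, Tendsto (fun n => ∫ x, lieDeriv p (φ n) x * R s x) atTop
      (𝓝 (∫ x, lieDeriv p ψ (flow p q x) * R s x)) := fun s =>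
    tendsto_integral_mul_L1
      (Eventually.of_forall fun n => (continuous_lieDeriv p (hφ1 n)).aestronglyMeasurable)
      (Eventually.of_forall hlieb) hlielim tendsto_const_nhds
  have hcont : ∀ n, ContinuousOn (fun s => ∫ x, lieDeriv p (φ n) x * R s x) (Icc a b) := fun n =>
    continuousOn_integral_mul_L1 (continuous_lieDeriv p (hφ1 n)).aestronglyMeasurable (hlieb n) hc
  have hsub : Ioc a t ⊆ Icc a b := fun s hs => ⟨hs.1.le, hs.2.trans ht.2⟩
  have hint : Tendsto (fun n => ∫ s in a..t, ∫ x, lieDeriv p (φ n) x * R s x) atTop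
      (𝓝 (∫ s in a..t, ∫ x, lieDeriv p ψ (flow p q x) * R s x)) := by
    refine intervalIntegral.tendsto_integral_filter_of_dominated_convergence
      (fun s => C * ‖R s‖) ?_ ?_ ?_ (ae_of_all _ fun s _ => hlim s)
    · refine Eventually.of_forall fun n => ?_
      rw [uIoc_of_le ht.1]
      exact ((hcont n).mono hsub).aestronglyMeasurable measurableSet_Ioc
    · exact Eventually.of_forall fun n => ae_of_all _ fun s _ =>
        abs_integral_mul_L1_le (continuous_lieDeriv p (hφ1 n)).aestronglyMeasurable (hlieb n) _
    · exact (((hc.mono (Icc_subset_Icc_right ht.2)).norm).const_mul C).intervalIntegrable_of_Icc ht.1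
  exact tendsto_nhds_unique (hφlim t)
    (((hφlim a).add hint).congr fun n => (h (φ n) (hφ1 n) (hφc n) t ht).symm)

/-- Along the flow, the integral of a transported test function is conserved. -/
lemma IsWeakOn.integral_comp_flow_eq {p : Param d} {a b : ℝ} {R : ℝ → (E d →₁[volume] ℝ)}
    (h : IsWeakOn p a b R) (hc : ContinuousOn R (Icc a b)) {ψ : E d → ℝ} (hψ : ContDiff ℝ 1 ψ)
    (hψc : HasCompactSupport ψ) {t : ℝ} (ht : t ∈ Icc a b) :
    ∫ x, ψ (flow p (a - t) x) * R t x = ∫ x, ψ x * R a x := by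
  obtain ⟨C₀, hC₀⟩ := hψc.exists_bound_of_continuous hψ.continuous
  obtain ⟨C, hC⟩ := exists_abs_lieDeriv_le p hψ hψc
  have hcont : ContinuousOn (fun t => ∫ x, ψ (flow p (a - t) x) * R t x) (Icc a b) := fun s hs =>
    tendsto_integral_mul_L1 (g := fun t x => ψ (flow p (a - t) x))
      (Eventually.of_forall fun t => (hψ.continuous.comp (continuous_flow p _)).aestronglyMeasurable)
      (Eventually.of_forall fun t x => hC₀ _)
      (fun x => ((hψ.continuous.comp ((continuous_flow_time p x).comp
        (continuous_sub_left a))).tendsto s).mono_left nhdsWithin_le_nhds) (hc s hs)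
  -- A zero right derivative suffices; the backward motion of the test function cancels the
  -- transport of `R`.
  have hconst := constant_of_has_deriv_right_zero hcont (fun s hs => ?_) t ht
  · simpa [flow_zero] using hconst
  have hs' : s ∈ Icc a b := ⟨hs.1, hs.2.le⟩
  have hRlim : Tendsto R (𝓝[>] s) (𝓝 (R s)) :=
    (hc s hs').mono_of_mem_nhdsWithin (mem_of_superset (Ioo_mem_nhdsGT hs.2)
      (Ioo_subset_Icc_self.trans (Icc_subset_Icc_left hs.1)))
  -- the contribution of the time dependence of the test function
  have hψd : ∀ x r, HasDerivAt (fun t => ψ (flow p (a - t) x))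
      (-lieDeriv p ψ (flow p (a - r) x)) r := fun x r => by
    have := (hasDerivAt_comp_flow p hψ x (a - r)).comp r ((hasDerivAt_id r).const_sub a)
    simpa [Function.comp_def] using! this
  set Q : ℝ → E d → ℝ := fun t x =>
    (t - s)⁻¹ * (ψ (flow p (a - t) x) - ψ (flow p (a - s) x)) with hQ
  have hQc : ∀ t, Continuous (Q t) := fun t => by
    have := hψ.continuous
    simp only [hQ]; fun_prop
  have hQb : ∀ᶠ t in 𝓝[>] s, ∀ x, |Q t x| ≤ C := by
    filter_upwards [self_mem_nhdsWithin] with t hts x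
    have hpos : 0 < t - s := sub_pos.2 hts
    have h1 := Convex.norm_image_sub_le_of_norm_hasDerivWithin_le
      (fun r _ => (hψd x r).hasDerivWithinAt) (fun r _ => by rw [norm_neg]; exact hC _)
      convex_univ (mem_univ s) (mem_univ t)
    rw [hQ, abs_mul, abs_inv, abs_of_pos hpos, inv_mul_le_iff₀ hpos]
    rw [Real.norm_eq_abs, Real.norm_eq_abs, abs_of_pos hpos] at h1
    linarith
  have hQlim : ∀ x, Tendsto (fun t => Q t x) (𝓝[>] s) (𝓝 (-lieDeriv p ψ (flow p (a - s) x))) :=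
    fun x => by
      exact (hasDerivWithinAt_iff_tendsto_slope' self_notMem_Ioi).1
        ((hψd x s).hasDerivWithinAt (s := Ioi s))
  have hA := tendsto_integral_mul_L1 (Eventually.of_forall fun t => (hQc t).aestronglyMeasurable)
    hQb hQlim hRlim
  -- the contribution of the equation
  have hG : ContinuousOn (fun r => ∫ x, lieDeriv p ψ (flow p (a - s) x) * R r x) (Icc a b) :=
    continuousOn_integral_mul_L1
      ((continuous_lieDeriv p hψ).comp (continuous_flow p _)).aestronglyMeasurable
      (fun x => hC _) hc
  have hB : HasDerivWithinAt (fun t => ∫ x, ψ (flow p (a - s) x) * R t x)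
      (∫ x, lieDeriv p ψ (flow p (a - s) x) * R s x) (Ioi s) s := by
    have hmem : Icc a b ∈ 𝓝[>] s := mem_of_superset (Ioo_mem_nhdsGT hs.2)
      (Ioo_subset_Icc_self.trans (Icc_subset_Icc_left hs.1))
    have hd := (intervalIntegral.integral_hasDerivWithinAt_right (s := Ici s) (t := Ioi s)
      ((hG.mono (Icc_subset_Icc_right hs'.2)).intervalIntegrable_of_Icc hs.1)
      ⟨Icc a b, hmem, hG.aestronglyMeasurable measurableSet_Icc⟩
      ((hG s hs').mono_of_mem_nhdsWithin hmem)).const_add (∫ x, ψ (flow p (a - s) x) * R a x)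
    refine (hd.mono Ioi_subset_Ici_self).congr_of_eventuallyEq ?_ (h.comp_flow hc hψ hψc _ hs')
    filter_upwards [hmem] with t ht using h.comp_flow hc hψ hψc _ ht
  rw [hasDerivWithinAt_iff_tendsto_slope' self_notMem_Ioi] at hB
  rw [← hasDerivWithinAt_Ioi_iff_Ici, hasDerivWithinAt_iff_tendsto_slope' self_notMem_Ioi]
  have hsum := hA.add hB
  simp only [neg_mul, integral_neg, neg_add_cancel] at hsum
  -- The discrete product rule: the quotient of the test function is paired with the moving density
  -- `R t`, the quotient of `R` with the test function frozen at time `s`.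
  refine hsum.congr fun t => ?_
  have hm : ∀ r, AEStronglyMeasurable (fun x => ψ (flow p r x)) volume := fun r =>
    (hψ.continuous.comp (continuous_flow p r)).aestronglyMeasurable
  have hi : ∀ r, Integrable fun x => ψ (flow p r x) * R t x := fun r =>
    integrable_mul_L1 (hm r) (fun x => hC₀ _) _
  have h1 : ∫ x, Q t x * R t x = (t - s)⁻¹ * ((∫ x, ψ (flow p (a - t) x) * R t x) -
      ∫ x, ψ (flow p (a - s) x) * R t x) := by
    rw [← integral_sub (hi _) (hi _), ← integral_const_mul]
    refine integral_congr_ae (ae_of_all _ fun x => ?_)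
    simp only [hQ]; ring
  rw [h1]
  simp only [slope, vsub_eq_sub, smul_eq_mul]
  ring

/-- A weak solution is transported by the flow. -/
lemma IsWeakOn.eq_push {p : Param d} {a b : ℝ} {R : ℝ → (E d →₁[volume] ℝ)}
    (h : IsWeakOn p a b R) (hc : ContinuousOn R (Icc a b)) {t : ℝ} (ht : t ∈ Icc a b) :
    R t =ᵐ[volume] push p (t - a) (R a) := by
  have hi : Integrable (push p (-(t - a)) (R t)) := integrable_push _ _ (L1.integrable_coeFn _)
  -- Conservation says that `R t`, pulled back to time `a`, has the same integrals as `R a` against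
  -- smooth test functions.
  have h0 : ∀ᵐ x, push p (-(t - a)) (R t) x - R a x = 0 := by
    refine ae_eq_zero_of_integral_contDiff_smul_eq_zero
      (hi.sub (L1.integrable_coeFn (R a))).locallyIntegrable fun ψ hψ hψc => ?_
    have hψ1 : ContDiff ℝ 1 ψ := hψ.of_le (by exact_mod_cast le_top)
    obtain ⟨C₀, hC₀⟩ := hψc.exists_bound_of_continuous hψ1.continuous
    have h1 := h.integral_comp_flow_eq hc hψ1 hψc ht
    have h2 := integral_mul_push p (-(t - a)) ψ (R t)
    rw [neg_sub, h1] at h2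
    simp only [smul_eq_mul, mul_sub]
    rw [integral_sub (hi.bdd_mul hψ1.continuous.aestronglyMeasurable (ae_of_all _ hC₀))
      (integrable_mul_L1 hψ1.continuous.aestronglyMeasurable hC₀ _), neg_sub, h2, sub_self]
  have h1 : push p (-(t - a)) (R t) =ᵐ[volume] R a := h0.mono fun x hx => sub_eq_zero.1 hx
  have h2 := push_congr_ae p (t - a) h1
  rwa [push_push_neg] at h2

/-! ### Existence for the continuity equation -/

/-- `push p t f` as an element of `L¹`. -/
def pushL1 (p : Param d) (t : ℝ) {f : E d → ℝ} (hf : Integrable f) : E d →₁[volume] ℝ :=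
  (integrable_push p t hf).toL1 (push p t f)

lemma coeFn_pushL1 (p : Param d) (t : ℝ) {f : E d → ℝ} (hf : Integrable f) :
    pushL1 p t hf =ᵐ[volume] push p t f := Integrable.coeFn_toL1 _

lemma dist_pushL1 (p q : Param d) (s t : ℝ) {f g : E d → ℝ} (hf : Integrable f)
    (hg : Integrable g) :
    dist (pushL1 p s hf) (pushL1 q t hg) = ∫ x, ‖push p s f x - push q t g x‖ := by
  rw [dist_eq_norm, pushL1, pushL1, ← Integrable.toL1_sub, L1.norm_of_fun_eq_integral_norm]
  rfl

/-- Dominated convergence on a common ball. The Jacobian jumps in `x` but is continuous in time at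
each fixed `x`. -/
lemma continuous_pushL1_of_hasCompactSupport (p : Param d) {f : E d → ℝ} (hf : Integrable f)
    (hfc : Continuous f) (hfs : HasCompactSupport f) : Continuous fun t => pushL1 p t hf := by
  refine continuous_iff_continuousAt.2 fun t₀ => ?_
  rw [ContinuousAt, tendsto_iff_dist_tendsto_zero]
  simp only [dist_pushL1]
  obtain ⟨C, hC⟩ := hfs.exists_bound_of_continuous hfc
  obtain ⟨r, hr⟩ := hfs.isCompact.isBounded.subset_closedBall 0
  obtain ⟨B, hB⟩ := exists_norm_flow_le p (-t₀) r
  have hC0 : 0 ≤ C := (norm_nonneg _).trans (hC 0)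
  set D := Real.exp (|rate p| * (|t₀| + 1)) * C with hD
  have hD0 : 0 ≤ D := by positivity
  have hbound : ∀ t ∈ Icc (t₀ - 1) (t₀ + 1), ∀ x,
      ‖push p t f x‖ ≤ (Metric.closedBall (0 : E d) B).indicator (fun _ => D) x := by
    intro t ht x
    by_cases hx : ‖flow p (-t) x‖ ≤ r
    · rw [indicator_of_mem (by
        simpa using hB (-t) ⟨by linarith [ht.2], by linarith [ht.1]⟩ x hx)]
      rw [push, norm_mul, Real.norm_eq_abs, Real.abs_exp]
      have h1 := (le_abs_self _).trans (abs_logJac_le p (-t) x)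
      have h2 : |-t| ≤ |t₀| + 1 := by
        rw [abs_neg, abs_le]
        constructor <;> linarith [ht.1, ht.2, le_abs_self t₀, neg_abs_le t₀]
      have h3 : |rate p| * |-t| ≤ |rate p| * (|t₀| + 1) := by gcongr
      exact mul_le_mul (Real.exp_le_exp.2 (h1.trans h3)) (hC _) (norm_nonneg _) (Real.exp_pos _).le
    · have h0 : f (flow p (-t) x) = 0 := image_eq_zero_of_notMem_tsupport fun h =>
        hx (by simpa using hr h)
      rw [push, h0, mul_zero, norm_zero]
      exact indicator_nonneg (fun _ _ => hD0) _
  have hnhds : Icc (t₀ - 1) (t₀ + 1) ∈ 𝓝 t₀ := Icc_mem_nhds (by linarith) (by linarith)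
  have hlim : ∀ x, Tendsto (fun t => ‖push p t f x - push p t₀ f x‖) (𝓝 t₀) (𝓝 0) := fun x => by
    have hcont : Continuous fun t => ‖push p t f x - push p t₀ f x‖ := by
      have h1 := (continuous_logJac_time p x).comp continuous_neg
      have h2 := hfc.comp ((continuous_flow_time p x).comp continuous_neg)
      exact ((h1.rexp.mul h2).sub continuous_const).norm
    simpa using hcont.tendsto t₀
  have := tendsto_integral_filter_of_dominated_convergence (μ := (volume : Measure (E d)))
    (F := fun t x => ‖push p t f x - push p t₀ f x‖) (l := 𝓝 t₀) (f := fun _ => (0 : ℝ))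
    (fun x => (Metric.closedBall (0 : E d) B).indicator (fun _ => D) x +
      (Metric.closedBall (0 : E d) B).indicator (fun _ => D) x)
    (Eventually.of_forall fun t =>
      ((integrable_push p t hf).1.sub (integrable_push p t₀ hf).1).norm) ?_ ?_
    (ae_of_all _ hlim)
  · simpa using this
  · filter_upwards [hnhds] with t ht
    refine ae_of_all _ fun x => ?_
    rw [norm_norm]
    exact (norm_sub_le _ _).trans (add_le_add (hbound t ht x) (hbound t₀ (mem_of_mem_nhds hnhds) x))
  · have : Integrable ((Metric.closedBall (0 : E d) B).indicator fun _ => D) :=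
      (integrable_indicator_iff measurableSet_closedBall).2
        (integrableOn_const (measure_closedBall_lt_top.ne))
    exact this.add this

/-- `push p t` preserves `L¹` distances, so approximating `f` by a compactly supported continuous
function costs the same at every time. -/
lemma continuous_pushL1 (p : Param d) {f : E d → ℝ} (hf : Integrable f) :
    Continuous fun t => pushL1 p t hf := by
  refine continuous_iff_continuousAt.2 fun t₀ => Metric.tendsto_nhds.2 fun ε hε => ?_
  obtain ⟨g, hgs, hg, hgc, hgi⟩ := hf.exists_hasCompactSupport_integral_sub_le
    (by positivity : 0 < ε / 3)
  have h1 := Metric.tendsto_nhds.1 ((continuous_pushL1_of_hasCompactSupport p hgi hgc hgs).tendsto t₀)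
    (ε / 3) (by positivity)
  have h2 : ∀ t, dist (pushL1 p t hf) (pushL1 p t hgi) ≤ ε / 3 := fun t => by
    rw [dist_pushL1, integral_norm_push_sub]; exact hg
  filter_upwards [h1] with t ht
  have h3 := dist_triangle4_right (pushL1 p t hf) (pushL1 p t₀ hf) (pushL1 p t hgi) (pushL1 p t₀ hgi)
  linarith [h2 t, h2 t₀]

/-- A change of variables puts the time dependence on `φ ∘ flow p s`, which is differentiable in
time with bounded derivative; differentiate under the integral and integrate back. -/
lemma isWeakOn_pushL1 (p : Param d) (a b : ℝ) {f : E d → ℝ} (hf : Integrable f) :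
    IsWeakOn p a b fun t => pushL1 p (t - a) hf := by
  intro φ hφ hφc t _
  obtain ⟨C₀, hC₀⟩ := hφc.exists_bound_of_continuous hφ.continuous
  obtain ⟨C, hC⟩ := exists_abs_lieDeriv_le p hφ hφc
  have hL : ∀ (g : E d → ℝ) (s : ℝ), ∫ x, g x * pushL1 p s hf x = ∫ y, g (flow p s y) * f y := by
    intro g s
    rw [← integral_mul_push]
    refine integral_congr_ae ?_
    filter_upwards [coeFn_pushL1 p s hf] with x hx
    rw [hx]
  have hder : ∀ s : ℝ, HasDerivAt (fun s => ∫ y, φ (flow p s y) * f y)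
      (∫ y, lieDeriv p φ (flow p s y) * f y) s := fun s => by
    refine (hasDerivAt_integral_of_dominated_loc_of_deriv_le (bound := fun y => C * |f y|)
      (F' := fun s y => lieDeriv p φ (flow p s y) * f y) univ_mem
      (Eventually.of_forall fun r => ?_) ?_ ?_ ?_ (hf.abs.const_mul C) ?_).2
    · exact (hφ.continuous.comp (continuous_flow p r)).aestronglyMeasurable.mul hf.1
    · exact hf.bdd_mul (hφ.continuous.comp (continuous_flow p s)).aestronglyMeasurable
        (ae_of_all _ fun x => hC₀ _)
    · exact ((continuous_lieDeriv p hφ).comp (continuous_flow p s)).aestronglyMeasurable.mul hf.1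
    · refine ae_of_all _ fun y r _ => ?_
      rw [norm_mul]
      exact mul_le_mul_of_nonneg_right (hC _) (abs_nonneg _)
    · exact ae_of_all _ fun y r _ => (hasDerivAt_comp_flow p hφ y r).mul_const _
  have hcont : Continuous fun s => ∫ x, lieDeriv p φ x * pushL1 p s hf x :=
    continuous_iff_continuousAt.2 fun s => tendsto_integral_mul_L1
      (Eventually.of_forall fun _ => (continuous_lieDeriv p hφ).aestronglyMeasurable)
      (Eventually.of_forall fun _ => hC) (fun _ => tendsto_const_nhds)
      ((continuous_pushL1 p hf).tendsto s)
  have hFTC := intervalIntegral.integral_eq_sub_of_hasDerivAt (a := a) (b := t)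
    (f := fun s => ∫ y, φ (flow p (s - a) y) * f y)
    (f' := fun s => ∫ x, lieDeriv p φ x * pushL1 p (s - a) hf x) (fun s _ => ?_)
    ((hcont.comp (continuous_sub_right a)).intervalIntegrable _ _)
  · rw [hFTC, hL, hL]; ring
  · have := (hder (s - a)).comp s ((hasDerivAt_id s).sub_const a)
    simp only [hL]
    simpa [Function.comp_def] using! this

/-! ### Solutions for piecewise constant controls -/

/-- The density transported through the first `n` stages. -/
def stageDensity (p : ℕ → Param d) (τ : ℝ) (f : E d → ℝ) : ℕ → E d → ℝ
  | 0 => f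
  | n + 1 => push (p n) τ (stageDensity p τ f n)

lemma stageDensity_eq (p : ℕ → Param d) (τ : ℝ) (f : E d → ℝ) (n : ℕ) (x : E d) :
    stageDensity p τ f n x = Real.exp (stageLog p τ n x) * f (stageInv p τ n x) := by
  induction n generalizing x with
  | zero => simp [stageDensity, stageLog, stageInv]
  | succ n ih =>
    simp only [stageDensity, push, ih, stageLog, stageInv, Function.comp, Real.exp_add, mul_assoc]

lemma integrable_stageDensity (p : ℕ → Param d) (τ : ℝ) {f : E d → ℝ} (hf : Integrable f) (n : ℕ) :
    Integrable (stageDensity p τ f n) := by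
  induction n with
  | zero => exact hf
  | succ n ih => exact integrable_push _ _ ih

lemma exists_ae_abs_stageDensity_le (p : ℕ → Param d) (τ : ℝ) {f : E d → ℝ}
    (hf : ∃ C, ∀ᵐ x, |f x| ≤ C) (n : ℕ) : ∃ C, ∀ᵐ x, |stageDensity p τ f n x| ≤ C := by
  induction n with
  | zero => exact hf
  | succ n ih =>
    obtain ⟨C, hC⟩ := ih
    exact ⟨_, ae_abs_push_le _ _ hC⟩

lemma intervalIntegrable_control_L1 (p : ℕ → Param d) {τ : ℝ} (hτ : 0 < τ) {k : ℕ}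
    {R : ℝ → (E d →₁[volume] ℝ)} (hc : ContinuousOn R (Icc (k * τ) ((k + 1 : ℕ) * τ)))
    {φ : E d → ℝ} (hφ : ContDiff ℝ 1 φ) (hφc : HasCompactSupport φ) :
    IntervalIntegrable (fun s => ∫ x, lieDeriv (control p τ s) φ x * R s x) volume
      (k * τ) ((k + 1 : ℕ) * τ) := by
  obtain ⟨C, hC⟩ := exists_abs_lieDeriv_le (p k) hφ hφc
  have h1 : IntervalIntegrable (fun s => ∫ x, lieDeriv (p k) φ x * R s x) volume
      (k * τ) ((k + 1 : ℕ) * τ) :=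
    (continuousOn_integral_mul_L1 (continuous_lieDeriv _ hφ).aestronglyMeasurable hC
      hc).intervalIntegrable_of_Icc (grid_mono hτ k.le_succ)
  refine h1.congr_uIoo fun s hs => ?_
  rw [uIoo_of_le (grid_mono hτ k.le_succ)] at hs
  simp only [control_eq p hτ (Ioo_subset_Ico_self hs)]

/-- Every solution at the final time is the transported initial density. -/
lemma IsSolution.eq_stageDensity {p : ℕ → Param d} {τ : ℝ} (hτ : 0 < τ) {n : ℕ} {f : E d → ℝ}
    {R : ℝ → (E d →₁[volume] ℝ)} (h : IsSolution (n * τ) (control p τ) f R) :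
    R (n * τ) =ᵐ[volume] stageDensity p τ f n := by
  have hc : ∀ k < n, ContinuousOn R (Icc (k * τ) ((k + 1 : ℕ) * τ)) := fun k hk =>
    h.continuousOn.mono (Icc_subset_Icc (by positivity) (grid_mono hτ hk))
  have hst : ∀ k < n, IsWeakOn (p k) (k * τ) ((k + 1 : ℕ) * τ) R := by
    intro k hk φ hφ hφc t ht
    have h0 : ∫ x, φ x * R 0 x = ∫ x, φ x * f x := integral_congr_ae <| by
      filter_upwards [h.initial] with x hx
      rw [hx]
    have := grid_of_integral_eq hτ (f := fun t => ∫ x, φ x * R t x)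
      (fun k hk => intervalIntegrable_control_L1 p hτ (hc k hk) hφ hφc)
      (fun t ht => by rw [h0]; exact h.weak_eq φ hφ hφc t ht) k hk t ht
    rwa [integral_control_congr p hτ (fun s q => ∫ x, lieDeriv q φ x * R s x) ht] at this
  suffices H : ∀ k ≤ n, R (k * τ) =ᵐ[volume] stageDensity p τ f k from H n le_rfl
  intro k
  induction k with
  | zero => intro _; simpa [stageDensity] using h.initial
  | succ k ih =>
    intro hk
    have h1 := (hst k hk).eq_push (hc k hk) (right_mem_Icc.2 (grid_mono hτ k.le_succ))
    have h2 := push_congr_ae (p k) τ (ih (Nat.le_of_succ_le hk))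
    rw [show ((k + 1 : ℕ) : ℝ) * τ - k * τ = τ by push_cast; ring] at h1
    exact h1.trans h2

/-- The solution obtained by following the stages one after the other. -/
def stageSolution (p : ℕ → Param d) (τ : ℝ) {f : E d → ℝ} (hf : Integrable f) (t : ℝ) :
    E d →₁[volume] ℝ :=
  pushL1 (p ⌊t / τ⌋₊) (t - ⌊t / τ⌋₊ * τ) (integrable_stageDensity p τ hf ⌊t / τ⌋₊)

lemma stageSolution_eq (p : ℕ → Param d) {τ : ℝ} (hτ : 0 < τ) {f : E d → ℝ} (hf : Integrable f)
    {k : ℕ} {t : ℝ} (ht : t ∈ Icc (k * τ) ((k + 1 : ℕ) * τ)) :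
    stageSolution p τ hf t = pushL1 (p k) (t - k * τ) (integrable_stageDensity p τ hf k) := by
  rcases ht.2.eq_or_lt with h | h
  · have hfl : ⌊t / τ⌋₊ = k + 1 := by
      rw [h, mul_div_assoc, div_self hτ.ne', mul_one, Nat.floor_natCast]
    rw [stageSolution, ← dist_eq_zero, dist_pushL1, hfl, h, sub_self, push_zero,
      show ((k + 1 : ℕ) : ℝ) * τ - k * τ = τ by push_cast; ring]
    simp [stageDensity]
  · have hfl : ⌊t / τ⌋₊ = k := by
      rw [Nat.floor_eq_iff (div_nonneg ((by positivity : (0 : ℝ) ≤ k * τ).trans ht.1) hτ.le),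
        le_div_iff₀ hτ, div_lt_iff₀ hτ]
      exact ⟨ht.1, by simpa using h⟩
    simp only [stageSolution, hfl]

lemma isSolution_stageSolution (p : ℕ → Param d) {τ : ℝ} (hτ : 0 < τ) {n : ℕ} (hn : 0 < n)
    {f : E d → ℝ} (hf : Integrable f) (hb : ∃ C, ∀ᵐ x, |f x| ≤ C) :
    IsSolution (n * τ) (control p τ) f (stageSolution p τ hf) := by
  have hc : ∀ k < n, ContinuousOn (stageSolution p τ hf) (Icc (k * τ) ((k + 1 : ℕ) * τ)) :=
    fun k _ => ((continuous_pushL1 (p k) (integrable_stageDensity p τ hf k)).comp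
      (continuous_sub_right _)).continuousOn.congr fun t ht => stageSolution_eq p hτ hf ht
  have h0 : stageSolution p τ hf 0 =ᵐ[volume] f := by
    refine (coeFn_pushL1 _ _ _).trans ?_
    simp [push_zero, stageDensity]
  refine ⟨continuousOn_grid hτ hn hc, ?_, h0, fun φ hφ hφc => ?_⟩
  · choose C hC using exists_ae_abs_stageDensity_le p τ hb
    have hCk : ∀ k, 0 ≤ Real.exp (|rate (p k)| * τ) * |C k| := fun k => by positivity
    -- A sum of nonnegative terms stands in for the maximum of the bounds over the stages.
    refine ⟨∑ k ∈ Finset.range n, Real.exp (|rate (p k)| * τ) * |C k|, fun t ht => ?_⟩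
    obtain ⟨k, hk, hkt⟩ : ∃ k < n, t ∈ Icc (k * τ) ((k + 1 : ℕ) * τ) := by
      rcases ht.2.eq_or_lt with h | h
      · refine ⟨n - 1, Nat.sub_lt hn one_pos, ?_⟩
        rw [h, show n - 1 + 1 = n by omega]
        exact ⟨grid_mono hτ (Nat.sub_le _ _), le_rfl⟩
      · have h1 : 0 ≤ t / τ := div_nonneg ht.1 hτ.le
        refine ⟨⌊t / τ⌋₊, (Nat.floor_lt h1).2 (by rwa [div_lt_iff₀ hτ]), ?_, ?_⟩
        · rw [← le_div_iff₀ hτ]; exact Nat.floor_le h1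
        · rw [← div_le_iff₀ hτ]; push_cast; exact (Nat.lt_floor_add_one _).le
    rw [stageSolution_eq p hτ hf hkt]
    have hle := Finset.single_le_sum (f := fun k => Real.exp (|rate (p k)| * τ) * |C k|)
      (fun k _ => hCk k) (Finset.mem_range.2 hk)
    filter_upwards [coeFn_pushL1 (p k) (t - k * τ) (integrable_stageDensity p τ hf k),
      ae_abs_push_le (p k) (t - k * τ) (hC k)] with x hx1 hx2
    rw [hx1]
    refine hx2.trans (le_trans ?_ hle)
    have h1 : |t - k * τ| ≤ τ := by
      rw [abs_of_nonneg (sub_nonneg.2 hkt.1)]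
      have := hkt.2
      push_cast at this
      linarith
    have h2 : |rate (p k)| * |t - k * τ| ≤ |rate (p k)| * τ := by gcongr
    exact mul_le_mul (Real.exp_le_exp.2 h2) (le_abs_self _)
      ((abs_nonneg _).trans (hC k).exists.choose_spec) (Real.exp_pos _).le
  · have h1 : ∫ x, φ x * stageSolution p τ hf 0 x = ∫ x, φ x * f x := integral_congr_ae <| by
      filter_upwards [h0] with x hx
      rw [hx]
    rw [← h1]
    refine integral_eq_of_grid hτ (f := fun t => ∫ x, φ x * stageSolution p τ hf t x)
      (g := fun s => ∫ x, lieDeriv (control p τ s) φ x * stageSolution p τ hf s x)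
      (fun k hk => intervalIntegrable_control_L1 p hτ (hc k hk) hφ hφc) fun k hk t ht => ?_
    rw [integral_control_congr p hτ
      (fun s q => ∫ x, lieDeriv q φ x * stageSolution p τ hf s x) ht, stageSolution_eq p hτ hf ht,
      stageSolution_eq p hτ hf (left_mem_Icc.2 (grid_mono hτ k.le_succ)),
      isWeakOn_pushL1 (p k) (k * τ) ((k + 1 : ℕ) * τ) (integrable_stageDensity p τ hf k) φ hφ hφc t
        ht]
    congr 1
    refine intervalIntegral.integral_congr fun s hs => ?_
    rw [uIcc_of_le ht.1] at hs
    simp only [stageSolution_eq p hτ hf ⟨hs.1, hs.2.trans ht.2⟩]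

/-! ### The Kullback-Leibler divergence of densities -/

lemma map_densityMeasure_stageMap (p : ℕ → Param d) (τ : ℝ) (n : ℕ) (f : E d → ℝ) :
    (densityMeasure f).map (stageMap p τ n) = densityMeasure (stageDensity p τ f n) := by
  have hm := (continuous_stageMap p τ n).measurable
  ext s hs
  rw [Measure.map_apply hm hs, densityMeasure, densityMeasure, withDensity_apply _ (hm hs),
    withDensity_apply _ hs, ← lintegral_indicator (hm hs), ← lintegral_indicator hs,
    ← (isChange_stageInv p τ n).lintegral_comp]
  refine lintegral_congr fun x => ?_
  by_cases hx : x ∈ s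
  · rw [indicator_of_mem hx, indicator_of_mem (by rwa [mem_preimage, stageMap_stageInv]),
      stageDensity_eq, ENNReal.ofReal_mul (Real.exp_pos _).le]
  · rw [indicator_of_notMem hx, indicator_of_notMem (by rwa [mem_preimage, stageMap_stageInv]),
      mul_zero]

/-- Positivity of `r` gives absolute continuity and the quotient form of the likelihood ratio; the
total-mass correction in `klDiv` cancels between probability measures. -/
lemma klDiv_densityMeasure {ρ r : E d → ℝ} (hρ : IsProbDensity ρ) (hr : AEMeasurable r volume)
    (hpos : ∀ᵐ x, 0 < r x) [IsProbabilityMeasure (densityMeasure r)]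
    (hint : Integrable fun x => ρ x * Real.log (ρ x / r x)) :
    InformationTheory.klDiv (densityMeasure ρ) (densityMeasure r) =
      ENNReal.ofReal (∫ x, ρ x * Real.log (ρ x / r x)) := by
  have hρm : AEMeasurable (fun x => ENNReal.ofReal (ρ x)) volume :=
    hρ.integrable.1.aemeasurable.ennreal_ofReal
  have hρlt : ∀ᵐ x : E d, ENNReal.ofReal (ρ x) < ∞ := ae_of_all _ fun _ => ENNReal.ofReal_lt_top
  have hprob : IsProbabilityMeasure (densityMeasure ρ) := by
    refine ⟨?_⟩
    rw [densityMeasure, withDensity_apply _ MeasurableSet.univ, Measure.restrict_univ,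
      ← ofReal_integral_eq_lintegral_ofReal hρ.integrable (ae_of_all _ hρ.nonneg),
      hρ.integral_eq_one, ENNReal.ofReal_one]
  have hne : ∀ᵐ x : E d, ENNReal.ofReal (r x) ≠ 0 := hpos.mono fun x hx => by simpa using hx
  have hρv : densityMeasure ρ ≪ volume := withDensity_absolutelyContinuous _ _
  have hac : densityMeasure ρ ≪ densityMeasure r :=
    hρv.trans (withDensity_absolutelyContinuous' hr.ennreal_ofReal hne)
  have hllr : llr (densityMeasure ρ) (densityMeasure r) =ᵐ[volume]
      fun x => Real.log (ρ x / r x) := by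
    have h1 : (densityMeasure ρ).rnDeriv (densityMeasure r) =ᵐ[volume] _ :=
      Measure.rnDeriv_withDensity_right (densityMeasure ρ) volume hr.ennreal_ofReal hne
        (ae_of_all _ fun _ => ENNReal.ofReal_ne_top)
    have h2 : (densityMeasure ρ).rnDeriv volume =ᵐ[volume] fun x => ENNReal.ofReal (ρ x) :=
      Measure.rnDeriv_withDensity₀ volume hρm
    filter_upwards [h1, h2, hpos] with x hx1 hx2 hx3
    rw [llr, hx1, hx2, ENNReal.toReal_mul, ENNReal.toReal_inv, ENNReal.toReal_ofReal hx3.le,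
      ENNReal.toReal_ofReal (hρ.nonneg x), div_eq_inv_mul]
  have hi : Integrable (llr (densityMeasure ρ) (densityMeasure r)) (densityMeasure ρ) := by
    refine Integrable.congr ?_ (hρv.ae_eq hllr.symm)
    rw [densityMeasure, integrable_withDensity_iff_integrable_smul₀' hρm hρlt]
    refine hint.congr (ae_of_all _ fun x => ?_)
    simp [ENNReal.toReal_ofReal (hρ.nonneg x)]
  rw [InformationTheory.klDiv_of_ac_of_integrable hac hi, probReal_univ, probReal_univ,
    add_sub_cancel_right, integral_congr_ae (hρv.ae_eq hllr), densityMeasure,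
    integral_withDensity_eq_integral_toReal_smul₀ hρm hρlt]
  congr 2
  ext1 x
  simp [ENNReal.toReal_ofReal (hρ.nonneg x)]

lemma mul_log_div_eq_divIntegrand {ρ : E d → ℝ} {Ψ : E d → E d} {ℓ : E d → ℝ} {x : E d} {r : ℝ}
    (hr : r = gaussD (Ψ x) * Real.exp (ℓ x)) :
    ρ x * Real.log (ρ x / r) = divIntegrand ρ Ψ ℓ x := by
  rw [divIntegrand]
  rcases eq_or_ne (ρ x) 0 with h | h
  · simp [h]
  · rw [hr, Real.log_div h (mul_pos (gaussD_pos _) (Real.exp_pos _)).ne',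
      Real.log_mul (gaussD_pos _).ne' (Real.exp_pos _).ne', log_gaussD, Real.log_exp]
    ring

end NeuralFlow

end

/-! ### Assembly of the control and of both forms of the estimate. -/

theorem theorem1 (d : ℕ) (mB : EuclideanSpace ℝ (Fin d)) (SB : Matrix (Fin d) (Fin d) ℝ)
    (hSB : SB.PosDef)
    (ρstar : EuclideanSpace ℝ (Fin d) → ℝ) (hρ : NeuralFlow.IsProbDensity ρstar)
    (hlog : Integrable (fun x => ρstar x * Real.log (ρstar x)))
    (M σ : ℝ) (hM : 0 < M) (hσ : 0 < σ)
    (htail : ∀ x, M ≤ ‖x‖ → ρstar x ≤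
      1 / (2 * Real.pi * σ ^ 2) ^ ((d : ℝ) / 2) * Real.exp (-‖x‖ ^ 2 / (2 * σ ^ 2)))
    (T ε : ℝ) (hT : 0 < T) (hε : 0 < ε) :
    ∃ θ : ℝ → NeuralFlow.Param d, NeuralFlow.IsPiecewiseConstant T θ ∧
      -- the solution of the continuity equation exists, and satisfies the estimate
      (∃ ρ, NeuralFlow.IsSolution T θ
        (NeuralFlow.lebesgueDensity (ProbabilityTheory.multivariateGaussian mB SB)) ρ) ∧
      (∀ ρ, NeuralFlow.IsSolution T θ
        (NeuralFlow.lebesgueDensity (ProbabilityTheory.multivariateGaussian mB SB)) ρ →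
          (∀ᵐ x, 0 < ρ T x) ∧
          Integrable (fun x => ρstar x * Real.log (ρstar x / ρ T x)) ∧
          ∫ x, ρstar x * Real.log (ρstar x / ρ T x) ≤ ε) ∧
      -- the flow exists, and satisfies the equivalent estimate
      (∃ Φ, NeuralFlow.IsFlow T θ Φ) ∧
      (∀ Φ, NeuralFlow.IsFlow T θ Φ →
        InformationTheory.klDiv (NeuralFlow.densityMeasure ρstar)
          ((ProbabilityTheory.multivariateGaussian mB SB).map (Φ T)) ≤ ENNReal.ofReal ε) := by
  obtain ⟨Ψ, ℓ, hΨ, hi, hle⟩ := NeuralFlow.exists_reachable_divergence_le hρ hlog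
    (NeuralFlow.integrable_mul_sq_norm_of_tail hρ.nonneg hρ.integrable hσ htail) hε
  obtain ⟨A, ℓA, hA, hAae, hdens, hBi, hBb⟩ :=
    NeuralFlow.exists_reachable_multivariateGaussian mB hSB
  set ρB := NeuralFlow.lebesgueDensity (ProbabilityTheory.multivariateGaussian mB SB) with hρB
  -- The backward map goes through `Ψ` to standard Gaussian coordinates, then through `A` to those
  -- of the base. The number of stages is fixed before their length, so `T / n` is available.
  obtain ⟨n, hn, hstage⟩ := (hA.comp hΨ).exists_stage
  have hn' : (0 : ℝ) < n := by exact_mod_cast hn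
  set τ := T / n with hτ
  have hτ0 : 0 < τ := div_pos hT hn'
  have hTn : T = n * τ := by rw [hτ]; field_simp
  obtain ⟨p, hpinv, hplog⟩ := hstage τ hτ0.ne'
  -- The base density along `A` times the Jacobian of `A` is the standard Gaussian, which leaves its
  -- pullback under `Ψ`.
  have hr : ∀ᵐ x, NeuralFlow.stageDensity p τ ρB n x =
      NeuralFlow.gaussD (Ψ x) * Real.exp (ℓ x) := by
    filter_upwards [hΨ.isChange.quasiMeasurePreserving.ae hAae] with x hx
    rw [NeuralFlow.stageDensity_eq, hpinv, hplog, ← hx, Function.comp, Real.exp_add]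
    ring
  have hpos : ∀ᵐ x, 0 < NeuralFlow.stageDensity p τ ρB n x := by
    filter_upwards [hr] with x hx
    rw [hx]
    exact mul_pos (NeuralFlow.gaussD_pos _) (Real.exp_pos _)
  have hint : ∀ {r : EuclideanSpace ℝ (Fin d) → ℝ},
      r =ᵐ[volume] NeuralFlow.stageDensity p τ ρB n →
      Integrable (fun x => ρstar x * Real.log (ρstar x / r x)) ∧
        ∫ x, ρstar x * Real.log (ρstar x / r x) ≤ ε := by
    intro r hrr
    have h : (fun x => ρstar x * Real.log (ρstar x / r x)) =ᵐ[volume]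
        NeuralFlow.divIntegrand ρstar Ψ ℓ := by
      filter_upwards [hrr, hr] with x hx1 hx2
      exact NeuralFlow.mul_log_div_eq_divIntegrand (hx1.trans hx2)
    exact ⟨hi.congr h.symm, (integral_congr_ae h).trans_le hle⟩
  refine ⟨NeuralFlow.control p τ, ?_, ?_, fun ρ hsol => ?_, ?_, fun Φ hΦ => ?_⟩
  · rw [hTn]; exact NeuralFlow.isPiecewiseConstant_control p hτ0 n
  · rw [hTn]; exact ⟨_, NeuralFlow.isSolution_stageSolution p hτ0 hn hBi hBb⟩
  · rw [hTn] at hsol ⊢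
    have h := hsol.eq_stageDensity hτ0
    refine ⟨?_, hint h⟩
    filter_upwards [h, hpos] with x hx1 hx2
    rwa [hx1]
  · rw [hTn]; exact ⟨_, NeuralFlow.isFlow_stageCurve p hτ0 hn⟩
  · rw [hTn] at hΦ ⊢
    have hmap := NeuralFlow.map_densityMeasure_stageMap p τ n ρB
    rw [hdens] at hmap
    have hprob : IsProbabilityMeasure
        (NeuralFlow.densityMeasure (NeuralFlow.stageDensity p τ ρB n)) := by
      rw [← hmap]
      exact Measure.isProbabilityMeasure_map
        (NeuralFlow.continuous_stageMap p τ n).measurable.aemeasurable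
    obtain ⟨h1, h2⟩ := hint (ae_eq_refl _)
    rw [hΦ.eq_stageMap hτ0, hmap, NeuralFlow.klDiv_densityMeasure hρ
      (NeuralFlow.integrable_stageDensity p τ hBi n).1.aemeasurable hpos h1]
    exact ENNReal.ofReal_le_ofReal h2
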